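/- Let $\mathbb H_2$ be the space of symmetric complex $2\times2$ matrices $Z=\begin{pmatrix}z_0&z_1\\z_1&z_2\end{pmatrix}$ with positive definite imaginary part, with coordinates $z_0,z_1,z_2$. Let $\Gamma_2=\mathrm{Sp}(2,\mathbb Z)$ act on it by $MZ=(AZ+B)(CZ+D)^{-1}$ for $M=\begin{pmatrix}A&B\\C&D\end{pmatrix}$, and let $E$ denote the unit matrix. Let $\Gamma_2[2]$ be the kernel of $\mathrm{Sp}(2,\mathbb Z)\to \mathrm{Sp}(2,\mathbb Z/2\mathbb Z)$, let $\Gamma_2[2,4]$ be the set of $M\in\Gamma_2[2]$ for which $A\,{}^tB/2$ and $C\,{}^tD/2$ have even diagonal, and let $\Gamma_{2,0}[2]=\{M\in\Gamma_2:\ C\equiv0\bmod 2\}$. A theta characteristic is a pair $m=(a,b)$ with $a,b\in(\mathbb Z/2\mathbb Z)^2$; it is even if ${}^ta\,b=0$. Its theta constant is $$\vartheta[m](Z)=\sum_{g\in\mathbb Z^2}e^{\pi i\left({}^t(g+a/2)\,Z\,(g+a/2)+{}^tb\,(g+a/2)\right)},$$ where $\mathbb Z/2\mathbb Z$ is identified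 with $\{0,1\}$. The group $\Gamma_2$ acts on characteristics by $M\{m\}=\bigl(Da-Cb+(C\,{}^tD)_0,\ -Ba+Ab+(A\,{}^tB)_0\bigr)$, where $S_0$ is the diagonal of $S$. A set of four different even characteristics is syzygetic if the sum of any three different elements of it is even. Let $\mathfrak n=\{n_1,\dots,n_6\}$ be the complement, in the set of the ten even characteristics, of a syzygetic quadruple, and put $$T_{\mathfrak n}=\prod_{\nu=1}^6\vartheta[n_\nu],\qquad \omega_{\mathfrak n}=T_{\mathfrak n}\,dz_0\wedge dz_1\wedge dz_2 .$$ Let $\Gamma_{2,0}[2]_{\mathfrak n}$ be the set of all $M\in\Gamma_2$ that stabilize the quadruple complementary to $\mathfrak n$ and satisfy $T_{\mathfrak n}(MZ)=\det(CZ+D)^3\,T_{\mathfrak n}(Z)$ for all $Z\in\mathbb H_2$. (If the quadruple consists of all $(0,b)$, its stabilizer is $\Gamma_{2,0}[2]$.) **Proposition.** Let $F\subset\mathbb H_2$ be an irreducible component (a maximal irreducible analytic subset) of the zero locus of $\omega_{\mathfrak n}$ in $\mathbb H_2$. Then there exists $M\in\Gamma_2$ whose fixed point set $\{Z\in\mathbb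 H_2:\ MZ=Z\}$ is $F$ and which satisfies $M^2=E$. Every $M'\in\Gamma_2$ whose fixed point set is $F$ equals $M$ or $-M$. Moreover $M\in\Gamma_2[2,4]\cap\Gamma_{2,0}[2]_{\mathfrak n}$. -/

import Mathlib

open Matrix

noncomputable section

namespace SiegelTheta

/-! ### The Siegel modular group, its action, and congruence subgroups -/

/-- The generalized half plane: symmetric complex matrices with positive definite imaginary
part. -/
def siegelUpperHalf (n : ℕ) : Set (Matrix (Fin n) (Fin n) ℂ) :=
  {Z | Zᵀ = Z ∧ (Z.map Complex.im).PosDef}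

/-- The Siegel modular group `Sp(n, ℤ)`. -/
abbrev SiegelModularGroup (n : ℕ) : Type :=
  ↥(Matrix.symplecticGroup (Fin n) ℤ)

variable {n : ℕ}

/-- The upper left block of `M = (A B; C D)`. -/
def blockA (M : SiegelModularGroup n) : Matrix (Fin n) (Fin n) ℤ := M.1.toBlocks₁₁

/-- The upper right block of `M = (A B; C D)`. -/
def blockB (M : SiegelModularGroup n) : Matrix (Fin n) (Fin n) ℤ := M.1.toBlocks₁₂

/-- The lower left block of `M = (A B; C D)`. -/
def blockC (M : SiegelModularGroup n) : Matrix (Fin n) (Fin n) ℤ := M.1.toBlocks₂₁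

/-- The lower right block of `M = (A B; C D)`. -/
def blockD (M : SiegelModularGroup n) : Matrix (Fin n) (Fin n) ℤ := M.1.toBlocks₂₂

/-- The matrix `C Z + D`. -/
def denom (M : SiegelModularGroup n) (Z : Matrix (Fin n) (Fin n) ℂ) :
    Matrix (Fin n) (Fin n) ℂ :=
  (blockC M).map (fun x : ℤ => (x : ℂ)) * Z + (blockD M).map (fun x : ℤ => (x : ℂ))

/-- The action `M Z = (A Z + B) (C Z + D)⁻¹` on the generalized half plane
(where `C Z + D` is always invertible). -/
def act (M : SiegelModularGroup n) (Z : Matrix (Fin n) (Fin n) ℂ) :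
    Matrix (Fin n) (Fin n) ℂ :=
  ((blockA M).map (fun x : ℤ => (x : ℂ)) * Z + (blockB M).map (fun x : ℤ => (x : ℂ))) *
    (denom M Z)⁻¹

/-- The principal congruence subgroup `Γ_n[l]`: the kernel of reduction modulo `l`. -/
def principalCongruence (n l : ℕ) : Set (SiegelModularGroup n) :=
  {M | M.1.map (fun x : ℤ => (x : ZMod l)) = 1}

/-- Igusa's subgroup `Γ_n[l, 2l]`: those `M` in `Γ_n[l]` for which `A Bᵀ / l` and `C Dᵀ / l`
have even diagonal. -/
def igusaSubgroup (n l : ℕ) : Set (SiegelModularGroup n) :=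
  {M | M ∈ principalCongruence n l ∧
    ∀ i, (2 * (l : ℤ)) ∣ (blockA M * (blockB M)ᵀ) i i ∧
      (2 * (l : ℤ)) ∣ (blockC M * (blockD M)ᵀ) i i}

/-- The group `Γ_{n,0}[l]`: those `M` with `C ≡ 0` modulo `l`. -/
def heckeSubgroup (n l : ℕ) : Set (SiegelModularGroup n) :=
  {M | ∀ i j, (l : ℤ) ∣ blockC M i j}

/-! ### Theta characteristics and theta constants -/

/-- A theta characteristic `m = (a, b)` with `a, b` in `(ℤ/2ℤ)^n`. -/
abbrev Characteristic (n : ℕ) : Type := (Fin n → ZMod 2) × (Fin n → ZMod 2)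

/-- The characteristic `(a, b)` is even if `ᵗa b = 0` in `ℤ/2ℤ`. -/
def IsEvenChar (m : Characteristic n) : Prop := m.1 ⬝ᵥ m.2 = 0

instance : DecidablePred (IsEvenChar (n := n)) := fun m =>
  inferInstanceAs (Decidable (m.1 ⬝ᵥ m.2 = 0))

/-- The action of the modular group on characteristics,
`M{m} = ᵗM⁻¹ m + ((C ᵗD)₀, (A ᵗB)₀)`, written in blocks with `ᵗM⁻¹ = (D -C; -B A)`; here `S₀`
is the diagonal of `S`. It is the action for which `ϑ[M{m}](M Z)` is an eighth root of unity
times `det (C Z + D) ^ (1/2) ϑ[m](Z)`. -/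
def charAct (M : SiegelModularGroup n) (m : Characteristic n) : Characteristic n :=
  let A := (blockA M).map (fun x : ℤ => (x : ZMod 2))
  let B := (blockB M).map (fun x : ℤ => (x : ZMod 2))
  let C := (blockC M).map (fun x : ℤ => (x : ZMod 2))
  let D := (blockD M).map (fun x : ℤ => (x : ZMod 2))
  (D *ᵥ m.1 - C *ᵥ m.2 + (C * Dᵀ).diag, -(B *ᵥ m.1) + A *ᵥ m.2 + (A * Bᵀ).diag)

/-- The theta constant
`ϑ[m](Z) = ∑_{g ∈ ℤ^n} exp (π i (Z[g + a/2] + ᵗb (g + a/2)))`, where `Z[x] = ᵗx Z x` and `ℤ/2ℤ`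
is identified with `{0, 1}`. -/
def theta (m : Characteristic n) (Z : Matrix (Fin n) (Fin n) ℂ) : ℂ :=
  ∑' g : Fin n → ℤ,
    let x : Fin n → ℂ := fun i => (g i : ℂ) + ((m.1 i).val : ℂ) / 2
    let b : Fin n → ℂ := fun i => ((m.2 i).val : ℂ)
    Complex.exp (Real.pi * Complex.I * (x ⬝ᵥ (Z *ᵥ x) + b ⬝ᵥ x))

/-! ### Degree two: syzygetic quadruples and complementary sextuples -/

/-- The even characteristics in degree two. -/
def evenChars : Finset (Characteristic 2) := Finset.univ.filter IsEvenChar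

/-- A syzygetic quadruple: four pairwise different even characteristics such that the sum of
any three of them is even. -/
def IsSyzygeticQuadruple (Q : Finset (Characteristic 2)) : Prop :=
  Q.card = 4 ∧ (∀ m ∈ Q, IsEvenChar m) ∧
    ∀ m₁ ∈ Q, ∀ m₂ ∈ Q, ∀ m₃ ∈ Q, m₁ ≠ m₂ → m₁ ≠ m₃ → m₂ ≠ m₃ → IsEvenChar (m₁ + m₂ + m₃)

/-- A sextuple of even characteristics complementary to a syzygetic quadruple. -/
def IsComplementarySextuple (N : Finset (Characteristic 2)) : Prop :=
  ∃ Q, IsSyzygeticQuadruple Q ∧ N = evenChars \ Q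

/-- The standard syzygetic quadruple: all `(0, b)`. -/
def standardQuadruple : Finset (Characteristic 2) := Finset.univ.filter (fun m => m.1 = 0)

/-- The product `T = ∏ ϑ[n_ν](Z)` over the characteristics in `N`. -/
def thetaProd (N : Finset (Characteristic 2)) (Z : Matrix (Fin 2) (Fin 2) ℂ) : ℂ :=
  ∏ m ∈ N, theta m Z

/-- The conjugate of `Γ_{2,0}[2]` belonging to the sextuple `N`: the stabilizer of the syzygetic
quadruple complementary to `N` (equivalently, of `N`) in the modular group. -/
def sextupleGroup (N : Finset (Characteristic 2)) : Set (SiegelModularGroup 2) :=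
  {M | (evenChars \ N).image (charAct M) = evenChars \ N}

/-- For the sextuple complementary to the standard quadruple the group is `Γ_{2,0}[2]`. -/
theorem sextupleGroup_standard :
    sextupleGroup (evenChars \ standardQuadruple) = heckeSubgroup 2 2 := by
  have hQ : evenChars \ (evenChars \ standardQuadruple) = standardQuadruple := by decide
  ext M
  simp only [sextupleGroup, heckeSubgroup, hQ, Set.mem_ofPred_eq]
  have hC : (∀ i j, ((2 : ℕ) : ℤ) ∣ blockC M i j) ↔
      (blockC M).map (fun x : ℤ => (x : ZMod 2)) = 0 := by
    rw [← Matrix.ext_iff]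
    simp only [Matrix.map_apply, Matrix.zero_apply, ZMod.intCast_zmod_eq_zero_iff_dvd]
  rw [hC]
  constructor
  · intro h
    have key : ∀ b : Fin 2 → ZMod 2, (charAct M (0, b)).1 = 0 := by
      intro b
      have h1 : charAct M (0, b) ∈ standardQuadruple := by
        rw [← h]
        exact Finset.mem_image_of_mem _ (by simp [standardQuadruple])
      simpa [standardQuadruple] using h1
    simp only [charAct, Matrix.mulVec_zero, zero_sub] at key
    have h0 := key 0
    simp only [Matrix.mulVec_zero, neg_zero, zero_add] at h0
    rw [h0] at key
    simp only [add_zero, neg_eq_zero] at key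
    exact Matrix.ext_of_mulVec_single fun i => by
      ext k
      simpa using congrFun (key (Pi.single i 1)) k
  · intro h
    have hMJ := SymplecticGroup.mem_iff.mp M.2
    have hAD : blockA M * (blockD M)ᵀ - blockB M * (blockC M)ᵀ = 1 := by
      have h2 := hMJ
      rw [← Matrix.fromBlocks_toBlocks M.1] at h2
      simp only [Matrix.J, Matrix.fromBlocks_transpose, Matrix.fromBlocks_multiply,
        Matrix.fromBlocks_inj] at h2
      have h3 := h2.2.1
      simp only [Matrix.mul_zero, Matrix.mul_one, Matrix.mul_neg, Matrix.neg_mul, zero_add,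
        add_zero] at h3
      have h4 := congrArg Neg.neg h3
      rw [neg_neg] at h4
      rw [← h4]
      simp only [blockA, blockB, blockC, blockD]
      abel
    have hAD2 : (blockD M).map (fun x : ℤ => (x : ZMod 2)) *
        ((blockA M).map (fun x : ℤ => (x : ZMod 2)))ᵀ = 1 := by
      have h5 := congrArg
        (fun X : Matrix (Fin 2) (Fin 2) ℤ => (X.map (Int.castRingHom (ZMod 2)))ᵀ) hAD
      have h6 : (blockC M).map (Int.castRingHom (ZMod 2)) = 0 := h
      simp only [Matrix.map_sub _ (map_sub (Int.castRingHom (ZMod 2))), Matrix.map_mul,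
        Matrix.transpose_sub, Matrix.transpose_mul, Matrix.transpose_map, h6,
        Matrix.transpose_transpose, Matrix.zero_mul, sub_zero,
        Matrix.map_one _ (map_zero _) (map_one _), Matrix.transpose_one] at h5
      exact h5
    have hinj : ∀ b b' : Fin 2 → ZMod 2,
        (blockA M).map (fun x : ℤ => (x : ZMod 2)) *ᵥ b =
          (blockA M).map (fun x : ℤ => (x : ZMod 2)) *ᵥ b' → b = b' := by
      intro b b' hb
      have h7 := congrArg Matrix.transpose hAD2
      rw [Matrix.transpose_mul, Matrix.transpose_transpose, Matrix.transpose_one,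
        mul_eq_one_comm] at h7
      have h8 := congrArg
        (fun v => ((blockD M).map (fun x : ℤ => (x : ZMod 2)))ᵀ *ᵥ v) hb
      simpa only [Matrix.mulVec_mulVec, h7, Matrix.one_mulVec] using h8
    refine Finset.eq_of_subset_of_card_le ?_ ?_
    · intro m hm
      obtain ⟨⟨a, b⟩, hab, rfl⟩ := Finset.mem_image.mp hm
      have ha : a = 0 := by simpa [standardQuadruple] using hab
      subst ha
      simp [standardQuadruple, charAct, h]
    · rw [Finset.card_image_of_injOn]
      rintro ⟨a, b⟩ hab ⟨a', b'⟩ hab' hEq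
      have ha : a = 0 := by simpa [standardQuadruple] using hab
      have ha' : a' = 0 := by simpa [standardQuadruple] using hab'
      subst ha ha'
      simp only [charAct, Matrix.mulVec_zero, neg_zero, zero_add, Prod.mk.injEq,
        add_left_inj] at hEq
      rw [hinj b b' hEq.2]

/-- The kernel, in the group belonging to `N`, of the character `χ` defined by
`T(M Z) = χ(M) det (C Z + D) ^ 3 T(Z)`. -/
def sextupleKernel (N : Finset (Characteristic 2)) : Set (SiegelModularGroup 2) :=
  {M | M ∈ sextupleGroup N ∧ ∀ Z ∈ siegelUpperHalf 2,
    thetaProd N (act M Z) = (denom M Z).det ^ 3 * thetaProd N Z}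

/-! ### Analytic subsets and their irreducible components -/

section Analytic

variable {E : Type*} [NormedAddCommGroup E] [NormedSpace ℂ E]

/-- `A` is an analytic subset of the open set `Ω`: every point of `Ω` has an open neighbourhood
in which `A` is the common zero set of finitely many holomorphic functions. -/
def IsAnalyticSubset (Ω A : Set E) : Prop :=
  A ⊆ Ω ∧ ∀ p ∈ Ω, ∃ U : Set E, IsOpen U ∧ p ∈ U ∧ U ⊆ Ω ∧
    ∃ (k : ℕ) (f : Fin k → E → ℂ), (∀ i, DifferentiableOn ℂ (f i) U) ∧
      A ∩ U = {z | z ∈ U ∧ ∀ i, f i z = 0}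

/-- An irreducible analytic subset of `Ω`: non-empty, and not the union of two proper analytic
subsets. -/
def IsIrreducibleAnalytic (Ω A : Set E) : Prop :=
  IsAnalyticSubset Ω A ∧ A.Nonempty ∧
    ∀ A₁ A₂, IsAnalyticSubset Ω A₁ → IsAnalyticSubset Ω A₂ → A = A₁ ∪ A₂ → A = A₁ ∨ A = A₂

/-- An irreducible component of the analytic subset `X` of `Ω`: a maximal irreducible analytic
subset of `Ω` contained in `X`. -/
def IsIrreducibleComponent (Ω X F : Set E) : Prop :=
  Maximal (fun G => IsIrreducibleAnalytic Ω G ∧ G ⊆ X) F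

end Analytic

/-! ### The half plane of degree two in coordinates and the differential form -/

/-- The symmetric matrix `(z₀ z₁; z₁ z₂)`. -/
def symMat (z : Fin 3 → ℂ) : Matrix (Fin 2) (Fin 2) ℂ := !![z 0, z 1; z 1, z 2]

/-- The generalized half plane of degree two in the coordinates `z₀, z₁, z₂`. -/
def halfSpaceTwo : Set (Fin 3 → ℂ) := {z | symMat z ∈ siegelUpperHalf 2}

/-- The differential form `ω = T dz₀ ∧ dz₁ ∧ dz₂`; at every point `dz₀ ∧ dz₁ ∧ dz₂` is the
determinant form with respect to the standard basis of `ℂ³`. -/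
def omegaForm (N : Finset (Characteristic 2)) (z : Fin 3 → ℂ) : (Fin 3 → ℂ) [⋀^Fin 3]→ₗ[ℂ] ℂ :=
  thetaProd N (symMat z) • (Pi.basisFun ℂ (Fin 3)).det

/-- The zero locus of `ω` in the generalized half plane. -/
def omegaZeroLocus (N : Finset (Characteristic 2)) : Set (Fin 3 → ℂ) :=
  {z | z ∈ halfSpaceTwo ∧ omegaForm N z = 0}

/-- The fixed point set of `M` in the generalized half plane, in coordinates. -/
def fixedPointSet (M : SiegelModularGroup 2) : Set (Fin 3 → ℂ) :=
  {z | z ∈ halfSpaceTwo ∧ act M (symMat z) = symMat z}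

end SiegelTheta

end

/-!
The zero locus of `ω` is the union of the zero loci of the six theta constants in the product. The
result rests on the classical fact that an even theta constant of degree two vanishes exactly on
modular translates of the diagonal `z₁ = 0`, and the diagonal is the fixed point set of the
reflection `z₁ ↦ -z₁`, which is given by the modular matrix `diag (1, -1, 1, -1)`.

To see that all zeros arise in this way, a zero `Z` is moved to a point of a reduced domain
(`exists_isReduced`) by an element of a group of modular matrices that permute the theta constants
up to non-vanishing factors (`thetaCovariantGroup`; the transformation laws of its generators
include the partial inversion `z₀ ↦ -1/z₀`, which follows from the functional equation of the
one-dimensional theta function). The reduction minimizes the lower right entry of `(Im Z)⁻¹` over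
the orbit and applies the one-dimensional reduction theory to `z₀`. In the reduced domain the
leading terms of the series dominate, so the even theta constants have no zeros there apart from
those of the characteristic `(1, 1)` on the diagonal (`eq_one_and_eq_zero_of_theta_eq_zero`). For
that characteristic the series is compared, term by term, with its leading part, which is divisible
by the odd function `X - X⁻¹`, `X = exp (π i z₁ / 2)`.

Hence the zero locus is the union of the fixed point sets of certain conjugates `g⁻¹ R g` of the
reflection `R` (`IsThetaInvolution`). Each of these sets is a holomorphic image of a product of two
upper half planes and therefore irreducible (`isIrreducibleAnalytic_fixedPointSet`), and they form a
locally finite family (`exists_isOpen_finite_fixedPointSet`). So an irreducible component is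
contained in one of them (`IsIrreducibleAnalytic.exists_subset`), and by maximality it is equal to
it.

The remaining claims are algebraic. A modular matrix that fixes the diagonal is `±1` or `±R`
(`eq_of_fixes_diag`), which gives uniqueness. A conjugate of `R` is an involution congruent to `1`
modulo `2`, so its off-diagonal blocks are alternating, which makes it an element of Igusa's group.
Finally `R` changes the sign of the theta constant of characteristic `(1, 1)` only, among the even
ones, while `det (C Z + D) ^ 3 = -1`; by the cocycle relation the product of six theta constants
that contains a translate of this one is invariant in weight `3` under the conjugate of `R`
(`thetaProd_act_of_isThetaInvolution`).
-/

noncomputable section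

namespace SiegelTheta

/-! ### The action of the Siegel modular group on the half plane -/

section Action

open scoped ComplexOrder

variable {n : ℕ}

/-- The matrix `A Z + B`, so that `act M Z = num M Z * (denom M Z)⁻¹`. -/
def num (M : SiegelModularGroup n) (Z : Matrix (Fin n) (Fin n) ℂ) : Matrix (Fin n) (Fin n) ℂ :=
  (blockA M).map (fun x : ℤ => (x : ℂ)) * Z + (blockB M).map (fun x : ℤ => (x : ℂ))

lemma act_eq (M : SiegelModularGroup n) (Z : Matrix (Fin n) (Fin n) ℂ) :
    act M Z = num M Z * (denom M Z)⁻¹ := rfl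

lemma fromBlocks_block (M : SiegelModularGroup n) :
    fromBlocks (blockA M) (blockB M) (blockC M) (blockD M) = M.1 :=
  fromBlocks_toBlocks M.1

lemma block_mul (M M' : SiegelModularGroup n) :
    blockA (M * M') = blockA M * blockA M' + blockB M * blockC M' ∧
    blockB (M * M') = blockA M * blockB M' + blockB M * blockD M' ∧
    blockC (M * M') = blockC M * blockA M' + blockD M * blockC M' ∧
    blockD (M * M') = blockC M * blockB M' + blockD M * blockD M' := by
  have h : (M * M').1 = M.1 * M'.1 := rfl
  rw [← fromBlocks_block, ← fromBlocks_block M, ← fromBlocks_block M', fromBlocks_multiply,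
    fromBlocks_inj] at h
  exact h

lemma block_one : blockA (1 : SiegelModularGroup n) = 1 ∧ blockB (1 : SiegelModularGroup n) = 0 ∧
    blockC (1 : SiegelModularGroup n) = 0 ∧ blockD (1 : SiegelModularGroup n) = 1 := by
  have h : (1 : SiegelModularGroup n).1 = 1 := rfl
  rw [← fromBlocks_block, ← fromBlocks_one, fromBlocks_inj] at h
  exact h

lemma block_inv (M : SiegelModularGroup n) :
    blockA M⁻¹ = (blockD M)ᵀ ∧ blockB M⁻¹ = -(blockB M)ᵀ ∧
    blockC M⁻¹ = -(blockC M)ᵀ ∧ blockD M⁻¹ = (blockA M)ᵀ := by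
  have h := SymplecticGroup.coe_inv M
  rw [← fromBlocks_block, ← fromBlocks_block M, fromBlocks_transpose, J, fromBlocks_neg,
    fromBlocks_multiply, fromBlocks_multiply, fromBlocks_inj] at h
  simpa using h

lemma block_relations (M : SiegelModularGroup n) :
    (blockA M)ᵀ * blockC M = (blockC M)ᵀ * blockA M ∧
    (blockB M)ᵀ * blockD M = (blockD M)ᵀ * blockB M ∧
    (blockA M)ᵀ * blockD M - (blockC M)ᵀ * blockB M = 1 :=
  SymplecticGroup.fromBlocks_mem_iff.mp (by rw [fromBlocks_block]; exact M.2)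

lemma map_intCast_mul (A B : Matrix (Fin n) (Fin n) ℤ) :
    (A * B).map (fun x : ℤ => (x : ℂ)) =
      A.map (fun x : ℤ => (x : ℂ)) * B.map (fun x : ℤ => (x : ℂ)) :=
  Matrix.map_mul (f := Int.castRingHom ℂ)

lemma map_intCast_add (A B : Matrix (Fin n) (Fin n) ℤ) :
    (A + B).map (fun x : ℤ => (x : ℂ)) =
      A.map (fun x : ℤ => (x : ℂ)) + B.map (fun x : ℤ => (x : ℂ)) := by
  ext; simp

lemma map_intCast_sub (A B : Matrix (Fin n) (Fin n) ℤ) :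
    (A - B).map (fun x : ℤ => (x : ℂ)) =
      A.map (fun x : ℤ => (x : ℂ)) - B.map (fun x : ℤ => (x : ℂ)) := by
  ext; simp

lemma map_intCast_one :
    (1 : Matrix (Fin n) (Fin n) ℤ).map (fun x : ℤ => (x : ℂ)) = 1 :=
  Matrix.map_one _ Int.cast_zero Int.cast_one

/-- The invariance of the symplectic form, evaluated on the columns of `(W; 1)` and `(Z; 1)`. -/
lemma denom_transpose_mul_num_sub (M : SiegelModularGroup n) (W Z : Matrix (Fin n) (Fin n) ℂ) :
    (denom M W)ᵀ * num M Z - (num M W)ᵀ * denom M Z = Z - Wᵀ := by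
  obtain ⟨h1, h2, h3⟩ := block_relations M
  have h4 := congrArg Matrix.transpose h3
  simp only [transpose_sub, transpose_mul, transpose_transpose, transpose_one] at h4
  replace h1 := congrArg (fun X => X.map (fun x : ℤ => (x : ℂ))) h1
  replace h2 := congrArg (fun X => X.map (fun x : ℤ => (x : ℂ))) h2
  replace h3 := congrArg (fun X => X.map (fun x : ℤ => (x : ℂ))) h3
  replace h4 := congrArg (fun X => X.map (fun x : ℤ => (x : ℂ))) h4
  simp only [map_intCast_mul, map_intCast_sub, map_intCast_one, transpose_map] at h1 h2 h3 h4
  simp only [denom, num]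
  generalize (blockA M).map (fun x : ℤ => (x : ℂ)) = A at *
  generalize (blockB M).map (fun x : ℤ => (x : ℂ)) = B at *
  generalize (blockC M).map (fun x : ℤ => (x : ℂ)) = C at *
  generalize (blockD M).map (fun x : ℤ => (x : ℂ)) = D at *
  have e : (C * W + D)ᵀ * (A * Z + B) - (A * W + B)ᵀ * (C * Z + D) =
      Wᵀ * (Cᵀ * A - Aᵀ * C) * Z - Wᵀ * (Aᵀ * D - Cᵀ * B) + (Dᵀ * A - Bᵀ * C) * Z +
      (Dᵀ * B - Bᵀ * D) := by
    simp only [transpose_add, transpose_mul]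
    noncomm_ring
  rw [e, h1, h2, h3, h4]
  simp only [sub_self]
  noncomm_ring

lemma num_one (Z : Matrix (Fin n) (Fin n) ℂ) : num 1 Z = Z := by
  obtain ⟨a, b, -, -⟩ := block_one (n := n)
  simp [num, a, b]

lemma denom_one (Z : Matrix (Fin n) (Fin n) ℂ) : denom 1 Z = 1 := by
  obtain ⟨-, -, a, b⟩ := block_one (n := n)
  simp [denom, a, b]

lemma act_one (Z : Matrix (Fin n) (Fin n) ℂ) : act 1 Z = Z := by
  simp [act_eq, num_one, denom_one]

lemma denom_map_conj (M : SiegelModularGroup n) (Z : Matrix (Fin n) (Fin n) ℂ) :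
    denom M (Zᴴᵀ) = (denom M Z)ᴴᵀ := by
  ext i j
  simp [denom, Matrix.mul_apply, mul_comm]

lemma num_map_conj (M : SiegelModularGroup n) (Z : Matrix (Fin n) (Fin n) ℂ) :
    num M (Zᴴᵀ) = (num M Z)ᴴᵀ := by
  ext i j
  simp [num, Matrix.mul_apply, mul_comm]

lemma denom_conjTranspose_mul_num_sub (M : SiegelModularGroup n)
    (Z : Matrix (Fin n) (Fin n) ℂ) :
    (denom M Z)ᴴ * num M Z - (num M Z)ᴴ * denom M Z = Z - Zᴴ := by
  have h := denom_transpose_mul_num_sub M (Zᴴᵀ) Z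
  simpa only [denom_map_conj, num_map_conj, transpose_transpose] using h

/-- The imaginary part of `Z`, as a complex matrix. -/
def imC (Z : Matrix (Fin n) (Fin n) ℂ) : Matrix (Fin n) (Fin n) ℂ :=
  (Z.map Complex.im).map (fun x : ℝ => (x : ℂ))

lemma posDef_map_ofReal {Y : Matrix (Fin n) (Fin n) ℝ} :
    (Y.map (fun x : ℝ => (x : ℂ))).PosDef ↔ Y.PosDef := by
  constructor
  · intro h
    refine .of_dotProduct_mulVec_pos ?_ fun x hx => ?_
    · ext i j
      have := congrFun (congrFun h.1 i) j
      simpa using this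
    · have hx' : (fun i => (x i : ℂ)) ≠ 0 := by
        intro h0
        apply hx
        ext i
        simpa using congrFun h0 i
      have := h.dotProduct_mulVec_pos hx'
      have e : star (fun i => (x i : ℂ)) ⬝ᵥ (Y.map (fun x : ℝ => (x : ℂ)) *ᵥ fun i => (x i : ℂ)) =
          ((star x ⬝ᵥ (Y *ᵥ x) : ℝ) : ℂ) := by
        simp [dotProduct, mulVec]
      rw [e] at this
      exact_mod_cast this
  · intro h
    have hsymm : ∀ i j, Y j i = Y i j := fun i j => by
      have := congrFun (congrFun h.1 i) j
      simpa using this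
    refine .of_dotProduct_mulVec_pos ?_ fun x hx => ?_
    · ext i j
      simp [hsymm i j]
    · set a : Fin n → ℝ := fun i => (x i).re with ha
      set b : Fin n → ℝ := fun i => (x i).im with hb
      have hab : a ⬝ᵥ (Y *ᵥ b) = b ⬝ᵥ (Y *ᵥ a) := by
        rw [dotProduct_mulVec, ← mulVec_transpose, dotProduct_comm]
        congr 2
        ext i j
        exact hsymm i j
      have e : star x ⬝ᵥ (Y.map (fun x : ℝ => (x : ℂ)) *ᵥ x) =
          ((a ⬝ᵥ (Y *ᵥ a) + b ⬝ᵥ (Y *ᵥ b) : ℝ) : ℂ) := by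
        have hab' := sub_eq_zero.mpr hab
        apply Complex.ext
        · simp only [dotProduct, mulVec, Complex.re_sum, Complex.im_sum, Pi.star_apply,
            RCLike.star_def, Complex.mul_re, Complex.mul_im, Matrix.map_apply, Complex.ofReal_re,
            Complex.ofReal_im, Complex.conj_re, Complex.conj_im, zero_mul, sub_zero, add_zero,
            neg_mul, sub_neg_eq_add, Finset.sum_add_distrib, ha, hb]
        · simp only [dotProduct, mulVec, ha, hb] at hab'
          simp only [dotProduct, mulVec, Complex.re_sum, Complex.im_sum, Pi.star_apply,
            RCLike.star_def, Complex.mul_re, Complex.mul_im, Matrix.map_apply, Complex.ofReal_re,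
            Complex.ofReal_im, Complex.conj_re, Complex.conj_im, zero_mul, sub_zero, add_zero,
            neg_mul, Finset.sum_add_distrib, Finset.sum_neg_distrib]
          linarith
      rw [e]
      have h0 : a ≠ 0 ∨ b ≠ 0 := by
        by_contra! hc
        apply hx
        ext i
        exact Complex.ext (congrFun hc.1 i) (congrFun hc.2 i)
      have pa := h.posSemidef.dotProduct_mulVec_nonneg a
      have pb := h.posSemidef.dotProduct_mulVec_nonneg b
      simp only [star_trivial] at pa pb
      have : 0 < a ⬝ᵥ (Y *ᵥ a) + b ⬝ᵥ (Y *ᵥ b) := by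
        rcases h0 with h0 | h0
        · have := h.dotProduct_mulVec_pos h0
          simp only [star_trivial] at this
          linarith
        · have := h.dotProduct_mulVec_pos h0
          simp only [star_trivial] at this
          linarith
      exact_mod_cast this

lemma sub_conjTranspose_of_symm {Z : Matrix (Fin n) (Fin n) ℂ} (h : Zᵀ = Z) :
    Z - Zᴴ = (2 * Complex.I) • imC Z := by
  ext i j
  have := congrFun (congrFun h i) j
  simp only [transpose_apply] at this
  simp only [Matrix.sub_apply, conjTranspose_apply, this, imC, Matrix.smul_apply,
    Matrix.map_apply, smul_eq_mul]
  apply Complex.ext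
  · simp
  · simp
    ring

lemma imC_posDef {Z : Matrix (Fin n) (Fin n) ℂ} (hZ : Z ∈ siegelUpperHalf n) : (imC Z).PosDef :=
  posDef_map_ofReal.mpr hZ.2

lemma denom_conj_identity (M : SiegelModularGroup n) {Z : Matrix (Fin n) (Fin n) ℂ}
    (hZ : Zᵀ = Z) :
    (denom M Z)ᴴ * num M Z - (num M Z)ᴴ * denom M Z = (2 * Complex.I) • imC Z := by
  rw [denom_conjTranspose_mul_num_sub, sub_conjTranspose_of_symm hZ]

lemma isUnit_denom (M : SiegelModularGroup n) {Z : Matrix (Fin n) (Fin n) ℂ}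
    (hZ : Z ∈ siegelUpperHalf n) : IsUnit (denom M Z).det := by
  rw [isUnit_iff_ne_zero]
  intro h0
  obtain ⟨v, hv, hRv⟩ := exists_mulVec_eq_zero_iff.mpr h0
  have h := denom_conj_identity M hZ.1
  have h2 := congrArg (fun X => star v ⬝ᵥ (X *ᵥ v)) h
  simp only [sub_mulVec, ← mulVec_mulVec, hRv, mulVec_zero, sub_zero, smul_mulVec,
    dotProduct_smul] at h2
  rw [dotProduct_mulVec, ← star_mulVec, hRv] at h2
  have h3 := (imC_posDef hZ).dotProduct_mulVec_pos hv
  have : (2 * Complex.I) • (star v ⬝ᵥ (imC Z *ᵥ v)) ≠ 0 :=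
    smul_ne_zero (by simp) h3.ne'
  exact this (by rw [← h2]; simp)

lemma det_denom_ne_zero (M : SiegelModularGroup n) {Z : Matrix (Fin n) (Fin n) ℂ}
    (hZ : Z ∈ siegelUpperHalf n) : (denom M Z).det ≠ 0 :=
  (isUnit_denom M hZ).ne_zero

lemma act_mul_denom (M : SiegelModularGroup n) {Z : Matrix (Fin n) (Fin n) ℂ}
    (hZ : Z ∈ siegelUpperHalf n) : act M Z * denom M Z = num M Z := by
  rw [act_eq, nonsing_inv_mul_cancel_right _ _ (isUnit_denom M hZ)]

lemma act_transpose (M : SiegelModularGroup n) {Z : Matrix (Fin n) (Fin n) ℂ}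
    (hZ : Z ∈ siegelUpperHalf n) : (act M Z)ᵀ = act M Z := by
  have h := denom_transpose_mul_num_sub M Z Z
  rw [hZ.1, sub_self, ← act_mul_denom M hZ, transpose_mul] at h
  have hu := isUnit_denom M hZ
  have hu' : IsUnit ((denom M Z)ᵀ).det := by rwa [det_transpose]
  have h2 : (denom M Z)ᵀ * (act M Z - (act M Z)ᵀ) * denom M Z = 0 := by
    rw [← h]; noncomm_ring
  have h3 : (denom M Z)ᵀ * (act M Z - (act M Z)ᵀ) = 0 := by
    have := congrArg (· * (denom M Z)⁻¹) h2
    simpa [mul_nonsing_inv_cancel_right _ _ hu] using this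
  have h4 : act M Z - (act M Z)ᵀ = 0 := by
    have := congrArg (((denom M Z)ᵀ)⁻¹ * ·) h3
    simpa [nonsing_inv_mul_cancel_left _ _ hu'] using this
  exact (sub_eq_zero.mp h4).symm

/-- The transformation law `Im Z = (C Z + D)ᴴ Im(M Z) (C Z + D)`. -/
lemma imC_eq (M : SiegelModularGroup n) {Z : Matrix (Fin n) (Fin n) ℂ}
    (hZ : Z ∈ siegelUpperHalf n) :
    imC Z = (denom M Z)ᴴ * imC (act M Z) * denom M Z := by
  have h := denom_conj_identity M hZ.1
  rw [← act_mul_denom M hZ, conjTranspose_mul] at h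
  have h2 : (denom M Z)ᴴ * (act M Z - (act M Z)ᴴ) * denom M Z = (2 * Complex.I) • imC Z := by
    rw [← h]; noncomm_ring
  rw [sub_conjTranspose_of_symm (act_transpose M hZ), mul_smul_comm, smul_mul_assoc] at h2
  have := smul_right_injective (Matrix (Fin n) (Fin n) ℂ)
    (show (2 * Complex.I : ℂ) ≠ 0 by simp) h2
  exact this.symm

lemma act_mem (M : SiegelModularGroup n) {Z : Matrix (Fin n) (Fin n) ℂ}
    (hZ : Z ∈ siegelUpperHalf n) : act M Z ∈ siegelUpperHalf n := by
  refine ⟨act_transpose M hZ, ?_⟩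
  rw [← posDef_map_ofReal]
  have h := imC_posDef hZ
  rw [imC_eq M hZ] at h
  have hu : IsUnit (denom M Z) := (isUnit_iff_isUnit_det _).mpr (isUnit_denom M hZ)
  exact (hu.posDef_star_left_conjugate_iff).mp h

lemma num_mul (M M' : SiegelModularGroup n) {Z : Matrix (Fin n) (Fin n) ℂ}
    (hZ : Z ∈ siegelUpperHalf n) :
    num (M * M') Z = num M (act M' Z) * denom M' Z := by
  obtain ⟨a, b, -, -⟩ := block_mul M M'
  rw [num, num, add_mul, mul_assoc, act_mul_denom M' hZ, a, b]
  simp only [map_intCast_add, map_intCast_mul, num, denom]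
  noncomm_ring

/-- The cocycle relation of the automorphy factor. -/
lemma denom_mul (M M' : SiegelModularGroup n) {Z : Matrix (Fin n) (Fin n) ℂ}
    (hZ : Z ∈ siegelUpperHalf n) :
    denom (M * M') Z = denom M (act M' Z) * denom M' Z := by
  obtain ⟨-, -, a, b⟩ := block_mul M M'
  rw [denom, denom, add_mul, mul_assoc, act_mul_denom M' hZ, a, b]
  simp only [map_intCast_add, map_intCast_mul, num, denom]
  noncomm_ring

lemma act_mul (M M' : SiegelModularGroup n) {Z : Matrix (Fin n) (Fin n) ℂ}
    (hZ : Z ∈ siegelUpperHalf n) : act (M * M') Z = act M (act M' Z) := by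
  rw [act_eq, num_mul M M' hZ, denom_mul M M' hZ, Matrix.mul_inv_rev, act_eq M, mul_assoc,
    ← mul_assoc (denom M' Z), mul_nonsing_inv _ (isUnit_denom M' hZ), one_mul]

lemma act_inv_act (M : SiegelModularGroup n) {Z : Matrix (Fin n) (Fin n) ℂ}
    (hZ : Z ∈ siegelUpperHalf n) : act M⁻¹ (act M Z) = Z := by
  rw [← act_mul _ _ hZ, inv_mul_cancel, act_one]

lemma act_act_inv (M : SiegelModularGroup n) {Z : Matrix (Fin n) (Fin n) ℂ}
    (hZ : Z ∈ siegelUpperHalf n) : act M (act M⁻¹ Z) = Z := by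
  rw [← act_mul _ _ hZ, mul_inv_cancel, act_one]

/-- The transformation law `Im(M Z)⁻¹ = (C Z + D) (Im Z)⁻¹ (C Z + D)ᴴ`. -/
lemma imC_inv_act (M : SiegelModularGroup n) {Z : Matrix (Fin n) (Fin n) ℂ}
    (hZ : Z ∈ siegelUpperHalf n) :
    (imC (act M Z))⁻¹ = denom M Z * (imC Z)⁻¹ * (denom M Z)ᴴ := by
  have hu := isUnit_denom M hZ
  have hu' : IsUnit ((denom M Z)ᴴ).det := by
    rw [det_conjTranspose]; exact hu.star
  rw [imC_eq M hZ, Matrix.mul_inv_rev, Matrix.mul_inv_rev]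
  rw [mul_nonsing_inv_cancel_left _ _ hu, nonsing_inv_mul_cancel_right _ _ hu']

end Action

/-! ### Coordinates in degree two -/

section Coordinates

/-- The coordinates `(z₀, z₁, z₂)` of a symmetric matrix. -/
def coords (Z : Matrix (Fin 2) (Fin 2) ℂ) : Fin 3 → ℂ := ![Z 0 0, Z 0 1, Z 1 1]

lemma symMat_coords {Z : Matrix (Fin 2) (Fin 2) ℂ} (hZ : Zᵀ = Z) : symMat (coords Z) = Z := by
  have h : Z 1 0 = Z 0 1 := congrFun (congrFun hZ 0) 1
  ext i j
  fin_cases i <;> fin_cases j <;> simp [symMat, coords, h]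

lemma coords_symMat (z : Fin 3 → ℂ) : coords (symMat z) = z := by
  ext i
  fin_cases i <;> simp [symMat, coords]

lemma mem_siegelUpperHalf_two {Z : Matrix (Fin 2) (Fin 2) ℂ} :
    Z ∈ siegelUpperHalf 2 ↔ Z 1 0 = Z 0 1 ∧ 0 < (Z 0 0).im ∧
      0 < (Z 0 0).im * (Z 1 1).im - (Z 0 1).im ^ 2 := by
  constructor
  · rintro ⟨h1, h2⟩
    have h : Z 1 0 = Z 0 1 := congrFun (congrFun h1 0) 1
    have hd := h2.det_pos
    rw [det_fin_two] at hd
    refine ⟨h, h2.diag_pos (i := 0), ?_⟩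
    simp only [Matrix.map_apply, h] at hd
    nlinarith [hd]
  · rintro ⟨h, h0, hd⟩
    refine ⟨?_, .of_dotProduct_mulVec_pos ?_ fun x hx => ?_⟩
    · ext i j
      fin_cases i <;> fin_cases j <;> simp [h]
    · ext i j
      fin_cases i <;> fin_cases j <;> simp [h]
    · simp only [dotProduct, mulVec, Fin.sum_univ_two, Matrix.map_apply, star_trivial, h]
      set p := (Z 0 0).im
      set q := (Z 0 1).im
      set r := (Z 1 1).im
      have key : p * (x 0 * (p * x 0 + q * x 1) + x 1 * (q * x 0 + r * x 1)) =
          (p * x 0 + q * x 1) ^ 2 + (p * r - q ^ 2) * x 1 ^ 2 := by ring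
      refine pos_of_mul_pos_right (a := p) ?_ h0.le
      rw [key]
      by_cases h1 : x 1 = 0
      · have h0' : x 0 ≠ 0 := by
          intro h0'
          apply hx
          ext i
          fin_cases i <;> simp [h0', h1]
        rw [h1]
        have : 0 < (p * x 0) ^ 2 := by positivity
        simpa using this
      · have : 0 < (p * r - q ^ 2) * x 1 ^ 2 := by positivity
        nlinarith [sq_nonneg (p * x 0 + q * x 1)]

lemma mem_halfSpaceTwo {z : Fin 3 → ℂ} :
    z ∈ halfSpaceTwo ↔ 0 < (z 0).im ∧ 0 < (z 0).im * (z 2).im - (z 1).im ^ 2 := by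
  rw [halfSpaceTwo, Set.mem_ofPred_eq, mem_siegelUpperHalf_two]
  simp [symMat]

end Coordinates

/-! ### Theta series with integral characteristics -/

section ThetaSeries

open Complex

/-- The quadratic exponent of the theta series of degree two. -/
def thetaExponent (z : Fin 3 → ℂ) (b₀ b₁ : ℤ) (x y : ℂ) : ℂ :=
  z 0 * x ^ 2 + 2 * z 1 * x * y + z 2 * y ^ 2 + b₀ * x + b₁ * y

/-- The general term of the theta series with an integral characteristic. -/
def thetaTerm (a₀ a₁ b₀ b₁ : ℤ) (z : Fin 3 → ℂ) (p : ℤ × ℤ) : ℂ :=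
  cexp (Real.pi * I * thetaExponent z b₀ b₁ (p.1 + a₀ / 2) (p.2 + a₁ / 2))

/-- The theta constant of degree two with a characteristic lifted to the integers. Modulo `2` it
depends on the characteristic only up to a sign. -/
def thetaZ (a₀ a₁ b₀ b₁ : ℤ) (z : Fin 3 → ℂ) : ℂ :=
  ∑' p : ℤ × ℤ, thetaTerm a₀ a₁ b₀ b₁ z p

lemma theta_eq_thetaZ (m : Characteristic 2) (z : Fin 3 → ℂ) :
    theta m (symMat z) =
      thetaZ ((m.1 0).val : ℤ) ((m.1 1).val : ℤ) ((m.2 0).val : ℤ) ((m.2 1).val : ℤ) z := by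
  rw [theta, thetaZ, ← (finTwoArrowEquiv ℤ).tsum_eq]
  refine tsum_congr fun g => ?_
  simp only [thetaTerm, thetaExponent, finTwoArrowEquiv_apply, dotProduct, mulVec,
    Fin.sum_univ_two, symMat]
  congr 1
  simp
  ring

lemma exp_pi_mul_I_two_mul_int (k : ℤ) : cexp (Real.pi * I * (2 * k)) = 1 :=
  Complex.exp_eq_one_iff.mpr ⟨k, by ring⟩

lemma thetaZ_add_two_mul (a₀ a₁ b₀ b₁ k₀ k₁ l₀ l₁ : ℤ) (z : Fin 3 → ℂ) :
    thetaZ (a₀ + 2 * k₀) (a₁ + 2 * k₁) (b₀ + 2 * l₀) (b₁ + 2 * l₁) z =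
      cexp (Real.pi * I * (l₀ * a₀ + l₁ * a₁)) * thetaZ a₀ a₁ b₀ b₁ z := by
  rw [thetaZ, thetaZ, ← tsum_mul_left,
    ← ((Equiv.subRight k₀).prodCongr (Equiv.subRight k₁)).tsum_eq]
  refine tsum_congr fun p => ?_
  rw [thetaTerm, thetaTerm, ← Complex.exp_add, ← mul_one (cexp (_ + _)),
    ← exp_pi_mul_I_two_mul_int (l₀ * p.1 + l₁ * p.2), ← Complex.exp_add]
  congr 1
  simp only [thetaExponent, Equiv.prodCongr_apply, Prod.map, Equiv.subRight_apply]
  push_cast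
  ring

/-- The reduction modulo `2` of an integral characteristic. -/
def redChar (a₀ a₁ b₀ b₁ : ℤ) : Characteristic 2 := (![a₀, a₁], ![b₀, b₁])

lemma exists_theta_redChar (a₀ a₁ b₀ b₁ : ℤ) :
    ∃ c : ℂ, c ≠ 0 ∧ ∀ z, theta (redChar a₀ a₁ b₀ b₁) (symMat z) = c * thetaZ a₀ a₁ b₀ b₁ z := by
  have h : ∀ a : ℤ, ((a : ZMod 2).val : ℤ) = a + 2 * (-(a / 2)) := fun a => by
    rw [ZMod.val_intCast]
    have := Int.emod_add_mul_ediv a 2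
    push_cast
    linarith
  refine ⟨cexp (Real.pi * I * (((-(b₀ / 2) : ℤ) : ℂ) * a₀ + ((-(b₁ / 2) : ℤ) : ℂ) * a₁)),
    Complex.exp_ne_zero _, fun z => ?_⟩
  rw [theta_eq_thetaZ, ← thetaZ_add_two_mul _ _ _ _ (-(a₀ / 2)) (-(a₁ / 2))]
  simp only [redChar, cons_val_zero, cons_val_one, h]

lemma redChar_val (m : Characteristic 2) :
    redChar ((m.1 0).val : ℤ) ((m.1 1).val : ℤ) ((m.2 0).val : ℤ) ((m.2 1).val : ℤ) = m := by
  revert m; decide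

lemma thetaZ_translate (a₀ a₁ b₀ b₁ : ℤ) :
    ∃ c : ℂ, c ≠ 0 ∧ ∀ z : Fin 3 → ℂ, thetaZ a₀ a₁ (b₀ + a₀ + 1) b₁ ![z 0 + 1, z 1, z 2] =
      c * thetaZ a₀ a₁ b₀ b₁ z := by
  refine ⟨cexp (Real.pi * I * (a₀ ^ 2 / 4 + (a₀ + 1) * a₀ / 2)), Complex.exp_ne_zero _,
    fun z => ?_⟩
  rw [thetaZ, thetaZ, ← tsum_mul_left]
  refine tsum_congr fun p => ?_
  obtain ⟨k, hk⟩ : ∃ k : ℤ, p.1 ^ 2 + p.1 = 2 * k := by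
    obtain ⟨k, hk⟩ := Int.even_mul_succ_self p.1
    exact ⟨k, by linarith⟩
  have hk' : (p.1 : ℂ) ^ 2 + p.1 = 2 * k := by exact_mod_cast hk
  rw [thetaTerm, thetaTerm, ← Complex.exp_add]
  refine Complex.exp_eq_exp_iff_exists_int.mpr ⟨k + a₀ * p.1, ?_⟩
  simp only [thetaExponent]
  push_cast
  linear_combination (Real.pi * I) * hk'

lemma thetaZ_shear (a₀ a₁ b₀ b₁ : ℤ) (z : Fin 3 → ℂ) :
    thetaZ (a₀ - a₁) a₁ b₀ (b₁ + b₀) ![z 0, z 1 + z 0, z 2 + 2 * z 1 + z 0] =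
      thetaZ a₀ a₁ b₀ b₁ z := by
  rw [thetaZ, thetaZ, ← (((Equiv.prodComm ℤ ℤ).trans (Equiv.prodShear (Equiv.refl ℤ)
      (fun q => Equiv.addRight q))).trans (Equiv.prodComm ℤ ℤ)).tsum_eq
      (thetaTerm a₀ a₁ b₀ b₁ z)]
  refine tsum_congr fun p => ?_
  rw [thetaTerm, thetaTerm]
  congr 2
  simp only [thetaExponent, Equiv.prodShear_apply, Equiv.refl_apply, Prod.swap,
    Equiv.coe_addRight, Equiv.trans_apply, Equiv.prodComm_apply]
  push_cast
  ring

lemma thetaZ_swap (a₀ a₁ b₀ b₁ : ℤ) (z : Fin 3 → ℂ) :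
    thetaZ a₁ a₀ b₁ b₀ ![z 2, z 1, z 0] = thetaZ a₀ a₁ b₀ b₁ z := by
  rw [thetaZ, thetaZ, ← (Equiv.prodComm ℤ ℤ).tsum_eq]
  refine tsum_congr fun p => ?_
  rw [thetaTerm, thetaTerm]
  congr 2
  simp only [thetaExponent, Equiv.prodComm_apply, Prod.swap]
  simp
  ring

lemma thetaZ_neg (a₀ a₁ b₀ b₁ : ℤ) (z : Fin 3 → ℂ) :
    thetaZ a₀ a₁ b₀ b₁ ![z 0, -z 1, z 2] =
      cexp (-(Real.pi * I * (a₁ * b₁))) * thetaZ a₀ a₁ b₀ b₁ z := by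
  rw [thetaZ, thetaZ, ← tsum_mul_left,
    ← ((Equiv.refl ℤ).prodCongr ((Equiv.neg ℤ).trans (Equiv.subRight a₁))).tsum_eq]
  refine tsum_congr fun p => ?_
  rw [thetaTerm, thetaTerm, ← Complex.exp_add, ← mul_one (cexp (_ + _)),
    ← exp_pi_mul_I_two_mul_int (-(b₁ * p.2)), ← Complex.exp_add]
  congr 1
  simp only [thetaExponent, Equiv.prodCongr_apply, Prod.map, Equiv.subRight_apply,
    Equiv.refl_apply, Equiv.trans_apply, Equiv.neg_apply]
  push_cast
  simp
  ring

end ThetaSeries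

/-! ### Convergence and partial inversion of the theta series -/

section Inversion

open Complex

lemma norm_thetaTerm (a₀ a₁ b₀ b₁ : ℤ) (z : Fin 3 → ℂ) (p : ℤ × ℤ) :
    ‖thetaTerm a₀ a₁ b₀ b₁ z p‖ = Real.exp (-Real.pi * ((z 0).im * (p.1 + a₀ / 2) ^ 2 +
      2 * (z 1).im * (p.1 + a₀ / 2) * (p.2 + a₁ / 2) + (z 2).im * (p.2 + a₁ / 2) ^ 2)) := by
  have e : (Real.pi * I * thetaExponent z b₀ b₁ (p.1 + a₀ / 2) (p.2 + a₁ / 2)).re =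
      -Real.pi * ((z 0).im * (p.1 + a₀ / 2) ^ 2 +
      2 * (z 1).im * (p.1 + a₀ / 2) * (p.2 + a₁ / 2) + (z 2).im * (p.2 + a₁ / 2) ^ 2) := by
    have h : thetaExponent z b₀ b₁ (p.1 + a₀ / 2) (p.2 + a₁ / 2) =
      z 0 * (((p.1 + a₀ / 2) ^ 2 : ℝ) : ℂ) +
      z 1 * ((2 * (p.1 + a₀ / 2) * (p.2 + a₁ / 2) : ℝ) : ℂ) +
      z 2 * (((p.2 + a₁ / 2) ^ 2 : ℝ) : ℂ) +
      ((b₀ * (p.1 + a₀ / 2) + b₁ * (p.2 + a₁ / 2) : ℝ) : ℂ) := by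
      simp only [thetaExponent]
      push_cast
      ring
    rw [h, mul_assoc, re_ofReal_mul, I_mul_re]
    simp only [add_im, im_mul_ofReal, ofReal_im]
    ring
  rw [thetaTerm, Complex.norm_exp, e]

lemma summable_exp_neg_sq {r : ℝ} (hr : 0 < r) (a : ℤ) :
    Summable fun n : ℤ => Real.exp (-Real.pi * (r * (n + a / 2) ^ 2)) := by
  have h := ((summable_jacobiTheta₂_term_iff (r * a / 2 * I) (r * I)).mpr
    (by simpa using hr)).norm.mul_left (Real.exp (-Real.pi * (r * (a / 2) ^ 2)))
  refine h.congr fun n => ?_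
  rw [norm_jacobiTheta₂_term, ← Real.exp_add]
  congr 1
  have h1 : ((r : ℂ) * I).im = r := by simp
  have h2 : ((r : ℂ) * a / 2 * I).im = r * a / 2 := by
    have : (r : ℂ) * a / 2 * I = ((r * a / 2 : ℝ) : ℂ) * I := by push_cast; ring
    rw [this]; simp
  rw [h1, h2]
  ring

/-- A positive definite binary form is bounded below by `det / trace` times the sum of squares. -/
lemma det_div_trace_mul_le {u v w : ℝ} (hu : 0 < u) (hw : 0 < w) (x y : ℝ) :
    (u * w - v ^ 2) / (u + w) * (x ^ 2 + y ^ 2) ≤ u * x ^ 2 + 2 * v * x * y + w * y ^ 2 := by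
  have h : 0 < u + w := by positivity
  rw [div_mul_eq_mul_div, div_le_iff₀ h]
  have : 0 ≤ (u * x + v * y) ^ 2 + (v * x + w * y) ^ 2 := by positivity
  linarith

lemma summable_thetaTerm (a₀ a₁ b₀ b₁ : ℤ) {z : Fin 3 → ℂ} (hz : z ∈ halfSpaceTwo) :
    Summable (thetaTerm a₀ a₁ b₀ b₁ z) := by
  obtain ⟨h0, hd⟩ := mem_halfSpaceTwo.mp hz
  have hw : 0 < (z 2).im := by
    by_contra hw
    nlinarith [sq_nonneg (z 1).im]
  obtain ⟨r, hr⟩ : ∃ r, r = ((z 0).im * (z 2).im - (z 1).im ^ 2) / ((z 0).im + (z 2).im) :=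
    ⟨_, rfl⟩
  have hr0 : 0 < r := by rw [hr]; positivity
  have hs := Summable.mul_of_nonneg (summable_exp_neg_sq hr0 a₀) (summable_exp_neg_sq hr0 a₁)
      (fun _ => (Real.exp_pos _).le) (fun _ => (Real.exp_pos _).le)
  refine Summable.of_norm_bounded hs fun p => ?_
  rw [norm_thetaTerm, ← Real.exp_add, Real.exp_le_exp]
  have key := det_div_trace_mul_le (v := (z 1).im) h0 hw (p.1 + a₀ / 2) (p.2 + a₁ / 2)
  rw [← hr] at key
  have := mul_le_mul_of_nonneg_left key Real.pi_pos.le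
  linarith

/-- The inversion formula for a one-dimensional theta series with characteristic. -/
lemma tsum_inversion (a b : ℤ) (w : ℂ) {τ : ℂ} (hτ : τ ≠ 0) :
    ∑' n : ℤ, cexp (Real.pi * I * (τ * (n + a / 2) ^ 2 + (2 * w + b) * (n + a / 2))) =
    1 / (-I * τ) ^ (1 / 2 : ℂ) * cexp (Real.pi * I * (-(w ^ 2 / τ) + a * b / 2)) *
      ∑' n : ℤ, cexp (Real.pi * I * (-1 / τ * (n + (-b) / 2) ^ 2 +
        (2 * (w / τ) + a) * (n + (-b) / 2))) := by
  have h1 : ∑' n : ℤ, cexp (Real.pi * I * (τ * (n + a / 2) ^ 2 + (2 * w + b) * (n + a / 2))) =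
      cexp (Real.pi * I * (τ * a ^ 2 / 4 + (w + b / 2) * a)) *
        jacobiTheta₂ (w + b / 2 + a * τ / 2) τ := by
    rw [jacobiTheta₂, ← tsum_mul_left]
    refine tsum_congr fun n => ?_
    rw [jacobiTheta₂_term, ← Complex.exp_add]
    congr 1
    ring
  have h2 : ∑' n : ℤ, cexp (Real.pi * I * (-1 / τ * (n + (-b) / 2) ^ 2 +
        (2 * (w / τ) + a) * (n + (-b) / 2))) =
      cexp (Real.pi * I * (-1 / τ * b ^ 2 / 4 - (w / τ + a / 2) * b)) *
        jacobiTheta₂ ((w + b / 2 + a * τ / 2) / τ) (-1 / τ) := by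
    rw [jacobiTheta₂, ← tsum_mul_left]
    refine tsum_congr fun n => ?_
    rw [jacobiTheta₂_term, ← Complex.exp_add]
    congr 1
    field_simp
    ring
  rw [h1, h2, jacobiTheta₂_functional_equation]
  have h3 : cexp (Real.pi * I * (τ * a ^ 2 / 4 + (w + b / 2) * a)) *
      cexp (-Real.pi * I * (w + b / 2 + a * τ / 2) ^ 2 / τ) =
      cexp (Real.pi * I * (-(w ^ 2 / τ) + a * b / 2)) *
      cexp (Real.pi * I * (-1 / τ * b ^ 2 / 4 - (w / τ + a / 2) * b)) := by
    rw [← Complex.exp_add, ← Complex.exp_add]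
    congr 1
    field_simp
    ring
  linear_combination (1 / (-I * τ) ^ (1 / 2 : ℂ) *
    jacobiTheta₂ ((w + b / 2 + a * τ / 2) / τ) (-1 / τ)) * h3

/-- The point `(-1/z₀, z₁/z₀, z₂ - z₁²/z₀)`, the partial inversion of `(z₀, z₁, z₂)`. -/
def invPoint (z : Fin 3 → ℂ) : Fin 3 → ℂ := ![-1 / z 0, z 1 / z 0, z 2 - z 1 ^ 2 / z 0]

lemma thetaZ_inversion (a₀ a₁ b₀ b₁ : ℤ) {z : Fin 3 → ℂ} (hz : z ∈ halfSpaceTwo)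
    (hz' : invPoint z ∈ halfSpaceTwo) :
    thetaZ a₀ a₁ b₀ b₁ z = 1 / (-I * z 0) ^ (1 / 2 : ℂ) * cexp (Real.pi * I * (a₀ * b₀ / 2)) *
      thetaZ (-b₀) a₁ a₀ b₁ (invPoint z) := by
  have h0 : z 0 ≠ 0 := by
    intro h
    have := (mem_halfSpaceTwo.mp hz).1
    simp [h] at this
  have hs1 : Summable fun p : ℤ × ℤ => thetaTerm a₀ a₁ b₀ b₁ z (Equiv.prodComm ℤ ℤ p) :=
    (Equiv.prodComm ℤ ℤ).summable_iff.mpr (summable_thetaTerm a₀ a₁ b₀ b₁ hz)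
  have hs2 : Summable fun p : ℤ × ℤ =>
      thetaTerm (-b₀) a₁ a₀ b₁ (invPoint z) (Equiv.prodComm ℤ ℤ p) :=
    (Equiv.prodComm ℤ ℤ).summable_iff.mpr (summable_thetaTerm (-b₀) a₁ a₀ b₁ hz')
  rw [thetaZ, thetaZ, ← (Equiv.prodComm ℤ ℤ).tsum_eq,
    ← (Equiv.prodComm ℤ ℤ).tsum_eq (thetaTerm (-b₀) a₁ a₀ b₁ (invPoint z)),
    hs1.tsum_prod, hs2.tsum_prod, ← tsum_mul_left]
  refine tsum_congr fun q => ?_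
  set y : ℂ := q + a₁ / 2 with hy
  have e1 : ∀ p : ℤ, thetaTerm a₀ a₁ b₀ b₁ z (p, q) =
      cexp (Real.pi * I * (z 2 * y ^ 2 + b₁ * y)) * cexp (Real.pi * I *
        (z 0 * (p + a₀ / 2) ^ 2 + (2 * (z 1 * y) + b₀) * (p + a₀ / 2))) := by
    intro p
    rw [thetaTerm, ← Complex.exp_add]
    congr 1
    simp only [thetaExponent, ← hy]
    ring
  have e2 : ∀ p : ℤ, thetaTerm (-b₀) a₁ a₀ b₁ (invPoint z) (p, q) =
      cexp (Real.pi * I * ((z 2 - z 1 ^ 2 / z 0) * y ^ 2 + b₁ * y)) * cexp (Real.pi * I *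
        (-1 / z 0 * (p + (-b₀) / 2) ^ 2 + (2 * (z 1 * y / z 0) + a₀) * (p + (-b₀) / 2))) := by
    intro p
    rw [thetaTerm, ← Complex.exp_add]
    congr 1
    simp only [thetaExponent, invPoint, ← hy]
    push_cast
    ring
  simp only [Equiv.prodComm_apply, Prod.swap_prod_mk]
  rw [tsum_congr e1, tsum_congr e2, tsum_mul_left, tsum_mul_left, tsum_inversion _ _ _ h0]
  have h3 : cexp (Real.pi * I * (z 2 * y ^ 2 + b₁ * y)) *
      cexp (Real.pi * I * (-((z 1 * y) ^ 2 / z 0) + a₀ * b₀ / 2)) =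
      cexp (Real.pi * I * (a₀ * b₀ / 2)) *
      cexp (Real.pi * I * ((z 2 - z 1 ^ 2 / z 0) * y ^ 2 + b₁ * y)) := by
    rw [← Complex.exp_add, ← Complex.exp_add]
    congr 1
    field_simp
    ring
  linear_combination (1 / (-I * z 0) ^ (1 / 2 : ℂ) * ∑' n : ℤ, cexp (Real.pi * I *
    (-1 / z 0 * (n + (-b₀) / 2) ^ 2 + (2 * (z 1 * y / z 0) + a₀) * (n + (-b₀) / 2)))) * h3

end Inversion

/-! ### The transformation law of the theta constants -/

section Covariance

open Complex

/-- The matrix `M` permutes the theta constants by `π`, up to constants `c m` and a common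
automorphy factor `s` of weight `1/2`, which satisfies `s(Z)² = det (C Z + D)`. One can take `π` to
be the permutation `charAct M`, but only the fact that it preserves parity is recorded. -/
structure ThetaCovariance (M : SiegelModularGroup 2) (π : Equiv.Perm (Characteristic 2))
    (c : Characteristic 2 → ℂ) (s : Matrix (Fin 2) (Fin 2) ℂ → ℂ) : Prop where
  even_iff : ∀ m, IsEvenChar (π m) ↔ IsEvenChar m
  const_ne_zero : ∀ m, c m ≠ 0
  transforms : ∀ Z ∈ siegelUpperHalf 2, s Z ^ 2 = (denom M Z).det ∧
    ∀ m, theta (π m) (act M Z) = c m * s Z * theta m Z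

/-- The theta constants are covariant with respect to `M` for some choice of the data. -/
def IsThetaCovariant (M : SiegelModularGroup 2) : Prop :=
  ∃ π c s, ThetaCovariance M π c s

lemma ThetaCovariance.factor_ne_zero {M : SiegelModularGroup 2}
    {π : Equiv.Perm (Characteristic 2)} {c : Characteristic 2 → ℂ}
    {s : Matrix (Fin 2) (Fin 2) ℂ → ℂ} (h : ThetaCovariance M π c s)
    {Z : Matrix (Fin 2) (Fin 2) ℂ} (hZ : Z ∈ siegelUpperHalf 2) : s Z ≠ 0 := by
  intro h0
  have := (h.transforms Z hZ).1
  rw [h0] at this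
  exact det_denom_ne_zero M hZ (by rw [← this]; simp)

/-- The subgroup of all modular matrices for which the theta constants transform as expected.
(It is the whole modular group, but only the elements generated by a few explicit matrices are
needed.) -/
def thetaCovariantGroup : Subgroup (SiegelModularGroup 2) where
  carrier := {M | IsThetaCovariant M}
  one_mem' := by
    refine ⟨1, 1, 1, fun m => Iff.rfl, fun m => one_ne_zero, fun Z _ => ⟨?_, fun m => ?_⟩⟩
    · simp [denom_one]
    · simp [act_one]
  mul_mem' := by
    rintro M M' ⟨π, c, s, h1, h2, h3⟩ ⟨π', c', s', h1', h2', h3'⟩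
    refine ⟨π * π', fun m => c (π' m) * c' m, fun Z => s (act M' Z) * s' Z,
      fun m => (h1 _).trans (h1' m), fun m => mul_ne_zero (h2 _) (h2' _), fun Z hZ => ⟨?_, ?_⟩⟩
    · rw [denom_mul _ _ hZ, det_mul, mul_pow, (h3 _ (act_mem M' hZ)).1, (h3' _ hZ).1]
    · intro m
      rw [Equiv.Perm.mul_apply, act_mul _ _ hZ, (h3 _ (act_mem M' hZ)).2, (h3' _ hZ).2]
      ring
  inv_mem' := by
    rintro M ⟨π, c, s, h⟩
    have hs0 := fun {Z} (hZ : Z ∈ siegelUpperHalf 2) => h.factor_ne_zero hZ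
    obtain ⟨h1, h2, h3⟩ := h
    refine ⟨π⁻¹, fun m => (c (π⁻¹ m))⁻¹, fun Z => (s (act M⁻¹ Z))⁻¹,
      fun m => ?_, fun m => inv_ne_zero (h2 _), fun Z hZ => ⟨?_, fun m => ?_⟩⟩
    · rw [← h1, show π (π⁻¹ m) = m from π.apply_symm_apply m]
    · have h := denom_mul M M⁻¹ hZ
      rw [mul_inv_cancel, denom_one] at h
      have h' := congrArg det h
      rw [det_one, det_mul] at h'
      rw [inv_pow, (h3 _ (act_mem _ hZ)).1]
      exact (eq_inv_of_mul_eq_one_right h'.symm).symm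
    · have hs : s (act M⁻¹ Z) ≠ 0 := hs0 (act_mem M⁻¹ hZ)
      have h := (h3 _ (act_mem M⁻¹ hZ)).2 (π⁻¹ m)
      rw [show π (π⁻¹ m) = m from π.apply_symm_apply m, act_act_inv _ hZ] at h
      rw [h]
      have := h2 (π⁻¹ m)
      field_simp

/-- A modular matrix from its blocks. -/
def ofBlocks (A B C D : Matrix (Fin 2) (Fin 2) ℤ)
    (h : Aᵀ * C = Cᵀ * A ∧ Bᵀ * D = Dᵀ * B ∧ Aᵀ * D - Cᵀ * B = 1) : SiegelModularGroup 2 :=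
  ⟨fromBlocks A B C D, SymplecticGroup.fromBlocks_mem_iff.mpr h⟩

/-- The translation `z₀ ↦ z₀ + 1`. -/
def translateGen : SiegelModularGroup 2 :=
  ofBlocks 1 !![1, 0; 0, 0] 0 1 (by decide)

/-- The substitution `Z ↦ U Z ᵗU` with `U = (1 0; 1 1)`. -/
def shearGen : SiegelModularGroup 2 :=
  ofBlocks !![1, 0; 1, 1] 0 0 !![1, -1; 0, 1] (by decide)

/-- The substitution interchanging `z₀` and `z₂`. -/
def swapGen : SiegelModularGroup 2 :=
  ofBlocks !![0, 1; 1, 0] 0 0 !![0, 1; 1, 0] (by decide)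

/-- The inversion `z₀ ↦ -1/z₀` in the first variable. -/
def inversionGen : SiegelModularGroup 2 :=
  ofBlocks !![0, 0; 0, 1] !![-1, 0; 0, 0] !![1, 0; 0, 0] !![0, 0; 0, 1] (by decide)

/-- The involution `z₁ ↦ -z₁`. -/
def reflection : SiegelModularGroup 2 :=
  ofBlocks !![1, 0; 0, -1] 0 0 !![1, 0; 0, -1] (by decide)

/-- The action of `M` follows from a matrix `W` with `W (C Z + D) = A Z + B`. -/
lemma act_eq_of_mul_denom {M : SiegelModularGroup 2} {Z W : Matrix (Fin 2) (Fin 2) ℂ}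
    (hZ : Z ∈ siegelUpperHalf 2) (h : W * denom M Z = num M Z) : act M Z = W := by
  rw [act_eq, ← h, mul_nonsing_inv_cancel_right _ _ (isUnit_denom M hZ)]

lemma act_translateGen {z : Fin 3 → ℂ} (hz : z ∈ halfSpaceTwo) :
    act translateGen (symMat z) = symMat ![z 0 + 1, z 1, z 2] := by
  refine act_eq_of_mul_denom hz ?_
  ext i j
  fin_cases i <;> fin_cases j <;>
    simp [num, denom, translateGen, ofBlocks, blockA, blockB, blockC, blockD, symMat,
      Matrix.mul_apply]

lemma act_shearGen {z : Fin 3 → ℂ} (hz : z ∈ halfSpaceTwo) :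
    act shearGen (symMat z) = symMat ![z 0, z 1 + z 0, z 2 + 2 * z 1 + z 0] := by
  refine act_eq_of_mul_denom hz ?_
  ext i j
  fin_cases i <;> fin_cases j <;>
    simp [num, denom, shearGen, ofBlocks, blockA, blockB, blockC, blockD, symMat,
      Matrix.mul_apply] <;> ring

lemma act_swapGen {z : Fin 3 → ℂ} (hz : z ∈ halfSpaceTwo) :
    act swapGen (symMat z) = symMat ![z 2, z 1, z 0] := by
  refine act_eq_of_mul_denom hz ?_
  ext i j
  fin_cases i <;> fin_cases j <;>
    simp [num, denom, swapGen, ofBlocks, blockA, blockB, blockC, blockD, symMat,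
      Matrix.mul_apply]

lemma ne_zero_of_mem_halfSpaceTwo {z : Fin 3 → ℂ} (hz : z ∈ halfSpaceTwo) : z 0 ≠ 0 := by
  intro h
  have := (mem_halfSpaceTwo.mp hz).1
  simp [h] at this

lemma act_inversionGen {z : Fin 3 → ℂ} (hz : z ∈ halfSpaceTwo) :
    act inversionGen (symMat z) = symMat (invPoint z) := by
  have h0 := ne_zero_of_mem_halfSpaceTwo hz
  refine act_eq_of_mul_denom hz ?_
  ext i j
  fin_cases i <;> fin_cases j <;>
    simp [num, denom, inversionGen, ofBlocks, blockA, blockB, blockC, blockD, symMat,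
      Matrix.mul_apply, invPoint] <;> field_simp <;> ring

lemma act_reflection {z : Fin 3 → ℂ} (hz : z ∈ halfSpaceTwo) :
    act reflection (symMat z) = symMat ![z 0, -z 1, z 2] := by
  refine act_eq_of_mul_denom hz ?_
  ext i j
  fin_cases i <;> fin_cases j <;>
    simp [num, denom, reflection, ofBlocks, blockA, blockB, blockC, blockD, symMat,
      Matrix.mul_apply]

/-- It suffices to check the transformation law for the series with integral characteristics. -/
lemma isThetaCovariant_of_thetaZ {M : SiegelModularGroup 2}
    (π : Equiv.Perm (Characteristic 2)) (hπ : ∀ m, IsEvenChar (π m) ↔ IsEvenChar m)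
    (f : (Fin 3 → ℂ) → Fin 3 → ℂ) (s : (Fin 3 → ℂ) → ℂ)
    (hs : ∀ z ∈ halfSpaceTwo, s z ^ 2 = (denom M (symMat z)).det)
    (hf : ∀ z ∈ halfSpaceTwo, act M (symMat z) = symMat (f z))
    (h : ∀ a₀ a₁ b₀ b₁ : ℤ, ∃ a₀' a₁' b₀' b₁' : ℤ,
      π (redChar a₀ a₁ b₀ b₁) = redChar a₀' a₁' b₀' b₁' ∧ ∃ c : ℂ, c ≠ 0 ∧
        ∀ z ∈ halfSpaceTwo, thetaZ a₀' a₁' b₀' b₁' (f z) = c * s z * thetaZ a₀ a₁ b₀ b₁ z) :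
    IsThetaCovariant M := by
  have key : ∀ m, ∃ c : ℂ, c ≠ 0 ∧ ∀ z ∈ halfSpaceTwo,
      theta (π m) (symMat (f z)) = c * s z * theta m (symMat z) := by
    intro m
    obtain ⟨a₀', a₁', b₀', b₁', h1, c, hc, h2⟩ := h ((m.1 0).val : ℤ) ((m.1 1).val : ℤ)
      ((m.2 0).val : ℤ) ((m.2 1).val : ℤ)
    obtain ⟨c', hc', h3⟩ := exists_theta_redChar a₀' a₁' b₀' b₁'
    refine ⟨c' * c, mul_ne_zero hc' hc, fun z hz => ?_⟩
    rw [← redChar_val m, h1, h3, h2 z hz, redChar_val, theta_eq_thetaZ]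
    ring
  choose c hc hc' using key
  refine ⟨π, c, fun Z => s (coords Z), hπ, hc, fun Z hZ => ?_⟩
  have hz : coords Z ∈ halfSpaceTwo := by
    rw [halfSpaceTwo, Set.mem_ofPred_eq, symMat_coords hZ.1]; exact hZ
  have e := symMat_coords hZ.1
  refine ⟨?_, fun m => ?_⟩
  · rw [hs _ hz, e]
  · have := hc' m _ hz
    rw [← hf _ hz, e] at this
    exact this

lemma isThetaCovariant_translateGen : IsThetaCovariant translateGen := by
  refine isThetaCovariant_of_thetaZ
    (⟨fun m => (m.1, ![m.2 0 + m.1 0 + 1, m.2 1]), fun m => (m.1, ![m.2 0 + m.1 0 + 1, m.2 1]),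
      by decide, by decide⟩) (by decide) _ (fun _ => 1) (fun z _ => ?_)
    (fun z hz => act_translateGen hz) fun a₀ a₁ b₀ b₁ =>
      ⟨a₀, a₁, b₀ + a₀ + 1, b₁, ?_, ?_⟩
  · simp [denom, translateGen, ofBlocks, blockC, blockD]
  · simp [redChar]
  · obtain ⟨c, hc, h⟩ := thetaZ_translate a₀ a₁ b₀ b₁
    exact ⟨c, hc, fun z _ => by rw [h, mul_one]⟩

lemma isThetaCovariant_shearGen : IsThetaCovariant shearGen := by
  refine isThetaCovariant_of_thetaZ
    (⟨fun m => (![m.1 0 - m.1 1, m.1 1], ![m.2 0, m.2 1 + m.2 0]),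
      fun m => (![m.1 0 - m.1 1, m.1 1], ![m.2 0, m.2 1 + m.2 0]),
      by decide, by decide⟩) (by decide) _ (fun _ => 1) (fun z _ => ?_)
    (fun z hz => act_shearGen hz) fun a₀ a₁ b₀ b₁ =>
      ⟨a₀ - a₁, a₁, b₀, b₁ + b₀, ?_, 1, one_ne_zero, fun z _ => ?_⟩
  · simp [denom, shearGen, ofBlocks, blockC, blockD, det_fin_two]
  · simp [redChar]
  · rw [thetaZ_shear]; ring

lemma isThetaCovariant_swapGen : IsThetaCovariant swapGen := by
  refine isThetaCovariant_of_thetaZ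
    (⟨fun m => (![m.1 1, m.1 0], ![m.2 1, m.2 0]),
      fun m => (![m.1 1, m.1 0], ![m.2 1, m.2 0]),
      by decide, by decide⟩) (by decide) _ (fun _ => I) (fun z _ => ?_)
    (fun z hz => act_swapGen hz) fun a₀ a₁ b₀ b₁ =>
      ⟨a₁, a₀, b₁, b₀, ?_, -I, by simp, fun z _ => ?_⟩
  · simp [denom, swapGen, ofBlocks, blockC, blockD, det_fin_two]
  · simp [redChar]
  · rw [thetaZ_swap]
    linear_combination (thetaZ a₀ a₁ b₀ b₁ z) * I_mul_I

lemma invPoint_mem {z : Fin 3 → ℂ} (hz : z ∈ halfSpaceTwo) : invPoint z ∈ halfSpaceTwo := by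
  have := act_mem inversionGen hz
  rwa [act_inversionGen hz] at this

lemma isThetaCovariant_inversionGen : IsThetaCovariant inversionGen := by
  -- an eighth root of unity turns `-i z₀` into `z₀`
  have hε : cexp (Real.pi * I / 4) ^ 2 = I := by
    rw [← Complex.exp_nat_mul]
    convert Complex.exp_pi_div_two_mul_I using 2
    push_cast
    ring
  have hpow : ∀ w : ℂ, (w ^ (1 / 2 : ℂ)) ^ 2 = w := fun w => by
    rw [one_div]
    exact_mod_cast Complex.cpow_nat_inv_pow w two_ne_zero
  refine isThetaCovariant_of_thetaZ
    (⟨fun m => (![-m.2 0, m.1 1], ![m.1 0, m.2 1]),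
      fun m => (![m.2 0, m.1 1], ![-m.1 0, m.2 1]),
      by decide, by decide⟩) (by decide) _
    (fun z => cexp (Real.pi * I / 4) * (-I * z 0) ^ (1 / 2 : ℂ)) (fun z _ => ?_)
    (fun z hz => act_inversionGen hz) fun a₀ a₁ b₀ b₁ =>
      ⟨-b₀, a₁, a₀, b₁, ?_, cexp (-(Real.pi * I / 4)) * cexp (-(Real.pi * I * (a₀ * b₀ / 2))),
        mul_ne_zero (Complex.exp_ne_zero _) (Complex.exp_ne_zero _), fun z hz => ?_⟩
  · rw [mul_pow, hε, hpow]
    simp only [denom, inversionGen, ofBlocks, blockC, blockD, det_fin_two, symMat,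
      toBlocks_fromBlocks₂₁, toBlocks_fromBlocks₂₂]
    simp [Matrix.mul_apply]
    linear_combination (-z 0) * I_mul_I
  · simp [redChar]
  · have h0 := ne_zero_of_mem_halfSpaceTwo hz
    have h1 : (-I * z 0) ^ (1 / 2 : ℂ) ≠ 0 := by
      intro h
      have := hpow (-I * z 0)
      rw [h] at this
      simp [h0] at this
    rw [thetaZ_inversion a₀ a₁ b₀ b₁ hz (invPoint_mem hz), Complex.exp_neg, Complex.exp_neg]
    have e1 := Complex.exp_ne_zero (Real.pi * I / 4)
    have e2 := Complex.exp_ne_zero (Real.pi * I * (a₀ * b₀ / 2))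
    field_simp

/-- The reflection multiplies a theta constant by the sign `(-1) ^ (a₂ b₂)`; among the even
characteristics this is `-1` only for the characteristic consisting of ones. -/
lemma theta_act_reflection {Z : Matrix (Fin 2) (Fin 2) ℂ} (hZ : Z ∈ siegelUpperHalf 2)
    {m : Characteristic 2} (hm : IsEvenChar m) :
    theta m (act reflection Z) = (if m = (1, 1) then -1 else 1) * theta m Z := by
  have e := symMat_coords hZ.1
  have hz : coords Z ∈ halfSpaceTwo := by
    rw [halfSpaceTwo, Set.mem_ofPred_eq, e]; exact hZ
  rw [← e, act_reflection hz, theta_eq_thetaZ, theta_eq_thetaZ, thetaZ_neg]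
  congr 1
  have key : ∀ m : Characteristic 2, IsEvenChar m →
      (m = (1, 1) ∧ (m.1 1).val = 1 ∧ (m.2 1).val = 1) ∨
      (m ≠ (1, 1) ∧ ((m.1 1).val = 0 ∨ (m.2 1).val = 0)) := by decide
  rcases key m hm with ⟨h, h1, h2⟩ | ⟨h, h1 | h1⟩
  · rw [if_pos h, h1, h2, Complex.exp_neg]
    simp [Complex.exp_pi_mul_I]
  · rw [if_neg h, h1]; simp
  · rw [if_neg h, h1]; simp

/-- The translations `z₁ ↦ z₁ + k`. -/
def offDiagTranslate (k : ℤ) : SiegelModularGroup 2 :=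
  ofBlocks 1 !![0, k; k, 0] 0 1 (by
    refine ⟨by simp, ?_, by simp⟩
    ext i j
    fin_cases i <;> fin_cases j <;> simp)

/-- The substitutions `Z ↦ U Z ᵗU` with `U = (1 0; k 1)`. -/
def shear (k : ℤ) : SiegelModularGroup 2 :=
  ofBlocks !![1, 0; k, 1] 0 0 !![1, -k; 0, 1] (by
    refine ⟨by simp, by simp, ?_⟩
    ext i j
    fin_cases i <;> fin_cases j <;> simp [Matrix.mul_apply])

lemma act_offDiagTranslate (k : ℤ) {z : Fin 3 → ℂ} (hz : z ∈ halfSpaceTwo) :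
    act (offDiagTranslate k) (symMat z) = symMat ![z 0, z 1 + k, z 2] := by
  refine act_eq_of_mul_denom hz ?_
  ext i j
  fin_cases i <;> fin_cases j <;>
    simp [num, denom, offDiagTranslate, ofBlocks, blockA, blockB, blockC, blockD, symMat]

lemma act_shear (k : ℤ) {z : Fin 3 → ℂ} (hz : z ∈ halfSpaceTwo) :
    act (shear k) (symMat z) = symMat ![z 0, z 1 + k * z 0, z 2 + 2 * k * z 1 + k ^ 2 * z 0] := by
  refine act_eq_of_mul_denom hz ?_
  ext i j
  fin_cases i <;> fin_cases j <;>
    simp [num, denom, shear, ofBlocks, blockA, blockB, blockC, blockD, symMat,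
      Matrix.mul_apply] <;> ring

lemma ofBlocks_mul_ofBlocks {A B C D A' B' C' D' h h'} :
    (ofBlocks A B C D h * ofBlocks A' B' C' D' h').1 = fromBlocks (A * A' + B * C')
      (A * B' + B * D') (C * A' + D * C') (C * B' + D * D') :=
  fromBlocks_multiply ..

lemma shear_add (k l : ℤ) : shear (k + l) = shear k * shear l := by
  refine Subtype.ext ?_
  simp only [shear, ofBlocks_mul_ofBlocks]
  simp [ofBlocks, add_comm]

lemma shear_mem (k : ℤ) : shear k ∈ thetaCovariantGroup := by
  have h1 : shear 1 ∈ thetaCovariantGroup := isThetaCovariant_shearGen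
  have h0 : shear 0 = 1 := by
    have := shear_add 0 0
    rwa [add_zero, left_eq_mul] at this
  induction k using Int.induction_on with
  | zero => rw [h0]; exact one_mem _
  | succ k ih => rw [shear_add]; exact mul_mem ih h1
  | pred k ih =>
    have := shear_add (-k - 1) 1
    rw [sub_add_cancel] at this
    rw [← mul_inv_eq_iff_eq_mul.mpr this]
    exact mul_mem ih (inv_mem h1)

/-- The translations `z₁ ↦ z₁ + k` are conjugates of shears by the inversion. -/
lemma offDiagTranslate_mem (k : ℤ) : offDiagTranslate k ∈ thetaCovariantGroup := by
  have h : offDiagTranslate k = inversionGen * shear k * inversionGen⁻¹ := by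
    rw [eq_mul_inv_iff_mul_eq]
    refine Subtype.ext ?_
    simp only [offDiagTranslate, inversionGen, shear, ofBlocks_mul_ofBlocks]
    simp [Matrix.one_fin_two]
  rw [h]
  have hi : inversionGen ∈ thetaCovariantGroup := isThetaCovariant_inversionGen
  exact mul_mem (mul_mem hi (shear_mem k)) (inv_mem hi)

end Covariance

/-! ### Reduction theory in degree two -/

section Reduction

/-- The value at the row `r = c Z + d` of the hermitian form with matrix `(Im Z)⁻¹`, as a positive
definite quadratic form in the four variables `(c, d)`. -/
def rowForm (z : Fin 3 → ℂ) (c₀ c₁ d₀ d₁ : ℝ) : ℝ :=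
  ((z 2).im * (c₀ * (z 0).re + c₁ * (z 1).re + d₀) ^ 2 -
    2 * (z 1).im * (c₀ * (z 0).re + c₁ * (z 1).re + d₀) * (c₀ * (z 1).re + c₁ * (z 2).re + d₁) +
    (z 0).im * (c₀ * (z 1).re + c₁ * (z 2).re + d₁) ^ 2) /
      ((z 0).im * (z 2).im - (z 1).im ^ 2) +
  ((z 0).im * c₀ ^ 2 + 2 * (z 1).im * c₀ * c₁ + (z 2).im * c₁ ^ 2)

lemma imC_symMat_inv (z : Fin 3 → ℂ) : (imC (symMat z))⁻¹ =
    (((z 0).im * (z 2).im - (z 1).im ^ 2 : ℝ) : ℂ)⁻¹ •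
      !![((z 2).im : ℂ), -((z 1).im : ℂ); -((z 1).im : ℂ), ((z 0).im : ℂ)] := by
  have h : imC (symMat z) = !![((z 0).im : ℂ), ((z 1).im : ℂ); ((z 1).im : ℂ), ((z 2).im : ℂ)] := by
    ext i j
    fin_cases i <;> fin_cases j <;> simp [imC, symMat]
  rw [h, Matrix.inv_def, det_fin_two_of, adjugate_fin_two_of, Ring.inverse_eq_inv']
  push_cast
  rw [sq]

lemma imC_inv_act_apply (M : SiegelModularGroup 2) {z : Fin 3 → ℂ} (hz : z ∈ halfSpaceTwo)
    (i : Fin 2) : (imC (act M (symMat z)))⁻¹ i i =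
      (rowForm z (blockC M i 0) (blockC M i 1) (blockD M i 0) (blockD M i 1) : ℂ) := by
  have hd : (((z 0).im * (z 2).im - (z 1).im ^ 2 : ℝ) : ℂ) ≠ 0 := by
    exact_mod_cast (mem_halfSpaceTwo.mp hz).2.ne'
  have hd' : ((z 0).im * (z 2).im - (z 1).im ^ 2 : ℝ) ≠ 0 := (mem_halfSpaceTwo.mp hz).2.ne'
  rw [imC_inv_act M hz, imC_symMat_inv, mul_smul_comm, smul_mul_assoc, Matrix.smul_apply,
    smul_eq_mul, inv_mul_eq_iff_eq_mul₀ hd]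
  rw [← Complex.ofReal_mul, rowForm, mul_add, mul_div_cancel₀ _ hd']
  simp only [Matrix.mul_apply, denom, Fin.sum_univ_two, conjTranspose_apply, Matrix.add_apply,
    Matrix.map_apply, symMat]
  apply Complex.ext
  · rw [Complex.ofReal_re]
    simp
    ring
  · rw [Complex.ofReal_im]
    simp
    ring

/-- The coefficients of a row with bounded `rowForm` are bounded, uniformly in `z` as long as `z`
stays in a bounded part of the half plane away from its boundary. -/
lemma exists_row_bound {δ : ℝ} (hδ : 0 < δ) (t K L : ℝ) :
    ∃ B : ℝ, ∀ z : Fin 3 → ℂ, z ∈ halfSpaceTwo → δ ≤ (z 0).im * (z 2).im - (z 1).im ^ 2 →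
      (z 0).im + (z 2).im ≤ t → (∀ i, |(z i).re| ≤ K) →
      ∀ c₀ c₁ d₀ d₁ : ℝ, rowForm z c₀ c₁ d₀ d₁ ≤ L →
        |c₀| ≤ B ∧ |c₁| ≤ B ∧ |d₀| ≤ B ∧ |d₁| ≤ B := by
  obtain ⟨R, hR⟩ : ∃ R, R = Real.sqrt (L * t / δ) + Real.sqrt (L * t) := ⟨_, rfl⟩
  refine ⟨R + 2 * (|K| * R), fun z hz h1 h2 h3 c₀ c₁ d₀ d₁ h => ?_⟩
  obtain ⟨hp, hd⟩ := mem_halfSpaceTwo.mp hz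
  have hq : 0 < (z 2).im := by
    by_contra hw
    nlinarith [sq_nonneg (z 1).im]
  obtain ⟨u₀, hu₀⟩ : ∃ u₀, u₀ = c₀ * (z 0).re + c₁ * (z 1).re + d₀ := ⟨_, rfl⟩
  obtain ⟨u₁, hu₁⟩ : ∃ u₁, u₁ = c₀ * (z 1).re + c₁ * (z 2).re + d₁ := ⟨_, rfl⟩
  obtain ⟨Δ, hΔ⟩ : ∃ Δ, Δ = (z 0).im * (z 2).im - (z 1).im ^ 2 := ⟨_, rfl⟩
  obtain ⟨T, hT⟩ : ∃ T, T = (z 0).im + (z 2).im := ⟨_, rfl⟩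
  have hT0 : 0 < T := by rw [hT]; positivity
  rw [← hΔ] at h1 hd
  rw [← hT] at h2
  rw [rowForm, ← hu₀, ← hu₁, ← hΔ] at h
  have e1 := det_div_trace_mul_le (v := (z 1).im) hp hq c₀ c₁
  have e2 := det_div_trace_mul_le (v := -(z 1).im) hq hp u₀ u₁
  have hΔ' : (z 2).im * (z 0).im - (-(z 1).im) ^ 2 = Δ := by rw [hΔ]; ring
  rw [← hΔ, ← hT] at e1
  rw [hΔ', add_comm, ← hT] at e2
  have e3 : (u₀ ^ 2 + u₁ ^ 2) / T ≤ ((z 2).im * u₀ ^ 2 - 2 * (z 1).im * u₀ * u₁ +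
      (z 0).im * u₁ ^ 2) / Δ := by
    rw [le_div_iff₀ hd]
    calc _ = Δ / T * (u₀ ^ 2 + u₁ ^ 2) := by ring
      _ ≤ _ := by linarith
  have hL : (Δ * (c₀ ^ 2 + c₁ ^ 2) + (u₀ ^ 2 + u₁ ^ 2)) / T ≤ L := by
    have : (Δ * (c₀ ^ 2 + c₁ ^ 2) + (u₀ ^ 2 + u₁ ^ 2)) / T =
      Δ / T * (c₀ ^ 2 + c₁ ^ 2) + (u₀ ^ 2 + u₁ ^ 2) / T := by ring
    linarith
  rw [div_le_iff₀ hT0] at hL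
  have hL0 : 0 ≤ L := by
    have : 0 ≤ L * T := le_trans (by positivity) hL
    exact nonneg_of_mul_nonneg_left this hT0
  have hLT : L * T ≤ L * t := mul_le_mul_of_nonneg_left h2 hL0
  have hc : c₀ ^ 2 + c₁ ^ 2 ≤ L * t / δ := by
    rw [le_div_iff₀ hδ]
    nlinarith [sq_nonneg c₀, sq_nonneg c₁, sq_nonneg u₀, sq_nonneg u₁]
  have hu : u₀ ^ 2 + u₁ ^ 2 ≤ L * t := by nlinarith [sq_nonneg c₀, sq_nonneg c₁]
  have s1 := Real.sqrt_nonneg (L * t / δ)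
  have s2 := Real.sqrt_nonneg (L * t)
  have b0 : |c₀| ≤ R := by
    have := Real.abs_le_sqrt (show c₀ ^ 2 ≤ L * t / δ by linarith [sq_nonneg c₁])
    linarith
  have b1 : |c₁| ≤ R := by
    have := Real.abs_le_sqrt (show c₁ ^ 2 ≤ L * t / δ by linarith [sq_nonneg c₀])
    linarith
  have v0 : |u₀| ≤ R := by
    have := Real.abs_le_sqrt (show u₀ ^ 2 ≤ L * t by linarith [sq_nonneg u₁])
    linarith
  have v1 : |u₁| ≤ R := by
    have := Real.abs_le_sqrt (show u₁ ^ 2 ≤ L * t by linarith [sq_nonneg u₀])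
    linarith
  have hR0 : 0 ≤ R := (abs_nonneg _).trans b0
  have hK : ∀ i, |(z i).re| ≤ |K| := fun i => (h3 i).trans (le_abs_self K)
  have hKR : 0 ≤ |K| * R := by positivity
  have m : ∀ (c : ℝ) (i : Fin 3), |c| ≤ R → |c * (z i).re| ≤ |K| * R := fun c i hc => by
    rw [abs_mul, mul_comm]
    exact mul_le_mul (hK i) hc (abs_nonneg _) (abs_nonneg _)
  have key : ∀ (u x y d : ℝ), u = x + y + d → |u| ≤ R → |x| ≤ |K| * R → |y| ≤ |K| * R →
      |d| ≤ R + 2 * (|K| * R) := fun u x y d h hu hx hy => by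
    rw [abs_le] at *
    constructor <;> linarith
  exact ⟨by linarith, by linarith, key _ _ _ _ hu₀ v0 (m _ _ b0) (m _ _ b1),
    key _ _ _ _ hu₁ v1 (m _ _ b0) (m _ _ b1)⟩

/-- The quantity `y₀ / det Y`, the lower right entry of `(Im Z)⁻¹`; it is the inverse square of the
height of `Z` with respect to a one-dimensional cusp. -/
def invHeight (Z : Matrix (Fin 2) (Fin 2) ℂ) : ℝ :=
  (Z 0 0).im / ((Z 0 0).im * (Z 1 1).im - (Z 0 1).im ^ 2)

lemma invHeight_act (M : SiegelModularGroup 2) {z : Fin 3 → ℂ} (hz : z ∈ halfSpaceTwo) :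
    invHeight (act M (symMat z)) =
      rowForm z (blockC M 1 0) (blockC M 1 1) (blockD M 1 0) (blockD M 1 1) := by
  have h := imC_inv_act_apply M hz 1
  rw [← symMat_coords (act_mem M hz).1, imC_symMat_inv] at h
  rw [← symMat_coords (act_mem M hz).1]
  generalize coords (act M (symMat z)) = w at *
  have h' : (((w 0).im * (w 2).im - (w 1).im ^ 2 : ℝ) : ℂ)⁻¹ * ((w 0).im : ℂ) =
    (rowForm z (blockC M 1 0) (blockC M 1 1) (blockD M 1 0) (blockD M 1 1) : ℂ) := by
    simpa using h
  rw [← Complex.ofReal_inv, ← Complex.ofReal_mul, Complex.ofReal_inj] at h'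
  rw [← h', invHeight, div_eq_inv_mul]
  simp [symMat]

lemma coords_mem {Z : Matrix (Fin 2) (Fin 2) ℂ} (hZ : Z ∈ siegelUpperHalf 2) :
    coords Z ∈ halfSpaceTwo := by
  rw [halfSpaceTwo, Set.mem_ofPred_eq, symMat_coords hZ.1]
  exact hZ

/-- In every orbit of a group of modular matrices `invHeight` attains its minimum. -/
lemma exists_min_invHeight (H : Subgroup (SiegelModularGroup 2))
    {z : Fin 3 → ℂ} (hz : z ∈ halfSpaceTwo) :
    ∃ g ∈ H, ∀ g' ∈ H, invHeight (act g (symMat z)) ≤ invHeight (act g' (symMat z)) := by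
  let row : SiegelModularGroup 2 → Fin 4 → ℤ := fun M =>
    ![blockC M 1 0, blockC M 1 1, blockD M 1 0, blockD M 1 1]
  let φ : (Fin 4 → ℤ) → ℝ := fun v => rowForm z (v 0) (v 1) (v 2) (v 3)
  have hφ : ∀ M, invHeight (act M (symMat z)) = φ (row M) := fun M => invHeight_act M hz
  let L := φ (row 1)
  let S : Set (Fin 4 → ℤ) := {v | v ∈ row '' (H : Set _) ∧ φ v ≤ L}
  obtain ⟨B, hB⟩ := exists_row_bound (mem_halfSpaceTwo.mp hz).2 ((z 0).im + (z 2).im)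
    (|(z 0).re| + |(z 1).re| + |(z 2).re|) L
  have hS : S.Finite := by
    refine (Set.finite_Icc (fun _ : Fin 4 => -⌈B⌉) (fun _ => ⌈B⌉)).subset fun v hv => ?_
    have hb := hB z hz le_rfl le_rfl (fun i => by
      have h0 := abs_nonneg (z 0).re
      have h1 := abs_nonneg (z 1).re
      have h2 := abs_nonneg (z 2).re
      fin_cases i <;> simp <;> linarith) _ _ _ _ hv.2
    have key : ∀ x : ℤ, |(x : ℝ)| ≤ B → -⌈B⌉ ≤ x ∧ x ≤ ⌈B⌉ := fun x hx => by
      have h2 : |(x : ℝ)| ≤ (⌈B⌉ : ℝ) := hx.trans (Int.le_ceil B)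
      rw [← Int.cast_abs, Int.cast_le] at h2
      exact abs_le.mp h2
    obtain ⟨h0, h1, h2, h3⟩ := hb
    rw [Set.mem_Icc]
    constructor
    · intro i
      fin_cases i
      exacts [(key _ h0).1, (key _ h1).1, (key _ h2).1, (key _ h3).1]
    · intro i
      fin_cases i
      exacts [(key _ h0).2, (key _ h1).2, (key _ h2).2, (key _ h3).2]
  obtain ⟨v, ⟨⟨g, hg, rfl⟩, hgL⟩, hmin⟩ := Set.exists_min_image S φ hS
    ⟨row 1, ⟨1, H.one_mem, rfl⟩, le_rfl⟩
  refine ⟨g, hg, fun g' hg' => ?_⟩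
  rw [hφ, hφ]
  by_cases h : φ (row g') ≤ L
  · exact hmin _ ⟨⟨g', hg', rfl⟩, h⟩
  · exact hgL.trans (not_le.mp h).le

end Reduction

section Reduced

open UpperHalfPlane

/-- The first diagonal entry of a point of the half plane, as a point of the upper half plane. -/
def firstEntry (Z : Matrix (Fin 2) (Fin 2) ℂ) (hZ : Z ∈ siegelUpperHalf 2) : ℍ :=
  ⟨Z 0 0, (mem_siegelUpperHalf_two.mp hZ).2.1⟩

lemma coe_firstEntry {Z : Matrix (Fin 2) (Fin 2) ℂ} (hZ : Z ∈ siegelUpperHalf 2) :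
    (firstEntry Z hZ : ℂ) = Z 0 0 := rfl

lemma act_eq_symMat (M : SiegelModularGroup 2) {Z : Matrix (Fin 2) (Fin 2) ℂ}
    (hZ : Z ∈ siegelUpperHalf 2) {f : (Fin 3 → ℂ) → Fin 3 → ℂ}
    (h : ∀ {z : Fin 3 → ℂ}, z ∈ halfSpaceTwo → act M (symMat z) = symMat (f z)) :
    act M Z = symMat (f (coords Z)) := by
  rw [← h (coords_mem hZ), symMat_coords hZ.1]

/-- The elliptic modular group acts on the first variable through matrices that do not change the
height. -/
lemma exists_act_firstEntry (γ : Matrix.SpecialLinearGroup (Fin 2) ℤ) :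
    ∃ g ∈ thetaCovariantGroup, ∀ (Z : Matrix (Fin 2) (Fin 2) ℂ) (hZ : Z ∈ siegelUpperHalf 2),
      firstEntry (act g Z) (act_mem g hZ) = γ • firstEntry Z hZ ∧
        invHeight (act g Z) = invHeight Z := by
  have hγ : γ ∈ Subgroup.closure {ModularGroup.S, ModularGroup.T} := by
    simp [SpecialLinearGroup.SL2Z_generators]
  induction hγ using Subgroup.closure_induction with
  | mem γ h =>
    rcases h with rfl | rfl
    · refine ⟨inversionGen, isThetaCovariant_inversionGen, fun Z hZ => ⟨?_, ?_⟩⟩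
      · rw [UpperHalfPlane.modular_S_smul]
        apply UpperHalfPlane.ext
        rw [coe_firstEntry, act_eq_symMat _ hZ act_inversionGen, UpperHalfPlane.coe_mk,
          coe_firstEntry]
        simp [symMat, invPoint, coords, neg_div, inv_neg]
      · have h1 := invHeight_act inversionGen (coords_mem hZ)
        rw [symMat_coords hZ.1] at h1
        rw [h1]
        simp [rowForm, inversionGen, ofBlocks, blockC, blockD, invHeight, coords]
    · refine ⟨translateGen, isThetaCovariant_translateGen, fun Z hZ => ⟨?_, ?_⟩⟩
      · rw [UpperHalfPlane.modular_T_smul]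
        apply UpperHalfPlane.ext
        rw [coe_firstEntry, act_eq_symMat _ hZ act_translateGen, UpperHalfPlane.coe_vadd,
          coe_firstEntry]
        simp [symMat, coords, add_comm]
      · rw [act_eq_symMat _ hZ act_translateGen]
        simp [invHeight, coords, symMat]
  | one => exact ⟨1, one_mem _, fun Z hZ => by simp [act_one]⟩
  | mul γ γ' _ _ ih ih' =>
    obtain ⟨g, hg, h⟩ := ih
    obtain ⟨g', hg', h'⟩ := ih'
    refine ⟨g * g', mul_mem hg hg', fun Z hZ => ⟨?_, ?_⟩⟩
    · rw [mul_smul, ← (h' Z hZ).1, ← (h _ (act_mem g' hZ)).1]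
      simp only [act_mul g g' hZ]
    · rw [act_mul g g' hZ, (h _ (act_mem g' hZ)).2, (h' Z hZ).2]
  | inv γ _ ih =>
    obtain ⟨g, hg, h⟩ := ih
    refine ⟨g⁻¹, inv_mem hg, fun Z hZ => ?_⟩
    obtain ⟨h1, h2⟩ := h _ (act_mem g⁻¹ hZ)
    simp only [act_act_inv g hZ] at h1 h2
    exact ⟨by rw [eq_inv_smul_iff, h1], h2.symm⟩

/-- The part of the half plane defined by those reduction conditions that are used in the
estimates. -/
def IsReduced (z : Fin 3 → ℂ) : Prop :=
  3 ≤ 4 * (z 0).im ^ 2 ∧ 0 < (z 0).im ∧ 2 * |(z 1).im| ≤ (z 0).im ∧ (z 0).im ≤ (z 2).im ∧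
    2 * |(z 1).re| ≤ 1

lemma exists_int_two_mul_abs_add_le (x y : ℝ) (hy : 0 < y) :
    ∃ k : ℤ, 2 * |x + k * y| ≤ y := by
  refine ⟨-round (x / y), ?_⟩
  have h := abs_sub_round (x / y)
  have e : x + (-round (x / y) : ℤ) * y = (x / y - round (x / y)) * y := by
    push_cast
    rw [sub_mul, div_mul_cancel₀ _ hy.ne']
    ring
  rw [e, abs_mul, abs_of_pos hy]
  nlinarith

/-- Every point of the half plane can be moved into the reduced domain by an element of the group
of theta covariant matrices. After minimizing `invHeight` there remain only substitutions that fix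
`invHeight`; the inequality `y₀ ≤ y₂` is the minimality with respect to `z₀ ↔ z₂`. -/
theorem exists_isReduced {z : Fin 3 → ℂ} (hz : z ∈ halfSpaceTwo) :
    ∃ g ∈ thetaCovariantGroup, IsReduced (coords (act g (symMat z))) := by
  obtain ⟨g₀, hg₀, hmin⟩ := exists_min_invHeight thetaCovariantGroup hz
  obtain ⟨γ, hγ⟩ := ModularGroup.exists_smul_mem_fd (firstEntry _ (act_mem g₀ hz))
  obtain ⟨g₁, hg₁, h1⟩ := exists_act_firstEntry γ
  obtain ⟨h1a, h1b⟩ := h1 _ (act_mem g₀ hz)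
  rw [← h1a] at hγ
  rw [← act_mul _ _ hz] at h1b
  have hm1 := act_mem (g₁ * g₀) hz
  have hγ' : firstEntry _ hm1 ∈ ModularGroup.fd := by
    convert hγ using 2
    exact act_mul _ _ hz
  obtain ⟨W, hW⟩ : ∃ W, W = act (g₁ * g₀) (symMat z) := ⟨_, rfl⟩
  have hWm : W ∈ siegelUpperHalf 2 := hW ▸ hm1
  have hy := ModularGroup.three_le_four_mul_im_sq_of_mem_fd hγ'
  have hy' : 3 ≤ 4 * (W 0 0).im ^ 2 := by rw [hW]; exact hy
  have hW0 : 0 < (W 0 0).im := (mem_siegelUpperHalf_two.mp hWm).2.1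
  obtain ⟨k, hk⟩ := exists_int_two_mul_abs_add_le (W 0 1).im (W 0 0).im hW0
  obtain ⟨l, hl⟩ := exists_int_two_mul_abs_add_le (W 0 1 + k * W 0 0).re 1 one_pos
  have hact : act (offDiagTranslate l * shear k) W =
      symMat ![W 0 0, W 0 1 + k * W 0 0 + l, W 1 1 + 2 * k * W 0 1 + k ^ 2 * W 0 0] := by
    rw [act_mul _ _ hWm, act_eq_symMat _ hWm (act_shear k)]
    have hm := act_mem (shear k) hWm
    rw [act_eq_symMat _ hWm (act_shear k)] at hm
    rw [act_offDiagTranslate l hm]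
    simp [coords]
  obtain ⟨V, hV⟩ : ∃ V, V = act (offDiagTranslate l * shear k) W := ⟨_, rfl⟩
  have hVm : V ∈ siegelUpperHalf 2 := hV ▸ act_mem _ hWm
  rw [← hV] at hact
  have hVe : V = act (offDiagTranslate l * shear k * (g₁ * g₀)) (symMat z) := by
    rw [act_mul _ _ hz, ← hW, hV]
  have hgm : offDiagTranslate l * shear k * (g₁ * g₀) ∈ thetaCovariantGroup :=
    mul_mem (mul_mem (offDiagTranslate_mem l) (shear_mem k)) (mul_mem hg₁ hg₀)
  have hVh : invHeight V = invHeight (act g₀ (symMat z)) := by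
    rw [← h1b, ← hW, hact]
    have hd : (W 0 0).im * (W 1 1 + 2 * k * W 0 1 + k ^ 2 * W 0 0).im -
        (W 0 1 + k * W 0 0 + l).im ^ 2 = (W 0 0).im * (W 1 1).im - (W 0 1).im ^ 2 := by
      have e1 : (W 1 1 + 2 * k * W 0 1 + k ^ 2 * W 0 0).im =
          (W 1 1).im + 2 * k * (W 0 1).im + k ^ 2 * (W 0 0).im := by
        have : W 1 1 + 2 * k * W 0 1 + k ^ 2 * W 0 0 =
            W 1 1 + ((2 * k : ℝ) : ℂ) * W 0 1 + ((k ^ 2 : ℝ) : ℂ) * W 0 0 := by push_cast; rfl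
        rw [this]
        simp only [Complex.add_im, Complex.im_ofReal_mul]
      have e2 : (W 0 1 + k * W 0 0 + l).im = (W 0 1).im + k * (W 0 0).im := by simp
      rw [e1, e2]
      ring
    simp only [invHeight, symMat]
    simpa using congrArg ((W 0 0).im / ·) hd
  have hswap : invHeight V ≤ invHeight (act swapGen V) := by
    have := hmin (swapGen * (offDiagTranslate l * shear k * (g₁ * g₀)))
      (mul_mem isThetaCovariant_swapGen hgm)
    rwa [act_mul _ _ hz, ← hVe, ← hVh] at this
  obtain ⟨-, hV0, hVd⟩ := mem_siegelUpperHalf_two.mp hVm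
  have hle : (V 0 0).im ≤ (V 1 1).im := by
    rw [act_eq_symMat _ hVm act_swapGen] at hswap
    have e : invHeight (symMat ![coords V 2, coords V 1, coords V 0]) =
        (V 1 1).im / ((V 0 0).im * (V 1 1).im - (V 0 1).im ^ 2) := by
      simp [invHeight, symMat, coords, mul_comm]
    rw [e, invHeight, div_le_div_iff_of_pos_right hVd] at hswap
    exact hswap
  refine ⟨_, hgm, ?_⟩
  rw [← hVe]
  have v0 : V 0 0 = W 0 0 := by rw [hact]; simp [symMat]
  have v1 : V 0 1 = W 0 1 + k * W 0 0 + l := by rw [hact]; simp [symMat]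
  refine ⟨?_, ?_, ?_, hle, ?_⟩
  · simpa [coords, v0] using hy'
  · simpa [coords, v0] using hW0
  · have : (V 0 1).im = (W 0 1).im + k * (W 0 0).im := by rw [v1]; simp
    simpa [coords, this, v0] using hk
  · have : (V 0 1).re = (W 0 1 + k * W 0 0).re + l := by
      rw [v1, Complex.add_re (_ + _)]; simp
    rw [mul_one, ← this] at hl
    simpa [coords] using hl

end Reduced

/-! ### Non-vanishing of the theta constants in the reduced domain -/

section Estimates

open Complex

/-- A series with a finite part that exceeds the bound for the remaining terms does not vanish. -/
lemma tsum_ne_zero_of_bound {ι : Type*} [DecidableEq ι] {f : ι → ℂ} {h : ι → ℝ} {H : ℝ}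
    (hh : HasSum h H) (hf : ∀ i, ‖f i‖ ≤ h i) (S : Finset ι)
    (hS : H < ‖∑ i ∈ S, f i‖ + ∑ i ∈ S, h i) : ∑' i, f i ≠ 0 := by
  intro h0
  have hs : Summable f := Summable.of_norm_bounded hh.summable hf
  have e1 := hs.sum_add_tsum_subtype_compl S
  have e2 := hh.summable.sum_add_tsum_subtype_compl S
  rw [h0] at e1
  rw [hh.tsum_eq] at e2
  have b : ‖∑' i : {i // i ∉ S}, f i‖ ≤ ∑' i : {i // i ∉ S}, h i :=
    tsum_of_norm_bounded (hh.summable.subtype _).hasSum fun i => hf i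
  have e3 : ∑ i ∈ S, f i = -∑' i : {i // i ∉ S}, f i := eq_neg_of_add_eq_zero_left e1
  rw [e3, norm_neg] at hS
  linarith

lemma HasSum.mul_prod_of_nonneg {ι κ : Type*} {f : ι → ℝ} {g : κ → ℝ} {a b : ℝ}
    (hf : HasSum f a) (hg : HasSum g b) (hf0 : ∀ i, 0 ≤ f i) (hg0 : ∀ i, 0 ≤ g i) :
    HasSum (fun p : ι × κ => f p.1 * g p.2) (a * b) :=
  hf.mul hg (hf.summable.mul_of_nonneg hg.summable hf0 hg0)

/-- The number `u` with `|n + 1/2| = u + 1/2`. -/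
def halfIndex : ℤ → ℕ := fun n => Int.rec (fun k => k) (fun k => k) n

lemma halfIndex_zero : halfIndex 0 = 0 := rfl

lemma halfIndex_neg_one : halfIndex (-1) = 0 := rfl

lemma abs_add_half (n : ℤ) : |(n : ℝ) + 1 / 2| = halfIndex n + 1 / 2 := by
  rcases n with k | k
  · simp only [halfIndex, Int.ofNat_eq_natCast, Int.cast_natCast]
    exact abs_of_pos (by positivity)
  · simp only [halfIndex, Int.cast_negSucc]
    push_cast
    rw [abs_of_neg (by linarith [(Nat.cast_nonneg k : (0 : ℝ) ≤ k)])]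
    ring

lemma add_half_sq (n : ℤ) : ((n : ℝ) + 1 / 2) ^ 2 = (halfIndex n + 1 / 2) ^ 2 := by
  rw [← abs_add_half, sq_abs]

lemma natAbs_two_mul_add_one (n : ℤ) : (2 * n + 1).natAbs = 2 * halfIndex n + 1 := by
  rcases n with k | k
  · simp only [halfIndex, Int.ofNat_eq_natCast]
    omega
  · simp only [halfIndex]
    omega

lemma hasSum_halfIndex {f : ℕ → ℝ} {a : ℝ} (hf : HasSum f a) :
    HasSum (fun n : ℤ => f (halfIndex n)) (2 * a) := by
  rw [two_mul]
  convert hf.int_rec hf using 1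
  ext n
  rcases n with k | k <;> rfl

lemma hasSum_natAbs_ne_zero {q : ℝ} (h0 : 0 ≤ q) (h1 : q < 1) :
    HasSum (fun n : ℤ => if n = 0 then 0 else q ^ n.natAbs) (2 * q / (1 - q)) := by
  have h := (hasSum_geometric_of_lt_one h0 h1).mul_left q
  have h' : HasSum (fun n : ℕ => if n = 0 then 0 else q ^ n) (q * (1 - q)⁻¹) := by
    rw [← hasSum_nat_add_iff' 1]
    simp only [Finset.range_one, Finset.sum_singleton, if_true, sub_zero]
    refine h.congr_fun fun n => ?_
    simp [pow_succ']
  have e : 2 * q / (1 - q) = q * (1 - q)⁻¹ + q * (1 - q)⁻¹ := by ring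
  rw [e]
  convert h'.int_rec h using 1
  ext n
  rcases n with k | k
  · simp
  · simp [pow_succ']

lemma hasSum_natAbs {q : ℝ} (h0 : 0 ≤ q) (h1 : q < 1) :
    HasSum (fun n : ℤ => q ^ n.natAbs) ((1 + q) / (1 - q)) := by
  have h := (hasSum_natAbs_ne_zero h0 h1).add (hasSum_ite_eq (0 : ℤ) (1 : ℝ))
  have hq : 1 - q ≠ 0 := by linarith
  convert h using 1
  · ext n
    by_cases hn : n = 0 <;> simp [hn]
  · field_simp
    ring

lemma hasSum_odd_mul_pow {q : ℝ} (h0 : 0 ≤ q) (h1 : q < 1) :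
    HasSum (fun n : ℕ => (2 * n + 1 : ℝ) * q ^ n) ((1 + q) / (1 - q) ^ 2) := by
  have hq : 1 - q ≠ 0 := by linarith
  have h := ((hasSum_coe_mul_geometric_of_norm_lt_one (r := q)
    (by rwa [Real.norm_of_nonneg h0])).mul_left 2).add (hasSum_geometric_of_lt_one h0 h1)
  have e : (1 + q) / (1 - q) ^ 2 = 2 * (q / (1 - q) ^ 2) + (1 - q)⁻¹ := by
    field_simp
    ring
  rw [e]
  exact h.congr_fun fun n => by ring

lemma exp_neg_pi_mul_le {y c Y : ℝ} {k : ℕ} (h : c + y * k ≤ Y) :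
    Real.exp (-Real.pi * Y) ≤ Real.exp (-Real.pi * c) * Real.exp (-Real.pi * y) ^ k := by
  rw [← Real.exp_nat_mul, ← Real.exp_add, Real.exp_le_exp]
  nlinarith [Real.pi_pos]

/-- The bound `exp (-π y / 2) ≤ 3/10` for points of the fundamental domain. -/
lemma exp_neg_pi_mul_half_le {y : ℝ} (h : 3 ≤ 4 * y ^ 2) (hy : 0 < y) :
    Real.exp (-Real.pi * (y / 2)) ≤ 3 / 10 := by
  have h1 : (43 : ℝ) / 50 ≤ y := by nlinarith
  have h2 : (5 : ℝ) / 4 ≤ Real.pi * (y / 2) := by nlinarith [Real.pi_gt_three]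
  have h3 : (10 : ℝ) / 3 ≤ Real.exp (5 / 4) := by
    have := Real.sum_le_exp_of_nonneg (show (0 : ℝ) ≤ 5 / 4 by norm_num) 4
    norm_num [Finset.sum_range_succ, Nat.factorial] at this
    linarith
  have h4 := h3.trans (Real.exp_le_exp.mpr h2)
  rw [neg_mul, Real.exp_neg]
  rw [inv_le_comm₀ (Real.exp_pos _) (by norm_num)]
  linarith

lemma sq_exp_half (y : ℝ) :
    Real.exp (-Real.pi * y) = Real.exp (-Real.pi * (y / 2)) ^ 2 := by
  rw [← Real.exp_nat_mul]
  congr 1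
  push_cast
  ring

lemma reduced_form_le {z : Fin 3 → ℂ} (hr : IsReduced z) (x y : ℝ) :
    (z 0).im * (x ^ 2 - |x| * |y|) + (z 2).im * y ^ 2 ≤
      (z 0).im * x ^ 2 + 2 * (z 1).im * x * y + (z 2).im * y ^ 2 := by
  obtain ⟨-, h0, h1, -, -⟩ := hr
  have h2 : |2 * (z 1).im * x * y| ≤ (z 0).im * (|x| * |y|) := by
    rw [mul_assoc, abs_mul, abs_mul, abs_mul x y, abs_two]
    exact mul_le_mul_of_nonneg_right h1 (by positivity)
  have := neg_abs_le (2 * (z 1).im * x * y)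
  linarith

/-- The characteristics `(0, b)`: the term with index `0` dominates. -/
lemma thetaZ_zero_zero_ne_zero {z : Fin 3 → ℂ} (hr : IsReduced z) (b₀ b₁ : ℤ) :
    thetaZ 0 0 b₀ b₁ z ≠ 0 := by
  have hp := exp_neg_pi_mul_half_le hr.1 hr.2.1
  have hq2 := sq_exp_half (z 0).im
  set p := Real.exp (-Real.pi * ((z 0).im / 2))
  have hp0 : 0 < p := Real.exp_pos _
  set q := Real.exp (-Real.pi * (z 0).im) with hq
  have hq0 : 0 < q := Real.exp_pos _
  have hq1 : q ≤ 9 / 100 := by rw [hq2]; nlinarith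
  let k : ℤ → ℝ := fun n => if n = 0 then 0 else q ^ n.natAbs
  have hk : ∀ n, 0 ≤ k n := fun n => by
    simp only [k]; split_ifs <;> positivity
  have s1 := hasSum_natAbs hq0.le (by linarith)
  have s2 := hasSum_natAbs_ne_zero hq0.le (by linarith)
  have s := (HasSum.mul_prod_of_nonneg s1 s1 (fun _ => by positivity) (fun _ => by positivity)).add
    ((HasSum.mul_prod_of_nonneg s2 s2 hk hk).mul_left q⁻¹)
  refine tsum_ne_zero_of_bound s (fun g => ?_) {(0, 0)} ?_
  · obtain ⟨m, n⟩ := g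
    rw [norm_thetaTerm]
    simp only [Int.cast_zero, zero_div, add_zero]
    have hm : |(m : ℝ)| = m.natAbs := by rw [Nat.cast_natAbs, Int.cast_abs]
    have hn : |(n : ℝ)| = n.natAbs := by rw [Nat.cast_natAbs, Int.cast_abs]
    have hred := reduced_form_le hr (m : ℝ) (n : ℝ)
    have hz2 := mul_le_mul_of_nonneg_right hr.2.2.2.1 (sq_nonneg (n : ℝ))
    have hy0 := hr.2.1
    have hm2 : (m : ℝ) ^ 2 = m.natAbs ^ 2 := by rw [← hm, sq_abs]
    have hn2 : (n : ℝ) ^ 2 = n.natAbs ^ 2 := by rw [← hn, sq_abs]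
    have hq' : ∀ j : ℕ, (j : ℝ) ≤ m.natAbs ^ 2 - m.natAbs * n.natAbs + n.natAbs ^ 2 →
        Real.exp (-Real.pi * ((z 0).im * m ^ 2 + 2 * (z 1).im * m * n + (z 2).im * n ^ 2)) ≤
          q ^ j := fun j hj => by
      rw [← hm2, ← hn2, ← hm, ← hn] at hj
      have hj' := mul_le_mul_of_nonneg_left hj hy0.le
      have := exp_neg_pi_mul_le (y := (z 0).im) (c := 0) (k := j)
        (Y := (z 0).im * m ^ 2 + 2 * (z 1).im * m * n + (z 2).im * n ^ 2) (by linarith)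
      rwa [mul_zero, Real.exp_zero, one_mul] at this
    have hnat : ∀ j : ℕ, (j : ℝ) ≤ j ^ 2 := fun j => by
      exact_mod_cast Nat.le_self_pow two_ne_zero j
    by_cases h : m = 0 ∨ n = 0
    · have hmn : (m.natAbs : ℝ) * n.natAbs = 0 := by
        rcases h with h | h <;> simp [h]
      have h1 := hq' (m.natAbs + n.natAbs) (by
        rw [hmn]
        push_cast
        linarith [hnat m.natAbs, hnat n.natAbs])
      have h2 : 0 ≤ q⁻¹ * (k m * k n) := mul_nonneg (by positivity) (mul_nonneg (hk m) (hk n))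
      rw [pow_add] at h1
      exact h1.trans (le_add_of_nonneg_right h2)
    · push Not at h
      have hm1 : 1 ≤ m.natAbs := Int.natAbs_pos.mpr h.1
      have hn1 : 1 ≤ n.natAbs := Int.natAbs_pos.mpr h.2
      have hm1' : (1 : ℝ) ≤ m.natAbs := by exact_mod_cast hm1
      have hn1' : (1 : ℝ) ≤ n.natAbs := by exact_mod_cast hn1
      have h1 := hq' (m.natAbs + n.natAbs - 1) (by
        rw [Nat.cast_sub (by omega)]
        push_cast
        nlinarith [mul_nonneg (sub_nonneg.mpr hm1') (sub_nonneg.mpr hn1'),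
          sq_nonneg ((m.natAbs : ℝ) - n.natAbs)])
      have h2 : q ^ (m.natAbs + n.natAbs - 1) = q⁻¹ * (k m * k n) := by
        simp only [k, if_neg h.1, if_neg h.2]
        rw [eq_inv_mul_iff_mul_eq₀ hq0.ne', ← pow_succ', ← pow_add]
        congr 1
        omega
      rw [h2] at h1
      exact h1.trans (le_add_of_nonneg_left (by positivity))
  · have e1 : (1 + q) / (1 - q) * ((1 + q) / (1 - q)) +
        q⁻¹ * (2 * q / (1 - q) * (2 * q / (1 - q))) = ((1 + q) ^ 2 + 4 * q) / (1 - q) ^ 2 := by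
      have : 1 - q ≠ 0 := by linarith
      field_simp
      ring
    rw [e1]
    simp only [Finset.sum_singleton, thetaTerm, thetaExponent]
    simp only [Int.cast_zero]
    have : ((1 + q) ^ 2 + 4 * q) / (1 - q) ^ 2 < 2 := by
      rw [div_lt_iff₀ (by nlinarith)]
      nlinarith
    simp
    linarith

lemma mixed_index_bound {u v : ℕ} (hv : 1 ≤ v) :
    (u : ℝ) + v - 1 / 2 ≤ u ^ 2 + u - u * v - v / 2 + v ^ 2 := by
  rcases hv.eq_or_lt with rfl | hv
  · have : (u : ℝ) ≤ u ^ 2 := by exact_mod_cast Nat.le_self_pow two_ne_zero u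
    push_cast
    linarith
  · have hv' : (2 : ℝ) ≤ v := by exact_mod_cast hv
    nlinarith [sq_nonneg ((u : ℝ) - v / 2)]

/-- The characteristics `((1, 0), (0, b))`: the two terms with `g₀ ∈ {0, -1}`, `g₁ = 0` dominate.
The lower bound for the quadratic form is stated with a parameter `ρ`, so that the case of the
characteristics `((0, 1), (b, 0))` follows by exchanging the variables. -/
lemma thetaZ_one_zero_ne_zero {w : Fin 3 → ℂ} {ρ : ℝ} (hρ : 3 ≤ 4 * ρ ^ 2) (hρ0 : 0 < ρ)
    (hw : ∀ x y : ℝ, 1 / 4 ≤ x ^ 2 → (w 0).im / 4 + ρ * (x ^ 2 - |x| * |y| + y ^ 2 - 1 / 4) ≤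
      (w 0).im * x ^ 2 + 2 * (w 1).im * x * y + (w 2).im * y ^ 2) (b₁ : ℤ) :
    thetaZ 1 0 0 b₁ w ≠ 0 := by
  have hp := exp_neg_pi_mul_half_le hρ hρ0
  have hq2 := sq_exp_half ρ
  obtain ⟨p, hpe⟩ : ∃ p, p = Real.exp (-Real.pi * (ρ / 2)) := ⟨_, rfl⟩
  obtain ⟨q, hqe⟩ : ∃ q, q = Real.exp (-Real.pi * ρ) := ⟨_, rfl⟩
  obtain ⟨C, hC⟩ : ∃ C, C = Real.exp (-Real.pi * ((w 0).im / 4)) := ⟨_, rfl⟩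
  rw [← hqe, ← hpe] at hq2
  rw [← hpe] at hp
  have hp0 : 0 < p := hpe ▸ Real.exp_pos _
  have hq0 : 0 < q := hqe ▸ Real.exp_pos _
  have hC0 : 0 < C := hC ▸ Real.exp_pos _
  have hq1 : q ≤ 9 / 100 := by rw [hq2]; nlinarith
  let k : ℤ → ℝ := fun n => if n = 0 then 0 else q ^ n.natAbs
  have hk : ∀ n, 0 ≤ k n := fun n => by
    simp only [k]; split_ifs <;> positivity
  have hk' : ∀ n : ℤ, 0 ≤ (if n = 0 then (1 : ℝ) else 0) + p⁻¹ * k n := fun n =>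
    add_nonneg (by split_ifs <;> norm_num) (mul_nonneg (by positivity) (hk n))
  have s1 := hasSum_halfIndex (hasSum_geometric_of_lt_one hq0.le (by linarith))
  have s2 := (hasSum_ite_eq (0 : ℤ) (1 : ℝ)).add
    ((hasSum_natAbs_ne_zero hq0.le (by linarith)).mul_left p⁻¹)
  have s := (HasSum.mul_prod_of_nonneg s1 s2 (fun _ => by positivity) hk').mul_left C
  refine tsum_ne_zero_of_bound s (fun g => ?_) {(0, 0), (-1, 0)} ?_
  · obtain ⟨m, n⟩ := g
    rw [norm_thetaTerm]
    simp only [Int.cast_zero, Int.cast_one, zero_div, add_zero]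
    have hn : |(n : ℝ)| = n.natAbs := by rw [Nat.cast_natAbs, Int.cast_abs]
    have hn2 : (n : ℝ) ^ 2 = n.natAbs ^ 2 := by rw [← hn, sq_abs]
    have hm := abs_add_half m
    have hm2 := add_half_sq m
    have hu0 : (0 : ℝ) ≤ halfIndex m := Nat.cast_nonneg _
    have hw' := hw (m + 1 / 2) n (by rw [hm2]; nlinarith)
    rw [hm, hn] at hw'
    nth_rewrite 1 [hm2] at hw'
    nth_rewrite 1 [hn2] at hw'
    by_cases h : n = 0
    · have h1 := exp_neg_pi_mul_le (c := (w 0).im / 4) (y := ρ) (k := halfIndex m)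
        (Y := (w 0).im * (m + 1 / 2) ^ 2 + 2 * (w 1).im * (m + 1 / 2) * n + (w 2).im * n ^ 2) (by
          refine le_trans ?_ hw'
          simp only [h, Int.natAbs_zero, Nat.cast_zero]
          nlinarith [mul_nonneg hρ0.le (sq_nonneg (halfIndex m : ℝ))])
      rw [← hC, ← hqe] at h1
      refine h1.trans (le_of_eq ?_)
      simp [h]
    · have hv : 1 ≤ n.natAbs := Int.natAbs_pos.mpr h
      have hb := mul_le_mul_of_nonneg_left (mixed_index_bound (u := halfIndex m) hv) hρ0.le
      have h1 := exp_neg_pi_mul_le (c := (w 0).im / 4 - ρ / 2) (y := ρ)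
        (k := halfIndex m + n.natAbs)
        (Y := (w 0).im * (m + 1 / 2) ^ 2 + 2 * (w 1).im * (m + 1 / 2) * n + (w 2).im * n ^ 2) (by
          refine le_trans ?_ hw'
          push_cast
          linarith)
      rw [mul_sub, sub_eq_add_neg, ← mul_neg, Real.exp_add, ← hC, ← hqe, mul_neg, Real.exp_neg,
        ← hpe, pow_add] at h1
      refine h1.trans (le_of_eq ?_)
      simp only [if_neg h]
      ring
  · have e1 : C * (2 * (1 - q)⁻¹ * (1 + p⁻¹ * (2 * q / (1 - q)))) =
        C * (2 * ((1 - q) + 2 * p) / (1 - q) ^ 2) := by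
      have : 1 - q ≠ 0 := by linarith
      rw [hq2] at this ⊢
      field_simp
    have e2 : (2 * ((1 - q) + 2 * p) / (1 - q) ^ 2) < 4 := by
      rw [div_lt_iff₀ (by nlinarith)]
      nlinarith
    have e3 : ∀ m : ℤ, m = 0 ∨ m = -1 → thetaTerm 1 0 0 b₁ w (m, 0) =
        cexp (Real.pi * I * (w 0 / 4)) := fun m hm => by
      rw [thetaTerm]
      congr 1
      rcases hm with rfl | rfl <;> simp [thetaExponent] <;> ring
    have e4 : ‖cexp (Real.pi * I * (w 0 / 4))‖ = C := by
      rw [Complex.norm_exp, hC]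
      congr 1
      simp
    rw [e1, Finset.sum_pair (by simp), Finset.sum_pair (by simp), e3 0 (Or.inl rfl),
      e3 (-1) (Or.inr rfl), ← two_mul, norm_mul, e4]
    have := mul_lt_mul_of_pos_left e2 hC0
    simp only [halfIndex_zero, halfIndex_neg_one, pow_zero, if_true, mul_zero,
      add_zero, mul_one, Complex.norm_ofNat]
    linarith

/-- Each term of a symmetrized theta series with characteristic `(1, 1)` is divisible by the
leading one: `X ^ k + σ X ^ (-k)` is a multiple of `X + σ X⁻¹` for odd `k` and `σ = ±1`. -/
lemma norm_pow_add_le {X σ : ℂ} (hX : X ≠ 0) (hσ : σ ^ 2 = 1) {r : ℝ} (h1 : ‖X‖ ≤ r)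
    (h2 : ‖X⁻¹‖ ≤ r) (j : ℕ) :
    ‖X ^ (2 * j + 1) + σ * X⁻¹ ^ (2 * j + 1)‖ ≤ (2 * j + 1) * r ^ (2 * j) * ‖X + σ * X⁻¹‖ := by
  have hσn : ‖σ‖ = 1 := by
    have : ‖σ‖ ^ 2 = 1 := by rw [← norm_pow, hσ, norm_one]
    exact (pow_eq_one_iff_of_nonneg (norm_nonneg _) two_ne_zero).mp this
  obtain ⟨Y, hY⟩ : ∃ Y, Y = -σ * X⁻¹ := ⟨_, rfl⟩
  have hYn : ‖Y‖ ≤ r := by rw [hY, norm_mul, norm_neg, hσn, one_mul]; exact h2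
  have e1 : X ^ (2 * j + 1) + σ * X⁻¹ ^ (2 * j + 1) = X ^ (2 * j + 1) - Y ^ (2 * j + 1) := by
    rw [hY, mul_pow, pow_succ (-σ), pow_mul, neg_sq, hσ, one_pow]
    ring
  have e2 : X + σ * X⁻¹ = X - Y := by rw [hY]; ring
  have hr : 0 ≤ r := (norm_nonneg _).trans h1
  rw [e1, e2, ← (Commute.all X Y).geom_sum₂_mul, norm_mul]
  refine mul_le_mul_of_nonneg_right ?_ (norm_nonneg _)
  refine (norm_sum_le _ _).trans ?_
  refine (Finset.sum_le_card_nsmul _ _ (r ^ (2 * j)) fun i hi => ?_).trans ?_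
  · have hi' := Finset.mem_range.mp hi
    rw [norm_mul, norm_pow, norm_pow]
    calc _ ≤ r ^ i * r ^ (2 * j + 1 - 1 - i) := by gcongr
      _ = r ^ (2 * j) := by rw [← pow_add]; congr 1; omega
  · simp

lemma norm_zpow_add_le {X σ : ℂ} (hX : X ≠ 0) (hσ : σ ^ 2 = 1) {r : ℝ} (h1 : ‖X‖ ≤ r)
    (h2 : ‖X⁻¹‖ ≤ r) {k : ℤ} {j : ℕ} (hk : k.natAbs = 2 * j + 1) :
    ‖X ^ k + σ * (X ^ k)⁻¹‖ ≤ (2 * j + 1) * r ^ (2 * j) * ‖X + σ * X⁻¹‖ := by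
  have hσn : ‖σ‖ = 1 := by
    have : ‖σ‖ ^ 2 = 1 := by rw [← norm_pow, hσ, norm_one]
    exact (pow_eq_one_iff_of_nonneg (norm_nonneg _) two_ne_zero).mp this
  have h := norm_pow_add_le hX hσ h1 h2 j
  rcases Int.natAbs_eq k with e | e
  · rw [e, hk, zpow_natCast, ← inv_pow]
    exact h
  · have e' : X ^ k + σ * (X ^ k)⁻¹ = σ * (X ^ (2 * j + 1) + σ * X⁻¹ ^ (2 * j + 1)) := by
      rw [e, hk, _root_.zpow_neg, zpow_natCast, inv_inv, inv_pow]
      linear_combination (-(X ^ (2 * j + 1))⁻¹) * hσ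
    rw [e', norm_mul, hσn, one_mul]
    exact h

lemma thetaTerm_one_one_neg (b : ℤ) (z : Fin 3 → ℂ) (m n : ℤ) :
    thetaTerm 1 1 b b z (-1 - m, -1 - n) = thetaTerm 1 1 b b z (m, n) := by
  rw [thetaTerm, thetaTerm, Complex.exp_eq_exp_iff_exists_int]
  refine ⟨-(b * (m + n + 1)), ?_⟩
  simp only [thetaExponent]
  push_cast
  ring

lemma thetaTerm_one_one_add (b : ℤ) (z : Fin 3 → ℂ) {X σ : ℂ}
    (hX : X = cexp (Real.pi * I * (z 1 / 2))) (hσ : σ = cexp (Real.pi * I * b)) (m n : ℤ) :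
    thetaTerm 1 1 b b z (m, n) + thetaTerm 1 1 b b z (-1 - m, n) =
      cexp (Real.pi * I * (z 0 * (m + 1 / 2) ^ 2 + z 2 * (n + 1 / 2) ^ 2)) *
        cexp (Real.pi * I * (b * (m + n + 1))) *
        (X ^ ((2 * m + 1) * (2 * n + 1)) + σ * (X ^ ((2 * m + 1) * (2 * n + 1)))⁻¹) := by
  rw [hX, hσ, ← Complex.exp_int_mul, ← Complex.exp_neg, ← Complex.exp_add, ← Complex.exp_add,
    mul_add, ← Complex.exp_add, ← Complex.exp_add]
  congr 1
  · rw [thetaTerm]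
    congr 1
    simp only [thetaExponent]
    push_cast
    ring
  · rw [thetaTerm, Complex.exp_eq_exp_iff_exists_int]
    refine ⟨-(b * (m + 1)), ?_⟩
    simp only [thetaExponent]
    push_cast
    ring

/-- The characteristics `((1, 1), (b, b))`: the four terms with `g₀, g₁ ∈ {0, -1}` dominate. Their
sum is a multiple of `X + σ X⁻¹` with `X = exp (π i z₁ / 2)`, `σ = (-1)ᵇ`, and so are the other
terms after symmetrization. -/
lemma thetaZ_one_one_ne_zero {z : Fin 3 → ℂ} (hr : IsReduced z) (b : ℤ)
    (hs : Summable (thetaTerm 1 1 b b z)) {X σ : ℂ} (hX : X = cexp (Real.pi * I * (z 1 / 2)))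
    (hσ : σ = cexp (Real.pi * I * b)) (hD : X + σ * X⁻¹ ≠ 0) :
    thetaZ 1 1 b b z ≠ 0 := by
  let G : ℤ × ℤ → ℂ := fun p => thetaTerm 1 1 b b z p + thetaTerm 1 1 b b z (-1 - p.1, p.2)
  have hG : ∑' p, G p = 2 * thetaZ 1 1 b b z := by
    have e := ((Equiv.subLeft (-1 : ℤ)).prodCongr (Equiv.refl ℤ)).tsum_eq (thetaTerm 1 1 b b z)
    have hs' := ((Equiv.subLeft (-1 : ℤ)).prodCongr (Equiv.refl ℤ)).summable_iff.mpr hs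
    rw [thetaZ, two_mul]
    nth_rewrite 2 [← e]
    exact hs.tsum_add hs'
  suffices h : ∑' p, G p ≠ 0 by
    rw [hG] at h
    exact right_ne_zero_of_mul h
  obtain ⟨hy, hy0, hy1, hy2, -⟩ := hr
  have hp := exp_neg_pi_mul_half_le hy hy0
  have hq2 := sq_exp_half (z 0).im
  obtain ⟨q, hqe⟩ : ∃ q, q = Real.exp (-Real.pi * (z 0).im) := ⟨_, rfl⟩
  obtain ⟨C, hC⟩ : ∃ C, C = Real.exp (-Real.pi * (((z 0).im + (z 2).im) / 4)) := ⟨_, rfl⟩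
  have hq0 : 0 < q := hqe ▸ Real.exp_pos _
  have hC0 : 0 < C := hC ▸ Real.exp_pos _
  have hq1 : q ≤ 9 / 100 := by
    rw [hqe, hq2]
    nlinarith [Real.exp_pos (-Real.pi * ((z 0).im / 2))]
  have hX0 : X ≠ 0 := hX ▸ Complex.exp_ne_zero _
  have hσ2 : σ ^ 2 = 1 := by
    rw [hσ, ← Complex.exp_nat_mul]
    exact Complex.exp_eq_one_iff.mpr ⟨b, by push_cast; ring⟩
  obtain ⟨r, hre⟩ : ∃ r, r = Real.exp (Real.pi * (|(z 1).im| / 2)) := ⟨_, rfl⟩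
  have hXre : (Real.pi * I * (z 1 / 2)).re = -(Real.pi * ((z 1).im / 2)) := by
    have : Real.pi * I * (z 1 / 2) = (Real.pi / 2 : ℝ) * (I * z 1) := by push_cast; ring
    rw [this, Complex.re_ofReal_mul, Complex.I_mul_re]
    ring
  have h1 : ‖X‖ ≤ r := by
    rw [hX, hre, Complex.norm_exp, Real.exp_le_exp, hXre]
    nlinarith [neg_abs_le (z 1).im, Real.pi_pos]
  have h2 : ‖X⁻¹‖ ≤ r := by
    rw [hX, hre, ← Complex.exp_neg, Complex.norm_exp, Real.exp_le_exp, Complex.neg_re, hXre]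
    nlinarith [le_abs_self (z 1).im, Real.pi_pos]
  obtain ⟨D, hDe⟩ : ∃ D, D = ‖X + σ * X⁻¹‖ := ⟨_, rfl⟩
  have hD0 : 0 < D := hDe ▸ norm_pos_iff.mpr hD
  have hunit : ∀ k : ℤ, ‖cexp (Real.pi * I * (b * k))‖ = 1 := fun k => by
    rw [Complex.norm_exp]
    have : Real.pi * I * (b * k) = ((Real.pi * (b * k) : ℝ) : ℂ) * I := by push_cast; ring
    rw [this, Complex.re_ofReal_mul]
    simp
  have hGn : ∀ m n : ℤ, ‖G (m, n)‖ =
      Real.exp (-Real.pi * ((z 0).im * (m + 1 / 2) ^ 2 + (z 2).im * (n + 1 / 2) ^ 2)) *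
      ‖X ^ ((2 * m + 1) * (2 * n + 1)) + σ * (X ^ ((2 * m + 1) * (2 * n + 1)))⁻¹‖ := by
    intro m n
    simp only [G]
    rw [thetaTerm_one_one_add b z hX hσ, norm_mul, norm_mul]
    have := hunit (m + n + 1)
    push_cast at this
    rw [this, mul_one, Complex.norm_exp]
    congr 2
    have : Real.pi * I * (z 0 * (m + 1 / 2) ^ 2 + z 2 * (n + 1 / 2) ^ 2) =
        (Real.pi : ℂ) * (I * (((m + 1 / 2) ^ 2 : ℝ) * z 0 + ((n + 1 / 2) ^ 2 : ℝ) * z 2)) := by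
      push_cast; ring
    rw [this, Complex.re_ofReal_mul, Complex.I_mul_re, Complex.add_im, Complex.im_ofReal_mul,
      Complex.im_ofReal_mul]
    ring
  have s1 := hasSum_halfIndex (hasSum_odd_mul_pow hq0.le (by linarith))
  have s := (HasSum.mul_prod_of_nonneg s1 s1 (fun _ => by positivity)
    (fun _ => by positivity)).mul_left (C * D)
  refine tsum_ne_zero_of_bound s (fun g => ?_) ({0, -1} ×ˢ {0, -1}) ?_
  · obtain ⟨m, n⟩ := g
    rw [hGn, add_half_sq m, add_half_sq n]
    obtain ⟨u, hu⟩ : ∃ u, u = halfIndex m := ⟨_, rfl⟩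
    obtain ⟨v, hv⟩ : ∃ v, v = halfIndex n := ⟨_, rfl⟩
    have hk : ((2 * m + 1) * (2 * n + 1)).natAbs = 2 * (2 * u * v + u + v) + 1 := by
      rw [Int.natAbs_mul, natAbs_two_mul_add_one, natAbs_two_mul_add_one, hu, hv]
      ring
    have hb := norm_zpow_add_le hX0 hσ2 h1 h2 hk
    have hrj : r ^ (2 * (2 * u * v + u + v)) =
        Real.exp (Real.pi * (|(z 1).im| * (2 * u * v + u + v))) := by
      rw [hre, ← Real.exp_nat_mul]
      congr 1
      push_cast
      ring
    rw [hrj, ← hDe] at hb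
    have hsq : ∀ j : ℕ, (j : ℝ) ≤ j ^ 2 := fun j => by
      exact_mod_cast Nat.le_self_pow two_ne_zero j
    have hc := exp_neg_pi_mul_le (c := ((z 0).im + (z 2).im) / 4) (y := (z 0).im) (k := u + v)
      (Y := (z 0).im * (u + 1 / 2) ^ 2 + (z 2).im * (v + 1 / 2) ^ 2 -
        |(z 1).im| * (2 * u * v + u + v)) (by
        have hj : (0 : ℝ) ≤ 2 * u * v + u + v := by positivity
        have a1 := mul_le_mul_of_nonneg_right hy1 hj
        have a2 := mul_le_mul_of_nonneg_right hy2 (show (0 : ℝ) ≤ v ^ 2 + v by positivity)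
        have a3 := mul_nonneg hy0.le (show (0 : ℝ) ≤ 2 * (u ^ 2 + v ^ 2 - u * v) - (u + v) by
          nlinarith [hsq u, hsq v, sq_nonneg ((u : ℝ) - v)])
        push_cast
        nlinarith)
    rw [← hC, ← hqe] at hc
    have hexp : Real.exp (-Real.pi * ((z 0).im * (u + 1 / 2) ^ 2 + (z 2).im * (v + 1 / 2) ^ 2 -
        |(z 1).im| * (2 * u * v + u + v))) =
        Real.exp (-Real.pi * ((z 0).im * (u + 1 / 2) ^ 2 + (z 2).im * (v + 1 / 2) ^ 2)) *
          Real.exp (Real.pi * (|(z 1).im| * (2 * u * v + u + v))) := by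
      rw [← Real.exp_add]
      congr 1
      ring
    rw [hexp] at hc
    rw [← hu, ← hv]
    have hF : (0 : ℝ) ≤ (2 * ((2 * u * v + u + v : ℕ) : ℝ) + 1) * D := by positivity
    have e := mul_le_mul_of_nonneg_right hc hF
    refine (mul_le_mul_of_nonneg_left hb (Real.exp_pos _).le).trans ?_
    calc _ = _ := by ring
      _ ≤ _ := e
      _ = _ := by
        push_cast
        ring
  · have g00 : ‖G (0, 0)‖ = C * D := by
      rw [hGn, hDe, hC]
      congr 2
      · push_cast; ring
      · simp
    have g10 : G (-1, 0) = G (0, 0) := by simp [G, add_comm]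
    have g01 : G (0, -1) = G (0, 0) := by
      have e1 := thetaTerm_one_one_neg b z 0 0
      have e2 := thetaTerm_one_one_neg b z (-1) 0
      simp only [sub_zero, sub_neg_eq_add, neg_add_cancel] at e1 e2
      simp only [G, sub_zero]
      rw [e1, e2, add_comm]
    have g11 : G (-1, -1) = G (0, 0) := by
      rw [← g01]
      simp [G, add_comm]
    have hS : ((1 + q) / (1 - q) ^ 2) ^ 2 < 2 := by
      have h0 : 0 ≤ (1 + q) / (1 - q) ^ 2 := by positivity
      have : (1 + q) / (1 - q) ^ 2 ≤ 7 / 5 := by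
        rw [div_le_iff₀ (by nlinarith)]
        nlinarith
      nlinarith
    have hCD : 0 < C * D := by positivity
    have := mul_lt_mul_of_pos_left hS hCD
    rw [Finset.sum_product, Finset.sum_product, Finset.sum_pair (by simp),
      Finset.sum_pair (by simp), Finset.sum_pair (by simp), Finset.sum_pair (by simp),
      Finset.sum_pair (by simp), Finset.sum_pair (by simp), g10, g01, g11]
    simp only [halfIndex_zero, halfIndex_neg_one]
    have e4 : G (0, 0) + G (0, 0) + (G (0, 0) + G (0, 0)) = 4 * G (0, 0) := by ring
    rw [e4, norm_mul, g00]
    simp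
    nlinarith

/-- In the reduced domain an even theta constant vanishes at most for the characteristic consisting
of ones, and then only on the diagonal. -/
theorem eq_one_and_eq_zero_of_theta_eq_zero {z : Fin 3 → ℂ} (hz : z ∈ halfSpaceTwo)
    (hr : IsReduced z) {m : Characteristic 2} (hm : IsEvenChar m) (h : theta m (symMat z) = 0) :
    m = (1, 1) ∧ z 1 = 0 := by
  rw [theta_eq_thetaZ] at h
  have key : ∀ m : Characteristic 2, IsEvenChar m →
      ((m.1 0).val = 0 ∧ (m.1 1).val = 0) ∨
      ((m.1 0).val = 1 ∧ (m.1 1).val = 0 ∧ (m.2 0).val = 0) ∨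
      ((m.1 0).val = 0 ∧ (m.1 1).val = 1 ∧ (m.2 1).val = 0) ∨
      ((m.1 0).val = 1 ∧ (m.1 1).val = 1 ∧ (m.2 0).val = 0 ∧ (m.2 1).val = 0) ∨
      ((m.1 0).val = 1 ∧ (m.1 1).val = 1 ∧ (m.2 0).val = 1 ∧ (m.2 1).val = 1 ∧ m = (1, 1)) := by
    decide
  have hsq : ∀ y : ℝ, 1 / 4 ≤ y ^ 2 → (z 0).im * (y ^ 2 - 1 / 4) ≤ (z 2).im * (y ^ 2 - 1 / 4) :=
    fun y hy => mul_le_mul_of_nonneg_right hr.2.2.2.1 (by linarith)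
  have hs := fun b : ℤ => summable_thetaTerm 1 1 b b hz
  have hX : cexp (Real.pi * I * (z 1 / 2)) ≠ 0 := Complex.exp_ne_zero _
  have hX2 : cexp (Real.pi * I * (z 1 / 2)) * cexp (Real.pi * I * (z 1 / 2)) =
      cexp (Real.pi * I * z 1) := by
    rw [← Complex.exp_add]
    congr 1
    ring
  have hpi : (Real.pi : ℂ) ≠ 0 := by exact_mod_cast Real.pi_ne_zero
  have hre : |(z 1).re| ≤ 1 / 2 := by linarith [hr.2.2.2.2]
  rcases key m hm with ⟨h0, h1⟩ | ⟨h0, h1, h2⟩ | ⟨h0, h1, h2⟩ | ⟨h0, h1, h2, h3⟩ |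
      ⟨h0, h1, h2, h3, h4⟩
  · rw [h0, h1] at h
    exact absurd h (thetaZ_zero_zero_ne_zero hr _ _)
  · rw [h0, h1, h2] at h
    refine absurd h (thetaZ_one_zero_ne_zero hr.1 hr.2.1 (fun x y _ => ?_) _)
    have := reduced_form_le hr x y
    have := mul_le_mul_of_nonneg_right hr.2.2.2.1 (sq_nonneg y)
    linarith
  · rw [h0, h1, h2, ← thetaZ_swap] at h
    refine absurd h (thetaZ_one_zero_ne_zero (ρ := (z 0).im) hr.1 hr.2.1 (fun x y hx => ?_) _)
    have := reduced_form_le hr y x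
    have := hsq x hx
    simp
    linarith
  · rw [h0, h1, h2, h3] at h
    refine absurd h (thetaZ_one_one_ne_zero hr 0 (hs 0) rfl rfl fun hD => ?_)
    rw [Int.cast_zero, mul_zero, Complex.exp_zero, one_mul] at hD
    have e : cexp (Real.pi * I * z 1) = cexp (Real.pi * I) := by
      rw [← hX2, Complex.exp_pi_mul_I]
      linear_combination cexp (Real.pi * I * (z 1 / 2)) * hD - mul_inv_cancel₀ hX
    obtain ⟨n, hn⟩ := Complex.exp_eq_exp_iff_exists_int.mp e
    have hz1 : z 1 = ((1 + 2 * n : ℤ) : ℂ) := by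
      have hpI : (Real.pi : ℂ) * I ≠ 0 := mul_ne_zero hpi I_ne_zero
      refine mul_left_cancel₀ hpI ?_
      rw [hn]
      push_cast
      ring
    rw [hz1, Complex.intCast_re, ← Int.cast_abs] at hre
    have : (1 : ℤ) ≤ |1 + 2 * n| := Int.one_le_abs (by omega)
    have : (1 : ℝ) ≤ ((|1 + 2 * n| : ℤ) : ℝ) := by exact_mod_cast this
    linarith
  · refine ⟨h4, ?_⟩
    by_contra hne
    rw [h0, h1, h2, h3] at h
    refine absurd h (thetaZ_one_one_ne_zero hr 1 (hs 1) rfl rfl fun hD => ?_)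
    rw [Int.cast_one, mul_one, Complex.exp_pi_mul_I] at hD
    have e : cexp (Real.pi * I * z 1) = 1 := by
      rw [← hX2]
      linear_combination cexp (Real.pi * I * (z 1 / 2)) * hD + mul_inv_cancel₀ hX
    obtain ⟨n, hn⟩ := Complex.exp_eq_one_iff.mp e
    have hz1 : z 1 = ((2 * n : ℤ) : ℂ) := by
      have hpI : (Real.pi : ℂ) * I ≠ 0 := mul_ne_zero hpi I_ne_zero
      refine mul_left_cancel₀ hpI ?_
      rw [hn]
      push_cast
      ring
    have hn0 : n ≠ 0 := by
      rintro rfl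
      exact hne (by simpa using hz1)
    rw [hz1, Complex.intCast_re, ← Int.cast_abs] at hre
    have : (1 : ℤ) ≤ |2 * n| := Int.one_le_abs (by omega)
    have : (1 : ℝ) ≤ ((|2 * n| : ℤ) : ℝ) := by exact_mod_cast this
    linarith

end Estimates

/-! ### Analytic subsets -/

section AnalyticSubsets

open Topology

variable {E : Type*} [NormedAddCommGroup E] [NormedSpace ℂ E] {Ω : Set E}

lemma IsAnalyticSubset.of_fintype {A : Set E} (hA : A ⊆ Ω)
    (h : ∀ p ∈ Ω, ∃ U : Set E, IsOpen U ∧ p ∈ U ∧ U ⊆ Ω ∧ ∃ (ι : Type) (_ : Fintype ι)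
      (f : ι → E → ℂ), (∀ i, DifferentiableOn ℂ (f i) U) ∧
        A ∩ U = {z | z ∈ U ∧ ∀ i, f i z = 0}) : IsAnalyticSubset Ω A := by
  refine ⟨hA, fun p hp => ?_⟩
  obtain ⟨U, h1, h2, h3, ι, _, f, h4, h5⟩ := h p hp
  refine ⟨U, h1, h2, h3, Fintype.card ι, fun i => f ((Fintype.equivFin ι).symm i),
    fun i => h4 _, ?_⟩
  rw [h5]
  ext z
  simp only [Set.mem_ofPred_eq]
  refine and_congr_right fun _ => ?_
  exact ((Fintype.equivFin ι).symm.forall_congr_right (q := fun i => f i z = 0)).symm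

lemma IsAnalyticSubset.inter {A B : Set E} (hA : IsAnalyticSubset Ω A)
    (hB : IsAnalyticSubset Ω B) : IsAnalyticSubset Ω (A ∩ B) := by
  refine .of_fintype (Set.inter_subset_left.trans hA.1) fun p hp => ?_
  obtain ⟨U, u1, u2, u3, k, f, u4, u5⟩ := hA.2 p hp
  obtain ⟨V, v1, v2, v3, l, g, v4, v5⟩ := hB.2 p hp
  refine ⟨U ∩ V, u1.inter v1, ⟨u2, v2⟩, Set.inter_subset_left.trans u3, Fin k ⊕ Fin l,
    inferInstance, Sum.elim f g, ?_, ?_⟩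
  · rintro (i | i)
    · exact (u4 i).mono Set.inter_subset_left
    · exact (v4 i).mono Set.inter_subset_right
  · ext z
    have hu := Set.ext_iff.mp u5 z
    have hv := Set.ext_iff.mp v5 z
    simp only [Set.mem_inter_iff, Set.mem_ofPred_eq, Sum.forall, Sum.elim_inl,
      Sum.elim_inr] at hu hv ⊢
    tauto

lemma IsAnalyticSubset.union {A B : Set E} (hA : IsAnalyticSubset Ω A)
    (hB : IsAnalyticSubset Ω B) : IsAnalyticSubset Ω (A ∪ B) := by
  refine .of_fintype (Set.union_subset hA.1 hB.1) fun p hp => ?_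
  obtain ⟨U, u1, u2, u3, k, f, u4, u5⟩ := hA.2 p hp
  obtain ⟨V, v1, v2, v3, l, g, v4, v5⟩ := hB.2 p hp
  refine ⟨U ∩ V, u1.inter v1, ⟨u2, v2⟩, Set.inter_subset_left.trans u3, Fin k × Fin l,
    inferInstance, fun i z => f i.1 z * g i.2 z, fun i =>
      ((u4 i.1).mono Set.inter_subset_left).mul ((v4 i.2).mono Set.inter_subset_right), ?_⟩
  ext z
  have hu := Set.ext_iff.mp u5 z
  have hv := Set.ext_iff.mp v5 z
  simp only [Set.mem_inter_iff, Set.mem_union, Set.mem_ofPred_eq, mul_eq_zero,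
    Prod.forall] at hu hv ⊢
  have key : (∀ i j, f i z = 0 ∨ g j z = 0) ↔ (∀ i, f i z = 0) ∨ ∀ j, g j z = 0 := by
    constructor
    · intro h
      by_contra! hc
      obtain ⟨⟨i, hi⟩, j, hj⟩ := hc
      exact (h i j).elim hi hj
    · rintro (h | h) i j
      · exact Or.inl (h i)
      · exact Or.inr (h j)
  rw [key]
  tauto

/-- Some open set containing `p` and contained in `Ω` exists as soon as there is an analytic
subset of `Ω`; this is how `Ω` is known to be open. -/
lemma IsAnalyticSubset.empty {A : Set E} (hA : IsAnalyticSubset Ω A) :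
    IsAnalyticSubset Ω (∅ : Set E) := by
  refine .of_fintype (Set.empty_subset _) fun p hp => ?_
  obtain ⟨U, u1, u2, u3, -⟩ := hA.2 p hp
  refine ⟨U, u1, u2, u3, Unit, inferInstance, fun _ _ => 1,
    fun _ => differentiableOn_const _, ?_⟩
  simp

lemma IsAnalyticSubset.biUnion_finite {ι : Type*} {D : ι → Set E} {A : Set E}
    (hA : IsAnalyticSubset Ω A) (hD : ∀ i, IsAnalyticSubset Ω (D i)) {S : Set ι}
    (hS : S.Finite) : IsAnalyticSubset Ω (⋃ i ∈ S, D i) := by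
  induction S, hS using Set.Finite.induction_on with
  | empty => simpa using hA.empty
  | insert _ _ ih =>
    rw [Set.biUnion_insert]
    exact (hD _).union ih

lemma IsAnalyticSubset.biUnion_locallyFinite {ι : Type*} {D : ι → Set E} {A : Set E}
    (hA : IsAnalyticSubset Ω A) (hD : ∀ i, IsAnalyticSubset Ω (D i))
    (hfin : ∀ p ∈ Ω, ∃ U, IsOpen U ∧ p ∈ U ∧ {i | (D i ∩ U).Nonempty}.Finite) (T : Set ι) :
    IsAnalyticSubset Ω (⋃ i ∈ T, D i) := by
  refine ⟨Set.iUnion₂_subset fun i _ => (hD i).1, fun p hp => ?_⟩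
  obtain ⟨U, u1, u2, u3⟩ := hfin p hp
  obtain ⟨V, v1, v2, v3, k, f, v4, v5⟩ :=
    (hA.biUnion_finite hD (u3.inter_of_left T)).2 p hp
  refine ⟨U ∩ V, u1.inter v1, ⟨u2, v2⟩, Set.inter_subset_right.trans v3, k, f,
    fun i => (v4 i).mono Set.inter_subset_right, ?_⟩
  ext z
  have hv := Set.ext_iff.mp v5 z
  have key : z ∈ U → ((z ∈ ⋃ i ∈ T, D i) ↔
      z ∈ ⋃ i ∈ {i | (D i ∩ U).Nonempty} ∩ T, D i) := by
    intro hz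
    simp only [Set.mem_iUnion₂]
    constructor
    · rintro ⟨i, hi, hzi⟩
      exact ⟨i, ⟨⟨z, hzi, hz⟩, hi⟩, hzi⟩
    · rintro ⟨i, ⟨-, hi⟩, hzi⟩
      exact ⟨i, hi, hzi⟩
  simp only [Set.mem_inter_iff, Set.mem_ofPred_eq] at hv ⊢
  constructor
  · rintro ⟨h1, h2, h3⟩
    exact ⟨⟨h2, h3⟩, (hv.mp ⟨(key h2).mp h1, h3⟩).2⟩
  · rintro ⟨⟨h2, h3⟩, h4⟩
    exact ⟨(key h2).mpr (hv.mpr ⟨h3, h4⟩).1, h2, h3⟩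

lemma IsIrreducibleAnalytic.subset_or_subset {F A B : Set E} (hF : IsIrreducibleAnalytic Ω F)
    (hA : IsAnalyticSubset Ω A) (hB : IsAnalyticSubset Ω B) (h : F ⊆ A ∪ B) : F ⊆ A ∨ F ⊆ B := by
  have e : F = (F ∩ A) ∪ (F ∩ B) := by
    rw [← Set.inter_union_distrib_left]
    exact (Set.inter_eq_left.mpr h).symm
  rcases hF.2.2 _ _ (hF.1.inter hA) (hF.1.inter hB) e with h | h
  · exact Or.inl (Set.inter_eq_left.mp h.symm)
  · exact Or.inr (Set.inter_eq_left.mp h.symm)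

lemma IsIrreducibleAnalytic.exists_subset_of_finite {ι : Type*} {D : ι → Set E} {F : Set E}
    (hF : IsIrreducibleAnalytic Ω F) (hD : ∀ i, IsAnalyticSubset Ω (D i)) {S : Set ι}
    (hS : S.Finite) (h : F ⊆ ⋃ i ∈ S, D i) : ∃ i ∈ S, F ⊆ D i := by
  induction S, hS using Set.Finite.induction_on with
  | empty =>
    obtain ⟨x, hx⟩ := hF.2.1
    simpa using h hx
  | @insert a S _ hS ih =>
    rw [Set.biUnion_insert] at h
    rcases hF.subset_or_subset (hD a) (hF.1.biUnion_finite hD hS) h with h | h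
    · exact ⟨a, Set.mem_insert _ _, h⟩
    · obtain ⟨i, hi, hi'⟩ := ih h
      exact ⟨i, Set.mem_insert_of_mem _ hi, hi'⟩

/-- An irreducible analytic set covered by a locally finite family of analytic sets lies in a
member of the family: it is not contained in the union of those members that avoid a given one of
its points. -/
theorem IsIrreducibleAnalytic.exists_subset {ι : Type*} {D : ι → Set E} {F : Set E}
    (hF : IsIrreducibleAnalytic Ω F) (hD : ∀ i, IsAnalyticSubset Ω (D i))
    (hfin : ∀ p ∈ Ω, ∃ U, IsOpen U ∧ p ∈ U ∧ {i | (D i ∩ U).Nonempty}.Finite)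
    (h : F ⊆ ⋃ i, D i) : ∃ i, F ⊆ D i := by
  obtain ⟨p, hp⟩ := hF.2.1
  obtain ⟨U, -, u2, u3⟩ := hfin p (hF.1.1 hp)
  have hS : {i | p ∈ D i}.Finite := u3.subset fun i hi => ⟨p, hi, u2⟩
  have hcov : F ⊆ (⋃ i ∈ {i | p ∈ D i}, D i) ∪ ⋃ i ∈ {i | p ∉ D i}, D i := by
    intro x hx
    obtain ⟨i, hi⟩ := Set.mem_iUnion.mp (h hx)
    by_cases hpi : p ∈ D i
    · exact Or.inl (Set.mem_biUnion hpi hi)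
    · exact Or.inr (Set.mem_biUnion hpi hi)
  rcases hF.subset_or_subset (hF.1.biUnion_finite hD hS)
    (hF.1.biUnion_locallyFinite hD hfin _) hcov with h | h
  · obtain ⟨i, -, hi⟩ := hF.exists_subset_of_finite hD hS h
    exact ⟨i, hi⟩
  · obtain ⟨i, hi, hi'⟩ := Set.mem_iUnion₂.mp (h hp)
    exact absurd hi' hi

/-- The identity theorem on a ball: a holomorphic function that vanishes near one point of a ball
vanishes on the ball. It is reduced to one variable by restriction to complex lines. -/
lemma eq_zero_of_eventually_eq_zero {E' : Type*} [NormedAddCommGroup E'] [NormedSpace ℂ E']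
    {f : E' → ℂ} {w q r : E'} {ε : ℝ} (hf : DifferentiableOn ℂ f (Metric.ball w ε))
    (hq : q ∈ Metric.ball w ε) (hr : r ∈ Metric.ball w ε) (h0 : ∀ᶠ x in 𝓝 q, f x = 0) :
    f r = 0 := by
  let l : ℂ → E' := fun t => q + t • (r - q)
  have hl : Differentiable ℂ l := by fun_prop
  let V : Set ℂ := l ⁻¹' Metric.ball w ε
  have hV : IsOpen V := Metric.isOpen_ball.preimage hl.continuous
  have hVc : Convex ℝ V := by
    intro s hs t ht a b ha hb hab
    simp only [V, Set.mem_preimage, mem_ball_iff_norm, l] at hs ht ⊢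
    have habc : (a : ℂ) + b = 1 := by exact_mod_cast hab
    have e : q + (a • s + b • t) • (r - q) - w =
        (a : ℂ) • (q + s • (r - q) - w) + (b : ℂ) • (q + t • (r - q) - w) := by
      rw [Complex.real_smul, Complex.real_smul]
      have hw : q - w = ((a : ℂ) + b) • (q - w) := by rw [habc, one_smul]
      rw [add_sub_right_comm, hw]
      module
    rw [e]
    refine (norm_add_le _ _).trans_lt ?_
    rw [norm_smul, norm_smul, Complex.norm_real, Complex.norm_real, Real.norm_of_nonneg ha,
      Real.norm_of_nonneg hb]
    rcases ha.eq_or_lt with rfl | ha'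
    · have : b = 1 := by linarith
      subst this
      linarith
    · calc _ < a * ε + b * ε := by
            exact add_lt_add_of_lt_of_le (mul_lt_mul_of_pos_left hs ha')
              (mul_le_mul_of_nonneg_left ht.le hb)
        _ = ε := by rw [← add_mul, hab, one_mul]
  have hg : DifferentiableOn ℂ (f ∘ l) V :=
    hf.comp hl.differentiableOn fun t ht => ht
  have h0V : (0 : ℂ) ∈ V := by simpa [V, l] using hq
  have h1V : (1 : ℂ) ∈ V := by simpa [V, l] using hr
  have hev : (f ∘ l) =ᶠ[𝓝 0] 0 := by
    have hc : Filter.Tendsto l (𝓝 0) (𝓝 q) := by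
      have := hl.continuous.tendsto 0
      simpa [l] using this
    exact hc.eventually h0
  have := (hg.analyticOnNhd hV).eqOn_zero_of_preconnected_of_eventuallyEq_zero
    hVc.isPreconnected h0V hev h1V
  simpa [l] using this

/-- An analytic set which is the holomorphic image of a connected open set is irreducible. -/
theorem isIrreducibleAnalytic_image {E' : Type*} [NormedAddCommGroup E'] [NormedSpace ℂ E']
    {W : Set E'} (hW : IsOpen W) (hWc : IsPreconnected W) (hW0 : W.Nonempty) {φ : E' → E}
    (hφ : DifferentiableOn ℂ φ W) (hA : IsAnalyticSubset Ω (φ '' W)) :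
    IsIrreducibleAnalytic Ω (φ '' W) := by
  refine ⟨hA, hW0.image φ, fun A₁ A₂ h1 h2 h => ?_⟩
  by_contra! hne
  obtain ⟨hne1, hne2⟩ := hne
  have hmem : ∀ w ∈ W, φ w ∈ A₁ ∪ A₂ := fun w hw => h ▸ Set.mem_image_of_mem φ hw
  have hmaps : ∀ w ∈ W, φ w ∈ Ω := fun w hw => hA.1 (Set.mem_image_of_mem φ hw)
  have hcont : ∀ w ∈ W, ContinuousAt φ w := fun w hw =>
    (hφ.differentiableAt (hW.mem_nhds hw)).continuousAt
  obtain ⟨w, hw, hw1⟩ : ∃ w ∈ W, φ w ∉ A₁ := by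
    by_contra! hc
    exact hne1 (Set.Subset.antisymm (Set.image_subset_iff.mpr hc) (h ▸ Set.subset_union_left))
  let I : Set E' := interior {w | w ∈ W ∧ φ w ∈ A₂}
  have hwI : w ∈ I := by
    obtain ⟨U, u1, u2, u3, k, f, u4, u5⟩ := h1.2 _ (hmaps w hw)
    have hnot : ∃ i, f i (φ w) ≠ 0 := by
      by_contra! hc
      have : φ w ∈ A₁ ∩ U := u5 ▸ ⟨u2, hc⟩
      exact hw1 this.1
    obtain ⟨i, hi⟩ := hnot
    have c1 : ContinuousAt (fun x => f i (φ x)) w :=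
      ContinuousAt.comp (f := φ) (g := f i)
        ((u4 i).differentiableAt (u1.mem_nhds u2)).continuousAt (hcont w hw)
    rw [mem_interior_iff_mem_nhds]
    filter_upwards [hW.mem_nhds hw, c1.eventually_ne hi,
      (hcont w hw).preimage_mem_nhds (u1.mem_nhds u2)] with x hx hx1 hx2
    refine ⟨hx, (hmem x hx).resolve_left fun hxA => ?_⟩
    have : φ x ∈ A₁ ∩ U := ⟨hxA, hx2⟩
    rw [u5] at this
    exact hx1 (this.2 i)
  have hsub : W ⊆ I := by
    refine hWc.subset_of_closure_inter_subset isOpen_interior ⟨w, hw, hwI⟩ ?_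
    rintro y ⟨hy, hyW⟩
    obtain ⟨U, u1, u2, u3, k, f, u4, u5⟩ := h2.2 _ (hmaps y hyW)
    obtain ⟨ε, hε, hball⟩ := Metric.mem_nhds_iff.mp (Filter.inter_mem (hW.mem_nhds hyW)
      ((hcont y hyW).preimage_mem_nhds (u1.mem_nhds u2)))
    obtain ⟨q, hqI, hq⟩ := Metric.mem_closure_iff.mp hy ε hε
    have hq' : q ∈ Metric.ball y ε := by rw [Metric.mem_ball, dist_comm]; exact hq
    rw [mem_interior_iff_mem_nhds]
    filter_upwards [Metric.ball_mem_nhds y hε] with r hr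
    refine ⟨(hball hr).1, ?_⟩
    have : φ r ∈ A₂ ∩ U := by
      rw [u5]
      refine ⟨(hball hr).2, fun i => ?_⟩
      refine eq_zero_of_eventually_eq_zero (f := fun x => f i (φ x)) (w := y) (ε := ε)
        ((u4 i).comp (hφ.mono fun x hx => (hball hx).1) fun x hx => (hball hx).2) hq' hr ?_
      filter_upwards [isOpen_interior.mem_nhds hqI, Metric.isOpen_ball.mem_nhds hq'] with x hx hx'
      have : φ x ∈ A₂ ∩ U := ⟨(interior_subset hx).2, (hball hx').2⟩
      rw [u5] at this
      exact this.2 i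
    exact this.1
  exact hne2 (Set.Subset.antisymm
    (Set.image_subset_iff.mpr fun x hx => (interior_subset (hsub hx)).2)
    (h ▸ Set.subset_union_right))

end AnalyticSubsets

/-! ### Fixed point sets of modular matrices -/

section FixedPoints

open Complex

lemma differentiable_symMat (i j : Fin 2) : Differentiable ℂ fun z : Fin 3 → ℂ => symMat z i j := by
  fin_cases i <;> fin_cases j <;> simp [symMat] <;> fun_prop

lemma differentiable_num (M : SiegelModularGroup 2) (i j : Fin 2) :
    Differentiable ℂ fun z : Fin 3 → ℂ => num M (symMat z) i j := by
  have h := differentiable_symMat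
  simp only [num, Matrix.add_apply, Matrix.mul_apply, Fin.sum_univ_two]
  exact (((h 0 j).const_mul _).add ((h 1 j).const_mul _)).add_const _

lemma differentiable_denom (M : SiegelModularGroup 2) (i j : Fin 2) :
    Differentiable ℂ fun z : Fin 3 → ℂ => denom M (symMat z) i j := by
  have h := differentiable_symMat
  simp only [denom, Matrix.add_apply, Matrix.mul_apply, Fin.sum_univ_two]
  exact (((h 0 j).const_mul _).add ((h 1 j).const_mul _)).add_const _

lemma differentiableOn_act (M : SiegelModularGroup 2) (i j : Fin 2) :
    DifferentiableOn ℂ (fun z : Fin 3 → ℂ => act M (symMat z) i j) halfSpaceTwo := by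
  have hn := differentiable_num M
  have hd := differentiable_denom M
  have hdet : Differentiable ℂ fun z : Fin 3 → ℂ => (denom M (symMat z)).det := by
    simp only [det_fin_two]
    exact ((hd 0 0).mul (hd 1 1)).sub ((hd 0 1).mul (hd 1 0))
  have hadj : ∀ k l, Differentiable ℂ fun z : Fin 3 → ℂ => (denom M (symMat z)).adjugate k l := by
    intro k l
    simp only [adjugate_fin_two]
    fin_cases k <;> fin_cases l
    · exact hd 1 1
    · exact (hd 0 1).neg
    · exact (hd 1 0).neg
    · exact hd 0 0
  have e : ∀ z : Fin 3 → ℂ, act M (symMat z) i j = ((denom M (symMat z)).det)⁻¹ *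
      (num M (symMat z) i 0 * (denom M (symMat z)).adjugate 0 j +
        num M (symMat z) i 1 * (denom M (symMat z)).adjugate 1 j) := by
    intro z
    rw [act_eq, Matrix.inv_def, Ring.inverse_eq_inv', mul_smul_comm, Matrix.smul_apply,
      smul_eq_mul, Matrix.mul_apply, Fin.sum_univ_two]
  simp only [e]
  refine DifferentiableOn.mul (hdet.differentiableOn.inv fun z hz => det_denom_ne_zero M hz) ?_
  exact (((hn i 0).mul (hadj 0 j)).add ((hn i 1).mul (hadj 1 j))).differentiableOn

lemma isOpen_halfSpaceTwo : IsOpen halfSpaceTwo := by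
  have e : halfSpaceTwo = {z : Fin 3 → ℂ | 0 < (z 0).im} ∩
      {z | 0 < (z 0).im * (z 2).im - (z 1).im ^ 2} := by
    ext z
    exact mem_halfSpaceTwo
  rw [e]
  exact (isOpen_lt continuous_const (by fun_prop)).inter
    (isOpen_lt continuous_const (by fun_prop))

lemma act_eq_self_iff (M : SiegelModularGroup 2) {Z : Matrix (Fin 2) (Fin 2) ℂ}
    (hZ : Z ∈ siegelUpperHalf 2) : act M Z = Z ↔ num M Z = Z * denom M Z := by
  constructor
  · intro h
    have := act_mul_denom M hZ
    rw [h] at this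
    exact this.symm
  · exact fun h => act_eq_of_mul_denom hZ h.symm

lemma isAnalyticSubset_fixedPointSet (M : SiegelModularGroup 2) :
    IsAnalyticSubset halfSpaceTwo (fixedPointSet M) := by
  refine .of_fintype (fun z hz => hz.1) fun p hp => ⟨halfSpaceTwo, isOpen_halfSpaceTwo, hp,
    subset_rfl, Fin 2 × Fin 2, inferInstance, fun i z => num M (symMat z) i.1 i.2 -
      (symMat z * denom M (symMat z)) i.1 i.2, fun i => ?_, ?_⟩
  · have h := differentiable_symMat
    have hd := differentiable_denom M
    simp only [Matrix.mul_apply, Fin.sum_univ_two]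
    exact ((differentiable_num M _ _).sub (((h _ 0).mul (hd 0 _)).add
      ((h _ 1).mul (hd 1 _)))).differentiableOn
  · ext z
    simp only [fixedPointSet, Set.mem_inter_iff, Set.mem_ofPred_eq]
    have : z ∈ halfSpaceTwo → (act M (symMat z) = symMat z ↔ ∀ i : Fin 2 × Fin 2,
        num M (symMat z) i.1 i.2 - (symMat z * denom M (symMat z)) i.1 i.2 = 0) := fun hz => by
      rw [act_eq_self_iff M hz, ← Matrix.ext_iff, Prod.forall]
      simp only [sub_eq_zero]
    tauto

lemma finite_setOf_entries_le (B : ℝ) :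
    {M : SiegelModularGroup 2 | ∀ i j, |(M.1 i j : ℝ)| ≤ B}.Finite := by
  have h : (Set.Icc (fun _ _ => -⌈B⌉ : Fin 2 ⊕ Fin 2 → Fin 2 ⊕ Fin 2 → ℤ)
      (fun _ _ => ⌈B⌉)).Finite := Set.finite_Icc _ _
  have hinj : Set.InjOn (fun (M : SiegelModularGroup 2) (i j : Fin 2 ⊕ Fin 2) => M.1 i j)
      Set.univ := fun M _ M' _ hM => Subtype.ext hM
  refine (Set.Finite.preimage (hinj.mono (Set.subset_univ _)) h).subset fun M hM => ?_
  have key : ∀ x : ℤ, |(x : ℝ)| ≤ B → -⌈B⌉ ≤ x ∧ x ≤ ⌈B⌉ := fun x hx => by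
    have h2 : |(x : ℝ)| ≤ (⌈B⌉ : ℝ) := hx.trans (Int.le_ceil B)
    rw [← Int.cast_abs, Int.cast_le] at h2
    exact abs_le.mp h2
  exact ⟨fun i j => (key _ (hM i j)).1, fun i j => (key _ (hM i j)).2⟩

/-- The entries of the second block row of a matrix that fixes `z` are bounded locally uniformly
in `z`, since `(Im Z)⁻¹ = (C Z + D) (Im Z)⁻¹ (C Z + D)ᴴ`. -/
lemma exists_bound_of_fixed {δ : ℝ} (hδ : 0 < δ) (t K : ℝ) :
    ∃ B : ℝ, ∀ z : Fin 3 → ℂ, z ∈ halfSpaceTwo → δ ≤ (z 0).im * (z 2).im - (z 1).im ^ 2 →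
      (z 0).im + (z 2).im ≤ t → (∀ i, |(z i).re| ≤ K) →
      ∀ M : SiegelModularGroup 2, act M (symMat z) = symMat z →
        ∀ i j, |(blockC M i j : ℝ)| ≤ B ∧ |(blockD M i j : ℝ)| ≤ B := by
  obtain ⟨B, hB⟩ := exists_row_bound hδ t K (t / δ)
  refine ⟨B, fun z hz h1 h2 h3 M hM i => ?_⟩
  obtain ⟨hp, hd⟩ := mem_halfSpaceTwo.mp hz
  have hq : 0 < (z 2).im := by
    by_contra hw
    nlinarith [sq_nonneg (z 1).im]
  have h := imC_inv_act_apply M hz i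
  rw [hM, imC_symMat_inv] at h
  have hL : rowForm z (blockC M i 0) (blockC M i 1) (blockD M i 0) (blockD M i 1) ≤ t / δ := by
    have key : ∀ y : ℝ, 0 ≤ y → y ≤ t →
        ((z 0).im * (z 2).im - (z 1).im ^ 2)⁻¹ * y ≤ t / δ := fun y hy0 hy => by
      rw [inv_mul_eq_div]
      exact div_le_div₀ (hy0.trans hy) hy hδ h1
    obtain ⟨y, hy0, hy, hye⟩ : ∃ y : ℝ, 0 ≤ y ∧ y ≤ t ∧
        (!![((z 2).im : ℂ), -((z 1).im : ℂ); -((z 1).im : ℂ), ((z 0).im : ℂ)] :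
          Matrix (Fin 2) (Fin 2) ℂ) i i = y := by
      fin_cases i
      · exact ⟨(z 2).im, hq.le, by linarith, rfl⟩
      · exact ⟨(z 0).im, hp.le, by linarith, rfl⟩
    rw [Matrix.smul_apply, smul_eq_mul, hye, ← Complex.ofReal_inv, ← Complex.ofReal_mul,
      Complex.ofReal_inj] at h
    rw [← h]
    exact key y hy0 hy
  obtain ⟨b0, b1, b2, b3⟩ := hB z hz h1 h2 h3 _ _ _ _ hL
  intro j
  fin_cases j
  exacts [⟨b0, b2⟩, ⟨b1, b3⟩]

/-- The fixed point sets of the modular matrices form a locally finite family. -/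
theorem exists_isOpen_finite_fixedPointSet {p : Fin 3 → ℂ} (hp : p ∈ halfSpaceTwo) :
    ∃ U, IsOpen U ∧ p ∈ U ∧ {M | (fixedPointSet M ∩ U).Nonempty}.Finite := by
  obtain ⟨-, hd⟩ := mem_halfSpaceTwo.mp hp
  set δ := ((p 0).im * (p 2).im - (p 1).im ^ 2) / 2 with hδe
  have hδ : 0 < δ := by positivity
  set t := (p 0).im + (p 2).im + 1 with ht
  set K := ‖p‖ + 1 with hK
  obtain ⟨B, hB⟩ := exists_bound_of_fixed hδ t K
  have hK0 : 0 ≤ K := by positivity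
  refine ⟨{z | δ < (z 0).im * (z 2).im - (z 1).im ^ 2} ∩ {z | (z 0).im + (z 2).im < t} ∩
    {z | ‖z‖ < K}, ?_, ⟨⟨?_, ?_⟩, ?_⟩, ?_⟩
  · exact ((isOpen_lt continuous_const (by fun_prop)).inter
      (isOpen_lt (by fun_prop) continuous_const)).inter
      (isOpen_lt continuous_norm continuous_const)
  · show δ < _
    linarith
  · show _ < t
    linarith
  · show ‖p‖ < K
    linarith
  · refine (finite_setOf_entries_le (B + 2 * (K * (2 * (B * K) + B)) + 2 * (B * K))).subset ?_
    rintro M ⟨z, ⟨hz, hM⟩, ⟨h1, h2⟩, h3⟩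
    have h1' : δ ≤ (z 0).im * (z 2).im - (z 1).im ^ 2 := le_of_lt h1
    have h2' : (z 0).im + (z 2).im ≤ t := le_of_lt h2
    have hzK : ∀ i, ‖z i‖ ≤ K := fun i => (norm_le_pi_norm z i).trans (le_of_lt h3)
    have h3' : ∀ i, |(z i).re| ≤ K := fun i => (Complex.abs_re_le_norm _).trans (hzK i)
    have b1 := hB z hz h1' h2' h3' M hM
    have hMinv : act M⁻¹ (symMat z) = symMat z := by
      have := act_inv_act M hz
      rwa [hM] at this
    have b2 := hB z hz h1' h2' h3' M⁻¹ hMinv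
    obtain ⟨-, -, -, hDinv⟩ := block_inv M
    have hB0 : 0 ≤ B := (abs_nonneg _).trans (b1 0 0).1
    have hA : ∀ i j, |(blockA M i j : ℝ)| ≤ B := fun i j => by
      have := (b2 j i).2
      rwa [hDinv, transpose_apply] at this
    have hS : ∀ i j, ‖symMat z i j‖ ≤ K := fun i j => by
      fin_cases i <;> fin_cases j <;> simp [symMat, hzK]
    have hint : ∀ x : ℤ, ‖(x : ℂ)‖ = |(x : ℝ)| := fun x => by
      rw [Complex.norm_intCast]
    have hprod : ∀ (x : ℤ) (w : ℂ), |(x : ℝ)| ≤ B → ‖w‖ ≤ K → ‖(x : ℂ) * w‖ ≤ B * K :=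
      fun x w hx hw => by
        rw [norm_mul, hint]
        exact mul_le_mul hx hw (norm_nonneg _) hB0
    have hden : ∀ i j, ‖denom M (symMat z) i j‖ ≤ 2 * (B * K) + B := fun i j => by
      simp only [denom, Matrix.add_apply, Matrix.mul_apply, Fin.sum_univ_two, Matrix.map_apply]
      refine (norm_add_le _ _).trans (add_le_add ((norm_add_le _ _).trans ?_) ?_)
      · have e1 := hprod _ _ (b1 i 0).1 (hS 0 j)
        have e2 := hprod _ _ (b1 i 1).1 (hS 1 j)
        linarith
      · rw [hint]
        exact (b1 i j).2
    have hBB : ∀ i j, |(blockB M i j : ℝ)| ≤ 2 * (K * (2 * (B * K) + B)) + 2 * (B * K) :=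
      fun i j => by
        have e := congrFun (congrFun ((act_eq_self_iff M hz).mp hM) i) j
        simp only [num, Matrix.add_apply, Matrix.mul_apply, Fin.sum_univ_two,
          Matrix.map_apply] at e
        have e' := eq_sub_of_add_eq' e
        rw [← hint, e']
        have hd' : 0 ≤ 2 * (B * K) + B := by positivity
        have p1 : ‖symMat z i 0 * denom M (symMat z) 0 j‖ ≤ K * (2 * (B * K) + B) := by
          rw [norm_mul]
          exact mul_le_mul (hS _ _) (hden _ _) (norm_nonneg _) hK0
        have p2 : ‖symMat z i 1 * denom M (symMat z) 1 j‖ ≤ K * (2 * (B * K) + B) := by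
          rw [norm_mul]
          exact mul_le_mul (hS _ _) (hden _ _) (norm_nonneg _) hK0
        have p3 := hprod _ _ (hA i 0) (hS 0 j)
        have p4 := hprod _ _ (hA i 1) (hS 1 j)
        refine (norm_sub_le _ _).trans (add_le_add ((norm_add_le _ _).trans ?_)
          ((norm_add_le _ _).trans ?_)) <;> linarith
    have q1 : 0 ≤ K * (2 * (B * K) + B) := by positivity
    have q2 : 0 ≤ B * K := by positivity
    rintro (i | i) (j | j)
    · have := hA i j
      change |(blockA M i j : ℝ)| ≤ _
      linarith
    · have := hBB i j
      change |(blockB M i j : ℝ)| ≤ _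
      linarith
    · have := (b1 i j).1
      change |(blockC M i j : ℝ)| ≤ _
      linarith
    · have := (b1 i j).2
      change |(blockD M i j : ℝ)| ≤ _
      linarith

/-! ### Conjugates of the reflection -/

/-- The conjugate of the reflection `z₁ ↦ -z₁` by `g`. -/
def conjReflection (g : SiegelModularGroup 2) : SiegelModularGroup 2 := g⁻¹ * reflection * g

lemma reflection_mul_self : reflection * reflection = 1 := by
  refine Subtype.ext ?_
  rw [reflection, ofBlocks_mul_ofBlocks]
  simp [← fromBlocks_one, Matrix.one_fin_two]

lemma conjReflection_sq (g : SiegelModularGroup 2) : conjReflection g ^ 2 = 1 := by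
  rw [sq, conjReflection]
  calc g⁻¹ * reflection * g * (g⁻¹ * reflection * g) =
      g⁻¹ * (reflection * reflection) * g := by group
    _ = 1 := by rw [reflection_mul_self]; group

lemma act_conjReflection (g : SiegelModularGroup 2) {Z : Matrix (Fin 2) (Fin 2) ℂ}
    (hZ : Z ∈ siegelUpperHalf 2) :
    act g (act (conjReflection g) Z) = act reflection (act g Z) := by
  rw [← act_mul _ _ hZ, ← act_mul _ _ hZ, conjReflection]
  congr 1
  group

lemma act_reflection_eq_self_iff {Z : Matrix (Fin 2) (Fin 2) ℂ} (hZ : Z ∈ siegelUpperHalf 2) :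
    act reflection Z = Z ↔ Z 0 1 = 0 := by
  have h := act_eq_symMat _ hZ act_reflection
  have hs := (mem_siegelUpperHalf_two.mp hZ).1
  rw [h]
  constructor
  · intro h0
    have := congrFun (congrFun h0 0) 1
    simp [symMat, coords] at this
    have h2 : (2 : ℂ) * Z 0 1 = 0 := by linear_combination -this
    simpa using h2
  · intro h0
    ext i j
    fin_cases i <;> fin_cases j <;> simp [symMat, coords, h0, hs]

lemma mem_fixedPointSet_conjReflection {g : SiegelModularGroup 2} {z : Fin 3 → ℂ} :
    z ∈ fixedPointSet (conjReflection g) ↔ z ∈ halfSpaceTwo ∧ act g (symMat z) 0 1 = 0 := by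
  refine and_congr_right fun hz => ?_
  rw [← act_reflection_eq_self_iff (act_mem g hz), ← act_conjReflection g hz]
  constructor
  · intro h; rw [h]
  · intro h
    have := congrArg (act g⁻¹) h
    rwa [act_inv_act g (act_mem _ hz), act_inv_act g hz] at this

/-- The set of pairs of points of the upper half plane, the parameter space of the diagonal. -/
def diagDomain : Set (ℂ × ℂ) := {w | 0 < w.1.im ∧ 0 < w.2.im}

lemma diag_mem {w : ℂ × ℂ} (hw : w ∈ diagDomain) : ![w.1, 0, w.2] ∈ halfSpaceTwo := by
  rw [mem_halfSpaceTwo]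
  simpa using ⟨hw.1, mul_pos hw.1 hw.2⟩

lemma fixedPointSet_conjReflection_eq_image (g : SiegelModularGroup 2) :
    fixedPointSet (conjReflection g) =
      (fun w : ℂ × ℂ => coords (act g⁻¹ (symMat ![w.1, 0, w.2]))) '' diagDomain := by
  ext z
  rw [mem_fixedPointSet_conjReflection]
  constructor
  · rintro ⟨hz, h⟩
    have hm := act_mem g hz
    obtain ⟨h1, h2, h3⟩ := mem_siegelUpperHalf_two.mp hm
    refine ⟨(act g (symMat z) 0 0, act g (symMat z) 1 1), ⟨h2, ?_⟩, ?_⟩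
    · rw [h] at h3
      refine pos_of_mul_pos_right (a := (act g (symMat z) 0 0).im) ?_ h2.le
      simpa using h3
    · have e : symMat ![act g (symMat z) 0 0, 0, act g (symMat z) 1 1] = act g (symMat z) := by
        conv_rhs => rw [← symMat_coords hm.1]
        rw [coords, h]
      simp only
      rw [e, act_inv_act g hz, coords_symMat]
  · rintro ⟨w, hw, rfl⟩
    have hm := act_mem g⁻¹ (diag_mem hw)
    refine ⟨coords_mem hm, ?_⟩
    simp only
    rw [symMat_coords hm.1, act_act_inv g (diag_mem hw)]
    simp [symMat]

lemma isIrreducibleAnalytic_fixedPointSet (g : SiegelModularGroup 2) :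
    IsIrreducibleAnalytic halfSpaceTwo (fixedPointSet (conjReflection g)) := by
  have hA := isAnalyticSubset_fixedPointSet (conjReflection g)
  rw [fixedPointSet_conjReflection_eq_image] at hA ⊢
  have hW : diagDomain = {w : ℂ | 0 < w.im} ×ˢ {w : ℂ | 0 < w.im} := rfl
  refine isIrreducibleAnalytic_image ?_ ?_ ⟨(I, I), by simp [diagDomain]⟩ ?_ hA
  · rw [hW]
    exact (isOpen_lt continuous_const continuous_im).prod (isOpen_lt continuous_const continuous_im)
  · rw [hW]
    exact ((convex_halfSpace_im_gt 0).prod (convex_halfSpace_im_gt 0)).isPreconnected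
  · have hl : Differentiable ℂ fun w : ℂ × ℂ => (![w.1, 0, w.2] : Fin 3 → ℂ) := by
      rw [differentiable_pi]
      intro i
      fin_cases i
      exacts [differentiable_fst, differentiable_const 0, differentiable_snd]
    have h := fun i j => (differentiableOn_act g⁻¹ i j).comp hl.differentiableOn
      fun w (hw : w ∈ diagDomain) => diag_mem hw
    rw [differentiableOn_pi]
    intro i
    fin_cases i
    · exact h 0 0
    · exact h 0 1
    · exact h 1 1

/-- A modular matrix that fixes the diagonal is `±1` or plus or minus the reflection. -/
lemma eq_of_fixes_diag {P : SiegelModularGroup 2}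
    (h : ∀ w ∈ diagDomain, act P (symMat ![w.1, 0, w.2]) = symMat ![w.1, 0, w.2]) :
    (∀ Z ∈ siegelUpperHalf 2, act P Z = Z) ∨ P.1 = reflection.1 ∨ P.1 = -reflection.1 := by
  have key : ∀ w ∈ diagDomain, ∀ i j, num P (symMat ![w.1, 0, w.2]) i j =
      (symMat ![w.1, 0, w.2] * denom P (symMat ![w.1, 0, w.2])) i j := fun w hw i j => by
    rw [(act_eq_self_iff P (diag_mem hw)).mp (h w hw)]
  have k1 := key (I, I) (by simp [diagDomain])
  have k2 := key (2 * I, I) (by simp [diagDomain])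
  have k3 := key (I, 2 * I) (by simp [diagDomain])
  simp only [num, denom, Matrix.add_apply, Matrix.mul_apply, Fin.sum_univ_two, Matrix.map_apply,
    symMat, Fin.forall_fin_two] at k1 k2 k3
  simp at k1 k2 k3
  simp [Complex.ext_iff] at k1 k2 k3
  have real_eq_zero : ∀ x : ℤ, (x : ℝ) = 0 → x = 0 := fun x hx => by exact_mod_cast hx
  obtain ⟨⟨⟨e1, f1⟩, e2, f2⟩, ⟨e3, f3⟩, e4, f4⟩ := k1
  obtain ⟨⟨⟨g1, -⟩, g2, h2⟩, ⟨g3, h3⟩, -⟩ := k2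
  obtain ⟨-, -, g4, -⟩ := k3
  have a01 : blockA P 0 1 = 0 := by
    have : (blockA P 0 1 : ℝ) = blockD P 0 1 := by rw [f2]
    exact real_eq_zero _ (by linarith)
  have a10 : blockA P 1 0 = 0 := by
    have : (blockA P 1 0 : ℝ) = blockD P 1 0 := by rw [f3]
    exact real_eq_zero _ (by linarith)
  have b00 : blockB P 0 0 = 0 := real_eq_zero _ (by linarith)
  have b01 : blockB P 0 1 = 0 := real_eq_zero _ (by linarith)
  have b10 : blockB P 1 0 = 0 := real_eq_zero _ (by linarith)
  have b11 : blockB P 1 1 = 0 := real_eq_zero _ (by linarith)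
  have c00 : blockC P 0 0 = 0 := real_eq_zero _ (by linarith)
  have c01 : blockC P 0 1 = 0 := real_eq_zero _ (by linarith)
  have c10 : blockC P 1 0 = 0 := real_eq_zero _ (by linarith)
  have c11 : blockC P 1 1 = 0 := real_eq_zero _ (by linarith)
  have eA : blockA P = !![blockA P 0 0, 0; 0, blockA P 1 1] := by
    rw [eta_fin_two (blockA P), a01, a10]; simp
  have eB : blockB P = 0 := by
    rw [eta_fin_two (blockB P), b00, b01, b10, b11]; ext i j; fin_cases i <;> fin_cases j <;> rfl
  have eC : blockC P = 0 := by
    rw [eta_fin_two (blockC P), c00, c01, c10, c11]; ext i j; fin_cases i <;> fin_cases j <;> rfl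
  have eD : blockD P = !![blockA P 0 0, 0; 0, blockA P 1 1] := by
    rw [eta_fin_two (blockD P), ← f1, ← f2, ← f3, ← f4, a01, a10]
  have hr := (block_relations P).2.2
  rw [eA, eB, eC, eD] at hr
  have r0 : blockA P 0 0 * blockA P 0 0 = 1 := by
    simpa [Matrix.mul_apply] using congrFun (congrFun hr 0) 0
  have r1 : blockA P 1 1 * blockA P 1 1 = 1 := by
    simpa [Matrix.mul_apply] using congrFun (congrFun hr 1) 1
  have hP := fromBlocks_block P
  rw [eA, eB, eC, eD] at hP
  have scalar : blockA P 0 0 = blockA P 1 1 → ∀ Z ∈ siegelUpperHalf 2, act P Z = Z := by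
    intro hs Z hZ
    rw [act_eq_self_iff P hZ, num, denom, eA, eB, eC, eD, hs]
    ext i j
    fin_cases i <;> fin_cases j <;> simp [Matrix.mul_apply, mul_comm]
  rcases mul_self_eq_one_iff.mp r0 with r0 | r0 <;>
    rcases mul_self_eq_one_iff.mp r1 with r1 | r1
  · exact Or.inl (scalar (by rw [r0, r1]))
  · refine Or.inr (Or.inl ?_)
    rw [← hP, r0, r1]
    rfl
  · refine Or.inr (Or.inr ?_)
    rw [← hP, r0, r1, reflection, ofBlocks, fromBlocks_neg]
    congr 1 <;> ext i j <;> fin_cases i <;> fin_cases j <;> rfl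
  · exact Or.inl (scalar (by rw [r0, r1]))

end FixedPoints

/-! ### The components of the zero locus -/

section Components

open Complex

lemma mem_omegaZeroLocus {N : Finset (Characteristic 2)} {z : Fin 3 → ℂ} :
    z ∈ omegaZeroLocus N ↔ z ∈ halfSpaceTwo ∧ ∃ m ∈ N, theta m (symMat z) = 0 := by
  refine and_congr_right fun _ => ?_
  rw [omegaForm, smul_eq_zero, or_iff_left (Module.Basis.det_ne_zero _), thetaProd,
    Finset.prod_eq_zero_iff]

lemma ThetaCovariance.theta_eq_zero_iff {M : SiegelModularGroup 2}
    {π : Equiv.Perm (Characteristic 2)} {c : Characteristic 2 → ℂ}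
    {s : Matrix (Fin 2) (Fin 2) ℂ → ℂ} (h : ThetaCovariance M π c s)
    {Z : Matrix (Fin 2) (Fin 2) ℂ} (hZ : Z ∈ siegelUpperHalf 2) (m : Characteristic 2) :
    theta (π m) (act M Z) = 0 ↔ theta m Z = 0 := by
  rw [(h.transforms Z hZ).2, mul_eq_zero,
    or_iff_right (mul_ne_zero (h.const_ne_zero m) (h.factor_ne_zero hZ))]

lemma isEvenChar_one : IsEvenChar ((1, 1) : Characteristic 2) := by decide

/-- The modular matrices `M` that are conjugate to the reflection by some `g` which moves an
element of `N` to the characteristic consisting of ones. -/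
def IsThetaInvolution (N : Finset (Characteristic 2)) (M : SiegelModularGroup 2) : Prop :=
  ∃ g π c s, ThetaCovariance g π c s ∧ M = conjReflection g ∧ ∃ m ∈ N, π m = (1, 1)

lemma IsThetaInvolution.fixedPointSet_subset {N : Finset (Characteristic 2)}
    {M : SiegelModularGroup 2} (hM : IsThetaInvolution N M) :
    fixedPointSet M ⊆ omegaZeroLocus N := by
  obtain ⟨g, π, c, s, h, rfl, m, hm, hπ⟩ := hM
  intro z hz
  obtain ⟨hz, h0⟩ := mem_fixedPointSet_conjReflection.mp hz
  refine mem_omegaZeroLocus.mpr ⟨hz, m, hm, ?_⟩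
  rw [← h.theta_eq_zero_iff hz, hπ]
  have hg := act_mem g hz
  have e := theta_act_reflection hg isEvenChar_one
  rw [(act_reflection_eq_self_iff hg).mpr h0, if_pos rfl] at e
  linear_combination e / 2

/-- A zero of an even theta constant is moved by reduction to a point of the diagonal. -/
lemma exists_isThetaInvolution {N : Finset (Characteristic 2)} (hN : ∀ m ∈ N, IsEvenChar m)
    {z : Fin 3 → ℂ} (hz : z ∈ omegaZeroLocus N) :
    ∃ M, IsThetaInvolution N M ∧ z ∈ fixedPointSet M := by
  obtain ⟨hz, m, hm, h0⟩ := mem_omegaZeroLocus.mp hz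
  obtain ⟨g, ⟨π, c, s, h⟩, hr⟩ := exists_isReduced hz
  have hg := act_mem g hz
  have h1 : theta (π m) (symMat (coords (act g (symMat z)))) = 0 := by
    rwa [symMat_coords hg.1, h.theta_eq_zero_iff hz]
  obtain ⟨h2, h3⟩ := eq_one_and_eq_zero_of_theta_eq_zero (coords_mem hg) hr
    ((h.even_iff m).mpr (hN m hm)) h1
  exact ⟨conjReflection g, ⟨g, π, c, s, h, rfl, m, hm, h2⟩,
    mem_fixedPointSet_conjReflection.mpr ⟨hz, h3⟩⟩

theorem IsIrreducibleComponent.exists_eq_fixedPointSet {N : Finset (Characteristic 2)}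
    (hN : ∀ m ∈ N, IsEvenChar m) {F : Set (Fin 3 → ℂ)}
    (hF : IsIrreducibleComponent halfSpaceTwo (omegaZeroLocus N) F) :
    ∃ M, IsThetaInvolution N M ∧ F = fixedPointSet M := by
  obtain ⟨hFirr, hFX⟩ := hF.prop
  obtain ⟨⟨M, hM⟩, hFM⟩ := hFirr.exists_subset
    (D := fun M : {M // IsThetaInvolution N M} => fixedPointSet M.1)
    (fun M => isAnalyticSubset_fixedPointSet M.1)
    (fun p hp => by
      obtain ⟨U, h1, h2, h3⟩ := exists_isOpen_finite_fixedPointSet hp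
      exact ⟨U, h1, h2, Set.Finite.preimage (f := Subtype.val) Subtype.val_injective.injOn h3⟩)
    (fun z hz => by
      obtain ⟨M, hM, hzM⟩ := exists_isThetaInvolution hN (hFX hz)
      exact Set.mem_iUnion.mpr ⟨⟨M, hM⟩, hzM⟩)
  refine ⟨M, hM, hFM.antisymm (hF.le_of_ge ⟨?_, hM.fixedPointSet_subset⟩ hFM)⟩
  obtain ⟨g, -, -, -, -, rfl, -⟩ := hM
  exact isIrreducibleAnalytic_fixedPointSet g

/-- Up to sign, the involution is determined by its fixed point set. -/
theorem eq_or_eq_neg_of_fixedPointSet_eq {g M : SiegelModularGroup 2}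
    (h : fixedPointSet M = fixedPointSet (conjReflection g)) :
    M.1 = (conjReflection g).1 ∨ M.1 = -(conjReflection g).1 := by
  have hM : M = g⁻¹ * (g * M * g⁻¹) * g := by group
  have hP : ∀ w ∈ diagDomain, act (g * M * g⁻¹) (symMat ![w.1, 0, w.2]) =
      symMat ![w.1, 0, w.2] := by
    intro w hw
    have hw' := diag_mem hw
    have hm := act_mem g⁻¹ hw'
    have h1 : coords (act g⁻¹ (symMat ![w.1, 0, w.2])) ∈ fixedPointSet M := by
      rw [h, fixedPointSet_conjReflection_eq_image]
      exact ⟨w, hw, rfl⟩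
    have h2 := h1.2
    rw [symMat_coords hm.1] at h2
    rw [act_mul _ _ hw', act_mul _ _ hm, h2, act_act_inv g hw']
  have hval : ∀ P Q : SiegelModularGroup 2, (P * Q).1 = P.1 * Q.1 := fun _ _ => rfl
  rcases eq_of_fixes_diag hP with h1 | h1 | h1
  · -- the fixed point set would be the whole half plane
    exfalso
    have hz : ![2 * I, 1, 2 * I] ∈ halfSpaceTwo := by
      rw [mem_halfSpaceTwo]; simp
    have hm := act_mem g⁻¹ hz
    have h2 : coords (act g⁻¹ (symMat ![2 * I, 1, 2 * I])) ∈ fixedPointSet M := by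
      refine ⟨coords_mem hm, ?_⟩
      have h3 := congrArg (act g⁻¹) (h1 _ hz)
      rw [symMat_coords hm.1]
      rwa [act_mul _ _ hz, act_mul _ _ hm, act_inv_act g (act_mem M hm)] at h3
    rw [h, mem_fixedPointSet_conjReflection, symMat_coords hm.1, act_act_inv g hz] at h2
    simpa [symMat] using h2.2
  · left
    rw [hM, conjReflection, Subtype.ext h1]
  · right
    rw [hM, hval, hval, h1, conjReflection, hval, hval, mul_neg, neg_mul]

/-! ### The congruence conditions -/

lemma reflection_mem_principalCongruence : reflection ∈ principalCongruence 2 2 := by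
  show reflection.1.map (fun x : ℤ => (x : ZMod 2)) = 1
  rw [reflection, ofBlocks, fromBlocks_map, ← fromBlocks_one]
  congr 1 <;> ext i j <;> fin_cases i <;> fin_cases j <;> simp

lemma conjReflection_mem_principalCongruence (g : SiegelModularGroup 2) :
    conjReflection g ∈ principalCongruence 2 2 := by
  have hmul : ∀ P Q : SiegelModularGroup 2, (P * Q).1.map (fun x : ℤ => (x : ZMod 2)) =
      P.1.map (fun x : ℤ => (x : ZMod 2)) * Q.1.map (fun x : ℤ => (x : ZMod 2)) := fun P Q =>
    Matrix.map_mul (f := Int.castRingHom (ZMod 2))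
  have hr : reflection.1.map (fun x : ℤ => (x : ZMod 2)) = 1 := reflection_mem_principalCongruence
  show (conjReflection g).1.map (fun x : ℤ => (x : ZMod 2)) = 1
  rw [conjReflection, hmul, hmul, hr, mul_one, ← hmul, inv_mul_cancel]
  exact Matrix.map_one _ Int.cast_zero Int.cast_one

lemma block_map_of_mem_principalCongruence {l : ℕ} {M : SiegelModularGroup 2}
    (hM : M ∈ principalCongruence 2 l) :
    (blockA M).map (fun x : ℤ => (x : ZMod l)) = 1 ∧
    (blockB M).map (fun x : ℤ => (x : ZMod l)) = 0 ∧
    (blockC M).map (fun x : ℤ => (x : ZMod l)) = 0 ∧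
    (blockD M).map (fun x : ℤ => (x : ZMod l)) = 1 := by
  have h : M.1.map (fun x : ℤ => (x : ZMod l)) = 1 := hM
  rwa [← fromBlocks_block, fromBlocks_map, ← fromBlocks_one, fromBlocks_inj] at h

lemma charAct_of_mem_principalCongruence {M : SiegelModularGroup 2}
    (hM : M ∈ principalCongruence 2 2) (m : Characteristic 2) : charAct M m = m := by
  obtain ⟨hA, hB, hC, hD⟩ := block_map_of_mem_principalCongruence hM
  simp only [charAct, hA, hB, hC, hD]
  ext <;> simp

/-- An involution congruent to `1` modulo `2` lies in Igusa's subgroup, because its blocks `B` and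
`C` are alternating. -/
lemma mem_igusaSubgroup_of_sq_eq_one {M : SiegelModularGroup 2}
    (hM : M ∈ principalCongruence 2 2) (h : M ^ 2 = 1) : M ∈ igusaSubgroup 2 2 := by
  obtain ⟨hA, hB, hC, hD⟩ := block_map_of_mem_principalCongruence hM
  have hinv : M⁻¹ = M := inv_eq_of_mul_eq_one_right (by rw [← sq, h])
  obtain ⟨-, iB, iC, -⟩ := block_inv M
  rw [hinv] at iB iC
  have dvd_of : ∀ {X : Matrix (Fin 2) (Fin 2) ℤ} {i j},
      (X.map (fun x : ℤ => (x : ZMod 2))) i j = 0 → (2 : ℤ) ∣ X i j := fun {X i j} hX =>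
    (ZMod.intCast_zmod_eq_zero_iff_dvd _ 2).mp hX
  have hdiag : ∀ {X : Matrix (Fin 2) (Fin 2) ℤ}, X = -Xᵀ → ∀ i, X i i = 0 := fun {X} hX i => by
    have := congrFun (congrFun hX i) i
    simp only [Matrix.neg_apply, transpose_apply] at this
    linarith
  have hB0 := hdiag iB
  have hC0 := hdiag iC
  have off : ∀ {i j : Fin 2}, i ≠ j → (2 : ℤ) ∣ blockA M i j ∧ (2 : ℤ) ∣ blockB M i j ∧
      (2 : ℤ) ∣ blockC M i j ∧ (2 : ℤ) ∣ blockD M i j := fun {i j} hij =>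
    ⟨dvd_of (by rw [hA, one_apply_ne hij]), dvd_of (by rw [hB]; rfl), dvd_of (by rw [hC]; rfl),
      dvd_of (by rw [hD, one_apply_ne hij])⟩
  refine ⟨hM, fun i => ?_⟩
  simp only [Matrix.mul_apply, transpose_apply, Fin.sum_univ_two, Nat.cast_ofNat]
  obtain ⟨a, b, c, d⟩ := off (i := 0) (j := 1) (by decide)
  obtain ⟨a', b', c', d'⟩ := off (i := 1) (j := 0) (by decide)
  fin_cases i
  · simpa [hB0, hC0] using ⟨mul_dvd_mul a b, mul_dvd_mul c d⟩
  · simpa [hB0, hC0] using ⟨mul_dvd_mul a' b', mul_dvd_mul c' d'⟩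

/-! ### The multiplier of the product of theta constants -/

lemma IsComplementarySextuple.isEvenChar {N : Finset (Characteristic 2)}
    (hN : IsComplementarySextuple N) : ∀ m ∈ N, IsEvenChar m := by
  obtain ⟨Q, -, rfl⟩ := hN
  intro m hm
  exact (Finset.mem_filter.mp (Finset.mem_sdiff.mp hm).1).2

lemma IsComplementarySextuple.card_eq {N : Finset (Characteristic 2)}
    (hN : IsComplementarySextuple N) : N.card = 6 := by
  obtain ⟨Q, ⟨hQ, hQe, -⟩, rfl⟩ := hN
  have hsub : Q ⊆ evenChars := fun m hm => Finset.mem_filter.mpr ⟨Finset.mem_univ _, hQe m hm⟩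
  have h10 : evenChars.card = 10 := by decide
  rw [Finset.card_sdiff_of_subset hsub, hQ, h10]

lemma det_denom_reflection (Z : Matrix (Fin 2) (Fin 2) ℂ) : (denom reflection Z).det = -1 := by
  simp [denom, reflection, ofBlocks, blockC, blockD, det_fin_two]

/-- The reflection changes the sign of exactly one factor of the product, and its automorphy
factor is `-1`, so that the two signs cancel in weight `3`. -/
theorem thetaProd_act_of_isThetaInvolution {N : Finset (Characteristic 2)}
    (hN : ∀ m ∈ N, IsEvenChar m) (hcard : N.card = 6) {M : SiegelModularGroup 2}
    (hM : IsThetaInvolution N M) {Z : Matrix (Fin 2) (Fin 2) ℂ} (hZ : Z ∈ siegelUpperHalf 2) :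
    thetaProd N (act M Z) = (denom M Z).det ^ 3 * thetaProd N Z := by
  obtain ⟨g, π, c, s, h, rfl, n, hn, hπ⟩ := hM
  have hMZ := act_mem (conjReflection g) hZ
  have hg := act_mem g hZ
  have each : ∀ m ∈ N, s (act (conjReflection g) Z) * theta m (act (conjReflection g) Z) =
      (if m = n then -1 else 1) * (s Z * theta m Z) := by
    intro m hm
    have e1 := (h.transforms _ hMZ).2 m
    have e2 := (h.transforms _ hZ).2 m
    rw [act_conjReflection g hZ, theta_act_reflection hg ((h.even_iff m).mpr (hN m hm)), e2,
      ← hπ] at e1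
    simp only [π.injective.eq_iff] at e1
    refine mul_left_cancel₀ (h.const_ne_zero m) ?_
    linear_combination -e1
  have hprod := Finset.prod_congr rfl each
  rw [Finset.prod_mul_distrib, Finset.prod_mul_distrib, Finset.prod_mul_distrib,
    Finset.prod_const, Finset.prod_const, hcard, Finset.prod_ite_eq' N n, if_pos hn,
    show ∀ x : ℂ, x ^ 6 = (x ^ 2) ^ 3 from fun x => by ring,
    show ∀ x : ℂ, x ^ 6 = (x ^ 2) ^ 3 from fun x => by ring, (h.transforms _ hMZ).1,
    (h.transforms _ hZ).1] at hprod
  -- both sides of `g * M = reflection * g` in the cocycle relation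
  have hco : (denom g (act (conjReflection g) Z)).det * (denom (conjReflection g) Z).det =
      -(denom g Z).det := by
    rw [← det_mul, ← denom_mul _ _ hZ,
      show g * conjReflection g = reflection * g by rw [conjReflection]; group,
      denom_mul _ _ hZ, det_mul, det_denom_reflection, neg_one_mul]
  have hj := det_denom_ne_zero g hMZ
  refine mul_left_cancel₀ (pow_ne_zero 3 hj) ?_
  change _ * ∏ m ∈ N, _ = _ * (_ * ∏ m ∈ N, _)
  rw [hprod]
  linear_combination (-(∏ m ∈ N, theta m Z)) * congrArg (· ^ 3) hco

lemma conjReflection_mem_sextupleGroup (N : Finset (Characteristic 2))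
    (g : SiegelModularGroup 2) : conjReflection g ∈ sextupleGroup N := by
  have h : charAct (conjReflection g) = id :=
    funext (charAct_of_mem_principalCongruence (conjReflection_mem_principalCongruence g))
  rw [sextupleGroup, Set.mem_ofPred_eq, h, Finset.image_id]

end Components
end SiegelTheta

end

theorem proposition1p3 (N : Finset (SiegelTheta.Characteristic 2))
    (hN : SiegelTheta.IsComplementarySextuple N)
    (F : Set (Fin 3 → ℂ))
    (hF : SiegelTheta.IsIrreducibleComponent SiegelTheta.halfSpaceTwo
      (SiegelTheta.omegaZeroLocus N) F) :
    ∃ M : SiegelTheta.SiegelModularGroup 2,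
      SiegelTheta.fixedPointSet M = F ∧
      M ^ 2 = 1 ∧
      M ∈ SiegelTheta.igusaSubgroup 2 2 ∩ SiegelTheta.sextupleKernel N ∧
      ∀ M' : SiegelTheta.SiegelModularGroup 2, SiegelTheta.fixedPointSet M' = F →
        (M' : Matrix (Fin 2 ⊕ Fin 2) (Fin 2 ⊕ Fin 2) ℤ) = M ∨
        (M' : Matrix (Fin 2 ⊕ Fin 2) (Fin 2 ⊕ Fin 2) ℤ) = -M := by
  obtain ⟨M, hM, rfl⟩ := hF.exists_eq_fixedPointSet hN.isEvenChar
  have hker := fun Z hZ =>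
    SiegelTheta.thetaProd_act_of_isThetaInvolution hN.isEvenChar hN.card_eq hM (Z := Z) hZ
  obtain ⟨g, -, -, -, -, rfl, -⟩ := hM
  have hsq := SiegelTheta.conjReflection_sq g
  exact ⟨_, rfl, hsq, ⟨SiegelTheta.mem_igusaSubgroup_of_sq_eq_one
    (SiegelTheta.conjReflection_mem_principalCongruence g) hsq,
    SiegelTheta.conjReflection_mem_sextupleGroup N g, hker⟩,
    fun M' h => SiegelTheta.eq_or_eq_neg_of_fixedPointSet_eq h⟩
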